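/- Let $k,d\in\mathbb N$ with $d\ge 1$, $k>d/2$, and let $c>1$. Functions live on the torus $\mathbb T^d=\mathbb R^d/\mathbb Z^d$. Let $H^k_0(\mathbb T^d)$ be the space of real mean-zero functions in $H^k(\mathbb T^d)$, each identified with its continuous representative, with inner product $\langle f,g\rangle_{H^k_0}=\langle D^kf,D^kg\rangle_{L^2}=\sum_{i_1,\dots,i_k=1}^d\int_{\mathbb T^d}\partial_{i_1}\cdots\partial_{i_k}f\;\partial_{i_1}\cdots\partial_{i_k}g\,dx$ and norm $\|D^kf\|_{L^2}$. A cube is a set $B=\prod_{i=1}^d[a_i,a_i+h)\subseteq[0,1]^d$ with $0<h\le1$; $|B|$ denotes its volume. A system $\mathcal B$ of cubes is normal with constant $c$ if every cube $B$ contains some $\tilde B\in\mathcal B$ with $|\tilde B|\ge|B|/c$. For $n=N^d$ with $N\in\mathbb N$ let $\Gamma_n=\{(\tau_1/N,\dots,\tau_d/N):\tau_i\in\{0,\dots,N-1\}\}$ and $S_nf=(f(x))_{x\in\Gamma_n}$. For $y,\omega\in\mathbb R^{\Gamma_n}$ put $$\|y\|_{\mathcal B}=\sup_{B\in\mathcal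 B}\frac{\bigl|\sum_{x\in\Gamma_n\cap B}y(x)\bigr|}{\sqrt{\#(\Gamma_n\cap B)}},\qquad \|\omega\|_{\mathcal B^*}=\sup\Bigl\{\sum_{x\in\Gamma_n}\omega(x)v(x):\ v\in\mathbb R^{\Gamma_n},\ \|v\|_{\mathcal B}\le1\Bigr\}\in[0,\infty],$$ where the quotient is $0$ if $\Gamma_n\cap B=\emptyset$. Let $S_n^*:\mathbb R^{\Gamma_n}\to H^k_0(\mathbb T^d)$ be the adjoint of $S_n$, given by $\sum_{x\in\Gamma_n}u(x)\omega(x)=\langle u,S_n^*\omega\rangle_{H^k_0}$ for all $u\in H^k_0(\mathbb T^d)$. Given $y_n\in\mathbb R^{\Gamma_n}$ and $\gamma_n\in\mathbb R$, a MIND estimator $\hat f_{\gamma_n}$ is a minimizer of $\frac12\|D^kg\|_{L^2}^2$ over all $g\in H^k_0(\mathbb T^d)$ with $\|S_ng-y_n\|_{\mathcal B}\le\gamma_n$. For $f\in H^k_0(\mathbb T^d)$ define, for $t\ge0$, $$d_n(t)=\min_{\|\omega\|_{\mathcal B^*}\le t}\|D^kS_n^*\omega-D^kf\|_{L^2},\qquad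 c_n=\min_{t\ge0}\bigl(d_n(t)+(\gamma_nt)^{1/2}\bigr).$$ For $1\le q\le\infty$ let $\vartheta=\frac{k}{2k+d}$ if $q\le\frac{4k+2d}{d}$, $\vartheta=\frac{k-d/2+d/q}{2k}$ if $q\ge\frac{4k+2d}{d}$ (with $d/\infty=0$), and $\vartheta'=2k\vartheta/d$. Theorem. There exist $C>0$ and $n_0\in\mathbb N$, depending only on $k$, $d$ and $c$, such that for all $1\le q\le\infty$, every system $\mathcal B$ that is normal with constant $c$, every $n=N^d\ge n_0$, all $f\in H^k_0(\mathbb T^d)$, $y_n\in\mathbb R^{\Gamma_n}$ and $\gamma_n\in\mathbb R$ with $\|S_nf-y_n\|_{\mathcal B}\le\gamma_n$, and every MIND estimator $\hat f_{\gamma_n}$, $$\|\hat f_{\gamma_n}-f\|_{L^q}\le C\max\Bigl\{\frac{\gamma_n^{2\vartheta}c_n^{1-2\vartheta}}{n^{\vartheta}},\ \frac{\gamma_n}{n^{1/2}},\ \frac{c_n}{n^{\vartheta'}}\Bigr\}.$$ -/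

import Mathlib

open MeasureTheory
open scoped NNReal ENNReal

noncomputable section

namespace MIND

/-! ### Periodic functions and Sobolev spaces on the torus `ℝ^d / ℤ^d`

Functions on the torus are represented by `ℤ^d`-periodic functions on `ℝ^d`; integrals and
`L^q`-norms over the torus are taken over the fundamental domain `[0,1]^d`. -/

/-- Lebesgue measure on the fundamental domain `[0,1]^d`. -/
def torusMeasure (d : ℕ) : Measure (Fin d → ℝ) :=
  volume.restrict (Set.Icc (0 : Fin d → ℝ) 1)

/-- `f` is `ℤ^d`-periodic, that is, a function on the torus. -/
def IsPeriodic {d : ℕ} (f : (Fin d → ℝ) → ℝ) : Prop :=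
  ∀ (x : Fin d → ℝ) (z : Fin d → ℤ), f (fun i => x i + (z i : ℝ)) = f x

/-- The classical iterated partial derivative `∂_{I 0} ⋯ ∂_{I (m-1)} φ`. -/
def partialDeriv {d m : ℕ} (I : Fin m → Fin d) (φ : (Fin d → ℝ) → ℝ) (x : Fin d → ℝ) : ℝ :=
  iteratedFDeriv ℝ m φ x (fun j => Pi.single (I j) (1 : ℝ))

/-- `g` belongs to `L²` of the torus and is the weak partial derivative
`∂_{I 0} ⋯ ∂_{I (m-1)} f` on the torus: the test functions are the smooth periodic functions. -/
def IsWeakDeriv {d m : ℕ} (I : Fin m → Fin d) (f g : (Fin d → ℝ) → ℝ) : Prop :=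
  MemLp g 2 (torusMeasure d) ∧
    ∀ φ : (Fin d → ℝ) → ℝ, ContDiff ℝ ((⊤ : ℕ∞) : WithTop ℕ∞) φ → IsPeriodic φ →
      ∫ x, f x * partialDeriv I φ x ∂(torusMeasure d)
        = (-1 : ℝ) ^ m * ∫ x, g x * φ x ∂(torusMeasure d)

/-- The space `H^k_0` of the torus: mean zero functions all of whose weak partial derivatives up to
order `k` are in `L²`. It is only used for `k > d/2`, where every Sobolev function has a unique
continuous representative; elements of `H^k_0` are identified with this representative. -/
def SobolevZero (k d : ℕ) : Set ((Fin d → ℝ) → ℝ) :=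
  {f | Continuous f ∧ IsPeriodic f ∧ ∫ x, f x ∂(torusMeasure d) = 0 ∧
    ∀ m : ℕ, m ≤ k → ∀ I : Fin m → Fin d, ∃ g, IsWeakDeriv I f g}

open Classical in
/-- A choice (unique almost everywhere on `[0,1]^d`) of the weak partial derivative of `f`. -/
def weakDeriv {d m : ℕ} (I : Fin m → Fin d) (f : (Fin d → ℝ) → ℝ) : (Fin d → ℝ) → ℝ :=
  if h : ∃ g, IsWeakDeriv I f g then h.choose else 0

/-- The inner product `⟨D^k f, D^k g⟩_{L²}` of `H^k_0`, where `D^k f` is the tensor of all `k`-th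
order partial derivatives. -/
def sobolevInner (k : ℕ) {d : ℕ} (f g : (Fin d → ℝ) → ℝ) : ℝ :=
  ∑ I : Fin k → Fin d, ∫ x, weakDeriv I f x * weakDeriv I g x ∂(torusMeasure d)

/-- The homogeneous Sobolev norm `‖D^k f‖_{L²}`. -/
def sobolevNorm (k : ℕ) {d : ℕ} (f : (Fin d → ℝ) → ℝ) : ℝ :=
  Real.sqrt (sobolevInner k f f)

/-! ### The grid and the sampling operator

The grid with `n = N ^ d` points is indexed by `Fin d → Fin N`. -/

/-- The grid point `(τ_1 / N, …, τ_d / N)`. -/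
def gridPoint {d N : ℕ} (τ : Fin d → Fin N) : Fin d → ℝ :=
  fun i => ((τ i : ℕ) : ℝ) / (N : ℝ)

/-- The sampling operator. -/
def sample {d : ℕ} (N : ℕ) (f : (Fin d → ℝ) → ℝ) : (Fin d → Fin N) → ℝ :=
  fun τ => f (gridPoint τ)

/-! ### Systems of cubes and the multiresolution norm -/

/-- `B` is a cube `∏ [a_i, a_i + h)` contained in `[0,1]^d`, with `0 < h ≤ 1`. -/
def IsCube {d : ℕ} (B : Set (Fin d → ℝ)) : Prop :=
  ∃ (a : Fin d → ℝ) (h : ℝ), 0 < h ∧ h ≤ 1 ∧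
    B = Set.univ.pi (fun i => Set.Ico (a i) (a i + h)) ∧ B ⊆ Set.Icc 0 1

/-- `𝓑` is a normal system of cubes with normality constant `c`. -/
def IsNormalSystem {d : ℕ} (c : ℝ) (𝓑 : Set (Set (Fin d → ℝ))) : Prop :=
  1 < c ∧ (∀ B ∈ 𝓑, IsCube B) ∧
    ∀ B : Set (Fin d → ℝ), IsCube B →
      ∃ B' ∈ 𝓑, B' ⊆ B ∧ volume.real B / c ≤ volume.real B'

open Classical in
/-- The indices of the grid points lying in `B`. -/
def gridIn {d : ℕ} (N : ℕ) (B : Set (Fin d → ℝ)) : Finset (Fin d → Fin N) :=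
  Finset.univ.filter (fun τ => gridPoint τ ∈ B)

/-- The multiresolution norm `‖y‖_𝓑`. A cube without grid points contributes `0 / √0 = 0`. -/
def multiresNorm {d N : ℕ} (𝓑 : Set (Set (Fin d → ℝ))) (y : (Fin d → Fin N) → ℝ) : ℝ :=
  ⨆ B : 𝓑, |∑ τ ∈ gridIn N (B : Set (Fin d → ℝ)), y τ| /
    Real.sqrt ((gridIn N (B : Set (Fin d → ℝ))).card : ℝ)

/-- The dual multiresolution norm `‖ω‖_{𝓑*}`, with values in `[0,∞]`; it is finite for every `ω` as
soon as `‖·‖_𝓑` is a norm. (The supremum is over a set symmetric about `0`, so nothing is lost by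
`ENNReal.ofReal`.) -/
def dualMultiresNorm {d N : ℕ} (𝓑 : Set (Set (Fin d → ℝ))) (ω : (Fin d → Fin N) → ℝ) : ℝ≥0∞ :=
  ⨆ (v : (Fin d → Fin N) → ℝ) (_ : multiresNorm 𝓑 v ≤ 1), ENNReal.ofReal (∑ τ, ω τ * v τ)

/-! ### The estimator and the distance function -/

/-- `f'` is a MIND estimator: it minimizes `½ ‖D^k g‖²` over all `g ∈ H^k_0` satisfying the
constraint `‖S_n g - y‖_𝓑 ≤ γ`. -/
def IsMINDEstimator (k : ℕ) {d N : ℕ} (𝓑 : Set (Set (Fin d → ℝ))) (y : (Fin d → Fin N) → ℝ)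
    (γ : ℝ) (f' : (Fin d → ℝ) → ℝ) : Prop :=
  (f' ∈ SobolevZero k d ∧ multiresNorm 𝓑 (sample N f' - y) ≤ γ) ∧
    ∀ g ∈ SobolevZero k d, multiresNorm 𝓑 (sample N g - y) ≤ γ →
      1 / 2 * sobolevNorm k f' ^ 2 ≤ 1 / 2 * sobolevNorm k g ^ 2

/-- `w = S_n^* ω`, for the adjoint of the sampling operator on `H^k_0` (`k > d/2`): `w` is the unique
element of `H^k_0` with `∑_x u(x) ω(x) = ⟨u, w⟩_{H^k_0}` for all `u ∈ H^k_0`. -/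
def IsAdjointSample (k : ℕ) {d N : ℕ} (ω : (Fin d → Fin N) → ℝ) (w : (Fin d → ℝ) → ℝ) : Prop :=
  w ∈ SobolevZero k d ∧
    ∀ u ∈ SobolevZero k d, ∑ τ, sample N u τ * ω τ = sobolevInner k u w

/-- The multiscale distance function `d_n(t)` of `f`, `n = N ^ d`: the minimum of
`‖D^k S_n^* ω - D^k f‖_{L²}` over all `ω` with `‖ω‖_{𝓑*} ≤ t`. -/
def distFun (k : ℕ) {d : ℕ} (N : ℕ) (𝓑 : Set (Set (Fin d → ℝ))) (f : (Fin d → ℝ) → ℝ)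
    (t : ℝ≥0) : ℝ :=
  sInf {r : ℝ | ∃ (ω : (Fin d → Fin N) → ℝ) (w : (Fin d → ℝ) → ℝ),
    dualMultiresNorm 𝓑 ω ≤ (t : ℝ≥0∞) ∧ IsAdjointSample k ω w ∧ r = sobolevNorm k (w - f)}

/-- `c_n = min_{t ≥ 0} (d_n(t) + (γ t)^{1/2})`, `n = N ^ d`. -/
def cMin (k : ℕ) {d : ℕ} (N : ℕ) (𝓑 : Set (Set (Fin d → ℝ))) (f : (Fin d → ℝ) → ℝ)
    (γ : ℝ) : ℝ :=
  ⨅ t : ℝ≥0, (distFun k N 𝓑 f t + Real.sqrt (γ * t))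

open Classical in
/-- The exponent `ϑ(k, d, q)`; for `q = ∞` the term `d / q` is `0`. -/
def theta (k d : ℕ) (q : ℝ≥0∞) : ℝ :=
  if q ≤ ENNReal.ofReal ((4 * k + 2 * d) / d) then (k : ℝ) / (2 * k + d)
  else (k - d / 2 + d * (q⁻¹).toReal) / (2 * k)

/-- The exponent `ϑ' = 2 k ϑ / d`. -/
def theta' (k d : ℕ) (q : ℝ≥0∞) : ℝ :=
  2 * k * theta k d q / d

end MIND

end

/-! Put `u = f' - f`. Both functions satisfy the constraint, so the multiresolution norm of the
samples of `u` is at most `2γ`. Minimality of `f'`, tested against an arbitrary `w = S_n^* ω`,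
together with the duality between the multiresolution norm and its dual, gives `‖D^k u‖ ≤ 3 c_n`
(`sobolevNorm_sub_le_cMin`). The rest is an interpolation inequality,
`exists_eLpNorm_le_interpBound`, which bounds `‖u‖_{L^q}` by these two quantities for every `u` in
`H^k_0`; `interpBound_le_max` then rewrites its right-hand side as the three terms of the rate.

The interpolation inequality is local at heart (`exists_local_estimate`). On a cube of side `h`,
compare `u` with a Taylor polynomial of degree `k - 1`. A polynomial of bounded degree keeps at
least half of its maximal modulus on a small subcube around its maximum point, hence its grid
average over a cube of the system inside that subcube is comparable to its maximum, and this average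
is what the multiresolution norm sees. Averaging the remainder over the centre of expansion bounds
it by `h^k` times an `L^r` mean of `D^k u`, where `1 < r < 2` and `d / r < k`.

To globalize, divide the unit cube into `M^d` cells. Balancing the two terms of the local bound
gives a uniform estimate (`LocalBound.abs_le_of_lt`). For the critical exponent `(4k + 2d)/d`, each
point is assigned its first successful dyadic scale; failure at the previous scale puts the point in
a cell where the `L^r` mean of `D^k u` is large. A truncated weak-type bound for the volume of such
cells (`volume_badSet_le`) and a geometric sum over the scales recover `∫ |D^k u|^2`; this uses `r <
2` (`LocalBound.integral_rpow_le`). Smaller `q` follow since the torus has measure one, larger `q`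
by interpolation with the uniform bound.

The local analysis is carried out for trigonometric polynomials, where Taylor's formula is explicit,
and passes to `H^k_0` by uniform approximation with partial Fourier sums. -/

noncomputable section
namespace MIND
attribute [local instance] instMeasureSpaceUnitAddCircle

lemma isProbabilityMeasure_unitAddCircle :
    IsProbabilityMeasure (volume : Measure UnitAddCircle) :=
  inferInstanceAs (IsProbabilityMeasure AddCircle.haarAddCircle)

attribute [local instance] isProbabilityMeasure_unitAddCircle

/-! ### Fourier series of functions on the fundamental domain -/

/-- The measure-preserving section `UnitAddTorus → (0,1]^d` of the covering map. -/
def torusSection (d : ℕ) (t : UnitAddTorus (Fin d)) : Fin d → ℝ :=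
  (UnitAddTorus.measurableEquivPiIoc (0 : Fin d → ℝ) t).1

lemma coe_torusSection {d : ℕ} (t : UnitAddTorus (Fin d)) :
    (fun i => ((torusSection d t i : ℝ) : UnitAddCircle)) = t :=
  (UnitAddTorus.measurableEquivPiIoc (0 : Fin d → ℝ)).symm_apply_apply t

lemma measurableSet_setOf_mem_Ioc (d : ℕ) :
    MeasurableSet {x : Fin d → ℝ | ∀ i, x i ∈ Set.Ioc ((0 : Fin d → ℝ) i) ((0 : Fin d → ℝ) i + 1)} :=
  MeasurableSet.univ_pi' (fun _ => measurableSet_Ioc)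

lemma measurableEmbedding_torusSection (d : ℕ) : MeasurableEmbedding (torusSection d) :=
  (MeasurableEmbedding.subtype_coe (measurableSet_setOf_mem_Ioc d)).comp
    (UnitAddTorus.measurableEquivPiIoc (0 : Fin d → ℝ)).measurableEmbedding

lemma measurePreserving_torusSection (d : ℕ) :
    MeasurePreserving (torusSection d) volume (torusMeasure d) := by
  have h1 := UnitAddTorus.measurePreserving_equivPiIoc (0 : Fin d → ℝ)
  have h2 : MeasurePreserving (Subtype.val : {x : Fin d → ℝ // ∀ i, x i ∈
      Set.Ioc ((0 : Fin d → ℝ) i) ((0 : Fin d → ℝ) i + 1)} → (Fin d → ℝ))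
      (Measure.comap Subtype.val volume) (torusMeasure d) := by
    refine ⟨measurable_subtype_coe, ?_⟩
    have := map_comap_subtype_coe (measurableSet_setOf_mem_Ioc d)
      (volume : Measure (Fin d → ℝ))
    refine this.trans ?_
    unfold torusMeasure
    -- The section takes values in the half-open box, which agrees with `[0,1]^d` up to a null set.
    apply Measure.restrict_congr_set
    have h3 := Measure.univ_pi_Ioc_ae_eq_Icc (μ := fun _ : Fin d => (volume : Measure ℝ))
      (f := 0) (g := 1)
    have h4 : {x : Fin d → ℝ | ∀ i, x i ∈ Set.Ioc ((0 : Fin d → ℝ) i) ((0 : Fin d → ℝ) i + 1)}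
        = Set.univ.pi fun i => Set.Ioc ((0 : Fin d → ℝ) i) ((1 : Fin d → ℝ) i) := by
      ext x
      simp
    rw [h4]
    exact h3
  exact h2.comp h1

instance (d : ℕ) : IsProbabilityMeasure (torusMeasure d) :=
  ⟨by simp [torusMeasure, Real.volume_Icc_pi]⟩

/-- The phase `2π ξ · x`. -/
def phase {d : ℕ} (ξ : Fin d → ℤ) (x : Fin d → ℝ) : ℝ := 2 * Real.pi * ∑ i, (ξ i : ℝ) * x i

/-- The character `exp (2π i ξ · x)`. -/
def expo {d : ℕ} (ξ : Fin d → ℤ) (x : Fin d → ℝ) : ℂ := Complex.exp (phase ξ x * Complex.I)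

lemma continuous_phase {d : ℕ} (ξ : Fin d → ℤ) : Continuous (phase ξ) := by
  unfold phase; fun_prop

lemma continuous_expo {d : ℕ} (ξ : Fin d → ℤ) : Continuous (expo ξ) := by
  have := continuous_phase ξ
  unfold expo; fun_prop

lemma norm_expo {d : ℕ} (ξ : Fin d → ℤ) (x : Fin d → ℝ) : ‖expo ξ x‖ = 1 :=
  Complex.norm_exp_ofReal_mul_I _

lemma mFourier_coe {d : ℕ} (ξ : Fin d → ℤ) (x : Fin d → ℝ) :
    UnitAddTorus.mFourier ξ (fun i => (x i : UnitAddCircle)) = expo ξ x := by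
  simp only [UnitAddTorus.mFourier, ContinuousMap.coe_mk, fourier_coe_apply, expo, phase]
  rw [← Complex.exp_sum]
  congr 1
  push_cast
  rw [Finset.mul_sum, Finset.sum_mul]
  refine Finset.sum_congr rfl fun i _ => ?_
  ring

lemma mFourier_eq {d : ℕ} (ξ : Fin d → ℤ) (t : UnitAddTorus (Fin d)) :
    UnitAddTorus.mFourier ξ t = expo ξ (torusSection d t) := by
  rw [← mFourier_coe, coe_torusSection]

/-- The Fourier coefficients of a function on the torus. -/
def fourierCoef {d : ℕ} (f : (Fin d → ℝ) → ℝ) (ξ : Fin d → ℤ) : ℂ :=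
  ∫ x, expo (-ξ) x * (f x : ℂ) ∂(torusMeasure d)

lemma mFourierCoeff_torusSection {d : ℕ} (f : (Fin d → ℝ) → ℝ) (ξ : Fin d → ℤ) :
    UnitAddTorus.mFourierCoeff (fun t => (f (torusSection d t) : ℂ)) ξ = fourierCoef f ξ := by
  unfold UnitAddTorus.mFourierCoeff fourierCoef
  rw [← (measurePreserving_torusSection d).integral_comp (measurableEmbedding_torusSection d)]
  simp only [mFourier_eq, smul_eq_mul]

lemma memLp_comp_torusSection {d : ℕ} {f : (Fin d → ℝ) → ℝ} (hf : MemLp f 2 (torusMeasure d)) :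
    MemLp (fun t => (f (torusSection d t) : ℂ)) 2 volume :=
  (hf.comp_measurePreserving (measurePreserving_torusSection d)).ofReal

/-- Parseval's identity. -/
lemma hasSum_sq_fourierCoef {d : ℕ} {f : (Fin d → ℝ) → ℝ} (hf : MemLp f 2 (torusMeasure d)) :
    HasSum (fun ξ => ‖fourierCoef f ξ‖ ^ 2) (∫ x, f x ^ 2 ∂(torusMeasure d)) := by
  have hF := memLp_comp_torusSection hf
  have h := UnitAddTorus.hasSum_sq_mFourierCoeff hF.toLp
  have h1 : ∀ ξ, UnitAddTorus.mFourierCoeff hF.toLp ξ = fourierCoef f ξ := by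
    intro ξ
    rw [← mFourierCoeff_torusSection]
    exact integral_congr_ae (ae_eq_rfl.mul hF.coeFn_toLp)
  simp only [h1] at h
  convert h using 1
  rw [← (measurePreserving_torusSection d).integral_comp (measurableEmbedding_torusSection d)]
  refine integral_congr_ae ?_
  filter_upwards [hF.coeFn_toLp] with t ht
  simp [ht]

/-- Functions in `L²` with vanishing Fourier coefficients vanish. -/
lemma ae_eq_zero_of_fourierCoef {d : ℕ} {f : (Fin d → ℝ) → ℝ} (hf : MemLp f 2 (torusMeasure d))
    (h : ∀ ξ, fourierCoef f ξ = 0) : f =ᵐ[torusMeasure d] 0 := by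
  have h1 := hasSum_sq_fourierCoef hf
  simp only [h, norm_zero, ne_eq, OfNat.ofNat_ne_zero, not_false_eq_true, zero_pow] at h1
  have h2 := h1.unique hasSum_zero
  rw [integral_eq_zero_iff_of_nonneg (fun x => sq_nonneg (f x)) hf.integrable_sq] at h2
  filter_upwards [h2] with x hx
  simpa using hx

/-- The squared norm of a trigonometric polynomial. -/
lemma integral_normSq_sum_expo {d : ℕ} (F : Finset (Fin d → ℤ)) (a : (Fin d → ℤ) → ℂ) :
    ∫ x, ‖∑ ξ ∈ F, a ξ * expo ξ x‖ ^ 2 ∂(torusMeasure d) = ∑ ξ ∈ F, ‖a ξ‖ ^ 2 := by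
  have h := (UnitAddTorus.orthonormal_mFourier (d := Fin d)).inner_sum a a F
  have h3 : ∑ ξ ∈ F, a ξ • UnitAddTorus.mFourierLp 2 ξ
      = ContinuousMap.toLp (E := ℂ) 2 volume ℂ (∑ ξ ∈ F, a ξ • UnitAddTorus.mFourier ξ) := by
    simp [map_sum]
  rw [h3, ContinuousMap.inner_toLp] at h
  rw [← (measurePreserving_torusSection d).integral_comp (measurableEmbedding_torusSection d)]
  have h4 : ∀ z : ℂ, (starRingEnd ℂ) z * z = ((‖z‖ ^ 2 : ℝ) : ℂ) := by
    intro z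
    rw [Complex.conj_mul']; norm_cast
  apply Complex.ofReal_injective
  rw [← integral_complex_ofReal]
  simp only [h4] at h
  push_cast at h ⊢
  rw [← h]
  refine integral_congr_ae (Filter.Eventually.of_forall fun t => ?_)
  beta_reduce
  rw [Complex.mul_conj']
  simp [ContinuousMap.sum_apply, mFourier_eq]

lemma isOpenQuotientMap_torus (d : ℕ) :
    IsOpenQuotientMap (fun (x : Fin d → ℝ) (i : Fin d) => (x i : UnitAddCircle)) :=
  IsOpenQuotientMap.piMap fun _ => QuotientAddGroup.isOpenQuotientMap_mk

/-- A periodic function with summable Fourier coefficients is the sum of its Fourier series. -/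
lemma hasSum_fourierCoef {d : ℕ} {f : (Fin d → ℝ) → ℝ} (hf : Continuous f) (hp : IsPeriodic f)
    (hs : Summable (fourierCoef f)) (x : Fin d → ℝ) :
    HasSum (fun ξ => fourierCoef f ξ * expo ξ x) (f x : ℂ) := by
  have hper : ∀ x, f (torusSection d (fun i => (x i : UnitAddCircle))) = f x := by
    intro x
    have h := coe_torusSection (fun i => (x i : UnitAddCircle))
    have h1 : ∀ i, ∃ z : ℤ, x i + z =
        torusSection d (fun i => (x i : UnitAddCircle)) i := by
      intro i
      have := congrFun h i
      rw [← sub_eq_zero, ← AddCircle.coe_sub, AddCircle.coe_eq_zero_iff] at this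
      obtain ⟨z, hz⟩ := this
      exact ⟨z, by simp at hz; linarith⟩
    choose z hz using h1
    rw [← hp x z]
    congr 1
    ext i
    exact (hz i).symm
  -- The section is not continuous, but its composite with `f` is: pulled back along the covering
  -- map, which is a quotient map, it is `f` itself by periodicity.
  let F : C(UnitAddTorus (Fin d), ℂ) := ⟨fun t => (f (torusSection d t) : ℂ), by
    rw [(isOpenQuotientMap_torus d).isQuotientMap.continuous_iff]
    have : ((fun t => (f (torusSection d t) : ℂ)) ∘ 
        fun (x : Fin d → ℝ) (i : Fin d) => (x i : UnitAddCircle)) = fun x => (f x : ℂ) := by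
      ext x; simp [hper]
    rw [this]
    fun_prop⟩
  have hF : UnitAddTorus.mFourierCoeff F = fourierCoef f := by
    ext ξ; exact mFourierCoeff_torusSection f ξ
  have := UnitAddTorus.hasSum_mFourier_series_apply_of_summable (f := F) (hF ▸ hs)
    (fun i => (x i : UnitAddCircle))
  rw [hF] at this
  simpa [mFourier_coe, F, hper] using this
end MIND
end

noncomputable section
namespace MIND

/-! ### Weak derivatives and Fourier coefficients -/

lemma phase_add {d : ℕ} (ξ : Fin d → ℤ) (x y : Fin d → ℝ) :
    phase ξ (x + y) = phase ξ x + phase ξ y := by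
  simp [phase, mul_add, Finset.sum_add_distrib]

lemma phase_smul {d : ℕ} (ξ : Fin d → ℤ) (t : ℝ) (x : Fin d → ℝ) :
    phase ξ (t • x) = t * phase ξ x := by
  simp only [phase, Pi.smul_apply, smul_eq_mul, Finset.mul_sum]
  exact Finset.sum_congr rfl fun i _ => by ring

lemma phase_single {d : ℕ} (ξ : Fin d → ℤ) (i : Fin d) :
    phase ξ (Pi.single i 1) = 2 * Real.pi * ξ i := by
  simp [phase, Pi.single_apply]

lemma hasFDerivAt_expo {d : ℕ} (ξ : Fin d → ℤ) (x : Fin d → ℝ) :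
    ∃ L : (Fin d → ℝ) →L[ℝ] ℂ, HasFDerivAt (expo ξ) L x ∧
      ∀ v, L v = phase ξ v * Complex.I * expo ξ x := by
  let P : (Fin d → ℝ) →L[ℝ] ℝ := LinearMap.toContinuousLinearMap
    { toFun := phase ξ, map_add' := phase_add ξ, map_smul' := phase_smul ξ }
  have hP : HasFDerivAt (phase ξ) P x := P.hasFDerivAt
  have h2 : HasFDerivAt (fun x => (phase ξ x : ℂ) * Complex.I)
      ((Complex.ofRealCLM.comp P).smulRight Complex.I) x :=
    ((Complex.ofRealCLM.comp P).smulRight Complex.I).hasFDerivAt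
  refine ⟨_, h2.cexp, fun v => ?_⟩
  simp [P, expo, mul_comm]

lemma contDiff_expo {d : ℕ} (ξ : Fin d → ℤ) {n : WithTop ℕ∞} : ContDiff ℝ n (expo ξ) := by
  have h1 : ContDiff ℝ n (phase ξ) := by unfold phase; fun_prop
  exact ((Complex.ofRealCLM.contDiff.comp h1).mul contDiff_const).cexp

lemma iteratedFDeriv_expo {d : ℕ} (ξ : Fin d → ℤ) (m : ℕ) (x : Fin d → ℝ)
    (h : Fin m → Fin d → ℝ) :
    iteratedFDeriv ℝ m (expo ξ) x h = (∏ j, (phase ξ (h j) : ℂ) * Complex.I) * expo ξ x := by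
  induction m generalizing x with
  | zero => simp
  | succ n ih =>
    have hd : DifferentiableAt ℝ (iteratedFDeriv ℝ n (expo ξ)) x :=
      ((contDiff_expo ξ (n := ⊤)).differentiable_iteratedFDeriv
        (by exact_mod_cast WithTop.coe_lt_top _)).differentiableAt
    rw [iteratedFDeriv_succ_apply_left, ← fderiv_continuousMultilinear_apply_const_apply hd]
    simp only [ih]
    obtain ⟨L, hL, hLv⟩ := hasFDerivAt_expo ξ x
    rw [(hL.const_mul _).fderiv]
    simp only [smul_apply, hLv, smul_eq_mul, Fin.prod_univ_succ, Fin.tail]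
    ring

/-- The Fourier symbol of `∂_{I 0} ⋯ ∂_{I (m-1)}`. -/
def symbol {d m : ℕ} (I : Fin m → Fin d) (ξ : Fin d → ℤ) : ℂ :=
  ∏ j, ((2 * Real.pi * ξ (I j) : ℝ) : ℂ) * Complex.I

lemma symbol_neg {d m : ℕ} (I : Fin m → Fin d) (ξ : Fin d → ℤ) :
    symbol I (-ξ) = (-1) ^ m * symbol I ξ := by
  unfold symbol
  have : ((-1 : ℂ)) ^ m = ∏ j : Fin m, (-1 : ℂ) := by simp
  rw [this, ← Finset.prod_mul_distrib]
  refine Finset.prod_congr rfl fun j _ => ?_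
  simp

lemma iteratedFDeriv_expo_single {d m : ℕ} (ξ : Fin d → ℤ) (I : Fin m → Fin d)
    (x : Fin d → ℝ) :
    iteratedFDeriv ℝ m (expo ξ) x (fun j => Pi.single (I j) (1 : ℝ)) = symbol I ξ * expo ξ x := by
  rw [iteratedFDeriv_expo]
  simp [symbol, phase_single]

lemma expo_periodic {d : ℕ} (ξ : Fin d → ℤ) (x : Fin d → ℝ) (z : Fin d → ℤ) :
    expo ξ (fun i => x i + (z i : ℝ)) = expo ξ x := by
  rw [← mFourier_coe, ← mFourier_coe]
  congr 1
  ext i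
  simp

lemma memLp_torusMeasure_of_continuous {d : ℕ} {f : (Fin d → ℝ) → ℝ} (hf : Continuous f)
    (p : ℝ≥0∞) : MemLp f p (torusMeasure d) := by
  have := (isCompact_Icc (a := (0 : Fin d → ℝ)) (b := 1)).exists_bound_of_continuousOn
    hf.continuousOn
  obtain ⟨B, hB⟩ := this
  refine MemLp.of_bound hf.aestronglyMeasurable B ?_
  exact (ae_restrict_iff' measurableSet_Icc).2 (Filter.Eventually.of_forall hB)

lemma integrable_mul_expo {d : ℕ} {f : (Fin d → ℝ) → ℝ} (hf : MemLp f 2 (torusMeasure d))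
    (ξ : Fin d → ℤ) : Integrable (fun x => expo ξ x * (f x : ℂ)) (torusMeasure d) := by
  have h1 : Integrable (fun x => (f x : ℂ)) (torusMeasure d) :=
    (hf.integrable (by norm_num)).ofReal
  exact h1.bdd_mul (c := 1) (continuous_expo ξ).aestronglyMeasurable
    (Filter.Eventually.of_forall fun x => (norm_expo ξ x).le)

/-- Test with the character of frequency `-ξ`. Test functions are real, so this is done through
real-linear functionals `T`, applied at the end to real and imaginary part. The sign `(-1) ^ m` of
the weak derivative cancels against the one in `symbol I (-ξ)`. -/
lemma fourierCoef_weakDeriv {d m : ℕ} {I : Fin m → Fin d} {f g : (Fin d → ℝ) → ℝ}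
    (hf : MemLp f 2 (torusMeasure d)) (h : IsWeakDeriv I f g) (ξ : Fin d → ℤ) :
    fourierCoef g ξ = symbol I ξ * fourierCoef f ξ := by
  have key : ∀ T : ℂ →L[ℝ] ℝ, T (∫ x, symbol I (-ξ) * (expo (-ξ) x * (f x : ℂ)) ∂torusMeasure d)
      = T ((-1) ^ m * ∫ x, expo (-ξ) x * (g x : ℂ) ∂torusMeasure d) := by
    intro T
    have h1 := h.2 (fun x => T (expo (-ξ) x)) (T.contDiff.comp (contDiff_expo (-ξ))) (by
      intro x z
      simp only [expo_periodic])
    have h2 : ∀ x, partialDeriv I (fun x => T (expo (-ξ) x)) x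
        = T (symbol I (-ξ) * expo (-ξ) x) := by
      intro x
      rw [← iteratedFDeriv_expo_single]
      have := T.iteratedFDeriv_comp_left (f := expo (-ξ)) (x := x) (n := m) (i := m)
        (contDiff_expo (-ξ)).contDiffAt le_rfl
      unfold partialDeriv
      change (iteratedFDeriv ℝ m (T ∘ expo (-ξ)) x) _ = _
      rw [this]
      rfl
    simp only [h2] at h1
    have hT : ∀ (z : ℂ) (r : ℝ), T (z * (r : ℂ)) = r * T z := by
      intro z r
      rw [mul_comm, ← Complex.real_smul, T.map_smul]; rfl
    rw [← ContinuousLinearMap.integral_comp_comm _ ((integrable_mul_expo hf _).const_mul _)]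
    have h3 : (-1 : ℂ) ^ m = (((-1) ^ m : ℝ) : ℂ) := by push_cast; rfl
    rw [h3, mul_comm _ (∫ x, _ ∂_), hT,
      ← ContinuousLinearMap.integral_comp_comm _ (integrable_mul_expo h.1 _)]
    simp only [← mul_assoc, hT]
    exact h1
  have h4 : ∫ x, symbol I (-ξ) * (expo (-ξ) x * (f x : ℂ)) ∂torusMeasure d
      = (-1) ^ m * ∫ x, expo (-ξ) x * (g x : ℂ) ∂torusMeasure d :=
    Complex.ext (key Complex.reCLM) (key Complex.imCLM)
  rw [integral_const_mul, symbol_neg, mul_assoc] at h4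
  exact (mul_left_cancel₀ (pow_ne_zero _ (by norm_num)) h4).symm

lemma fourierCoef_sub {d : ℕ} {f g : (Fin d → ℝ) → ℝ} (hf : MemLp f 2 (torusMeasure d))
    (hg : MemLp g 2 (torusMeasure d)) (ξ : Fin d → ℤ) :
    fourierCoef (f - g) ξ = fourierCoef f ξ - fourierCoef g ξ := by
  unfold fourierCoef
  rw [← integral_sub (integrable_mul_expo hf _) (integrable_mul_expo hg _)]
  simp [mul_sub]

/-- The Fourier coefficients of a weak derivative are prescribed, and by Parseval they determine it.
Thus the choice made in `weakDeriv` is harmless inside integrals, although identities such as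
linearity hold only almost everywhere. -/
lemma IsWeakDeriv.ae_unique {d m : ℕ} {I : Fin m → Fin d} {f g g' : (Fin d → ℝ) → ℝ}
    (hf : MemLp f 2 (torusMeasure d)) (h : IsWeakDeriv I f g) (h' : IsWeakDeriv I f g') :
    g =ᵐ[torusMeasure d] g' := by
  have := ae_eq_zero_of_fourierCoef (h.1.sub h'.1) fun ξ => by
    rw [fourierCoef_sub h.1 h'.1, fourierCoef_weakDeriv hf h, fourierCoef_weakDeriv hf h', sub_self]
  filter_upwards [this] with x hx
  simpa [sub_eq_zero] using hx

lemma isWeakDeriv_weakDeriv {d m : ℕ} {I : Fin m → Fin d} {f : (Fin d → ℝ) → ℝ}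
    (h : ∃ g, IsWeakDeriv I f g) : IsWeakDeriv I f (weakDeriv I f) := by
  unfold weakDeriv
  rw [dif_pos h]
  exact h.choose_spec

lemma IsWeakDeriv.sub {d m : ℕ} {I : Fin m → Fin d} {f f' g g' : (Fin d → ℝ) → ℝ}
    (hf : MemLp f 2 (torusMeasure d)) (hf' : MemLp f' 2 (torusMeasure d))
    (h : IsWeakDeriv I f g) (h' : IsWeakDeriv I f' g') : IsWeakDeriv I (f - f') (g - g') := by
  refine ⟨h.1.sub h'.1, fun φ hφ hp => ?_⟩
  have hc : Continuous (partialDeriv I φ) := by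
    have := hφ.continuous_iteratedFDeriv (m := m) (by exact_mod_cast le_top)
    unfold partialDeriv
    fun_prop
  have i1 : ∀ (u v : (Fin d → ℝ) → ℝ), MemLp u 2 (torusMeasure d) → Continuous v →
      Integrable (fun x => u x * v x) (torusMeasure d) := fun u v hu hv =>
    hu.integrable_mul (memLp_torusMeasure_of_continuous hv 2)
  simp only [Pi.sub_apply, sub_mul]
  rw [integral_sub (i1 _ _ hf hc) (i1 _ _ hf' hc),
    integral_sub (i1 _ _ h.1 hφ.continuous) (i1 _ _ h'.1 hφ.continuous), h.2 φ hφ hp, h'.2 φ hφ hp]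
  ring

lemma SobolevZero.memLp {k d : ℕ} {f : (Fin d → ℝ) → ℝ} (hf : f ∈ SobolevZero k d) :
    MemLp f 2 (torusMeasure d) := memLp_torusMeasure_of_continuous hf.1 2

lemma SobolevZero.isWeakDeriv {k d : ℕ} {f : (Fin d → ℝ) → ℝ} (hf : f ∈ SobolevZero k d)
    (I : Fin k → Fin d) : IsWeakDeriv I f (weakDeriv I f) :=
  isWeakDeriv_weakDeriv (hf.2.2.2 k le_rfl I)

lemma SobolevZero.sub {k d : ℕ} {f g : (Fin d → ℝ) → ℝ} (hf : f ∈ SobolevZero k d)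
    (hg : g ∈ SobolevZero k d) : f - g ∈ SobolevZero k d := by
  refine ⟨hf.1.sub hg.1, fun x z => ?_, ?_, fun m hm I => ?_⟩
  · simp only [Pi.sub_apply, hf.2.1 x z, hg.2.1 x z]
  · have h1 := (SobolevZero.memLp hf).integrable (by norm_num)
    have h2 := (SobolevZero.memLp hg).integrable (by norm_num)
    have := integral_sub h1 h2
    simp only [Pi.sub_apply]
    rw [this, hf.2.2.1, hg.2.2.1, sub_zero]
  · obtain ⟨F, hF⟩ := hf.2.2.2 m hm I
    obtain ⟨G, hG⟩ := hg.2.2.2 m hm I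
    exact ⟨_, hF.sub (SobolevZero.memLp hf) (SobolevZero.memLp hg) hG⟩

lemma weakDeriv_sub {k d : ℕ} {f g : (Fin d → ℝ) → ℝ} (hf : f ∈ SobolevZero k d)
    (hg : g ∈ SobolevZero k d) (I : Fin k → Fin d) :
    weakDeriv I (f - g) =ᵐ[torusMeasure d] weakDeriv I f - weakDeriv I g :=
  (SobolevZero.isWeakDeriv (SobolevZero.sub hf hg) I).ae_unique
    (SobolevZero.memLp (SobolevZero.sub hf hg))
    ((SobolevZero.isWeakDeriv hf I).sub (SobolevZero.memLp hf) (SobolevZero.memLp hg)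
      (SobolevZero.isWeakDeriv hg I))

end MIND
end

noncomputable section
namespace MIND

/-! ### Summability of Fourier coefficients and trigonometric polynomials -/

-- View `ℤ^d` as a lattice of rank `d` in `ℝ^d` with the sup norm and use the convergence of lattice
-- sums with exponent above the rank.
open Submodule in
lemma summable_norm_inv_pow {d m : ℕ} (h : d < m) :
    Summable (fun ξ : Fin d → ℤ => (‖ξ‖ : ℝ)⁻¹ ^ m) := by
  let L := span ℤ (Set.range (Pi.basisFun ℝ (Fin d)))
  have hL : Module.finrank ℤ L = d := by
    have := ZLattice.rank ℝ L
    simpa using this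
  have h1 := ZLattice.summable_norm_pow_inv L m (by omega)
  have hm : ∀ ξ : Fin d → ℤ, (fun i => (ξ i : ℝ)) ∈ L := by
    intro ξ
    have : (fun i => (ξ i : ℝ)) = ∑ i, ξ i • Pi.basisFun ℝ (Fin d) i := by
      ext j; simp [Pi.single_apply]
    rw [this]
    exact sum_mem fun i _ => smul_mem _ _ (subset_span ⟨i, rfl⟩)
  have h2 := h1.comp_injective (i := fun ξ : Fin d → ℤ => (⟨fun i => (ξ i : ℝ), hm ξ⟩ : L)) (by
    intro a b hab
    ext i
    have := congrFun (congrArg Subtype.val hab) i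
    simpa using this)
  exact h2

lemma exists_norm_eq_apply {d : ℕ} {ξ : Fin d → ℤ} (h : ξ ≠ 0) : ∃ i, ‖ξ‖ = |(ξ i : ℝ)| := by
  have : Nonempty (Fin d) := by
    by_contra hne
    rw [not_nonempty_iff] at hne
    exact h (Subsingleton.elim _ _)
  obtain ⟨i, -, hi⟩ := Finset.exists_mem_eq_sup Finset.univ Finset.univ_nonempty (fun i => ‖ξ i‖₊)
  refine ⟨i, ?_⟩
  rw [Pi.norm_def, hi]
  simp [Int.norm_eq_abs]

/-- For `ξ ≠ 0` pick the coordinate `i` realizing the sup norm; the coefficient of `∂_i^k f`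
dominates `‖ξ‖^k` times that of `f`. Then `‖ξ‖^(-k) * D ≤ ‖ξ‖^(-2k) + D^2`, where the first part is
summable because `2k > d` and the second by Parseval. The zero mode vanishes since `f` has mean
zero. -/
lemma summable_fourierCoef {k d : ℕ} (hk : d < 2 * k) {f : (Fin d → ℝ) → ℝ}
    (hf : f ∈ SobolevZero k d) : Summable (fourierCoef f) := by
  have hS : Summable (fun ξ => ∑ i : Fin d,
      ‖fourierCoef (weakDeriv (fun _ : Fin k => i) f) ξ‖ ^ 2) :=
    summable_sum fun i _ => (hasSum_sq_fourierCoef (SobolevZero.isWeakDeriv hf _).1).summable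
  refine Summable.of_norm_bounded (((summable_norm_inv_pow hk).add hS)) fun ξ => ?_
  by_cases h0 : ξ = 0
  · have : fourierCoef f ξ = 0 := by
      subst h0
      have : ∀ x, expo (-(0 : Fin d → ℤ)) x = 1 := by intro x; simp [expo, phase]
      simp only [fourierCoef, this, one_mul]
      rw [integral_complex_ofReal, hf.2.2.1]; simp
    rw [this, norm_zero]
    positivity
  · obtain ⟨i, hi⟩ := exists_norm_eq_apply h0
    have hpos : 0 < ‖ξ‖ := norm_pos_iff.2 h0
    have h1 := fourierCoef_weakDeriv (SobolevZero.memLp hf)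
      (SobolevZero.isWeakDeriv hf (fun _ : Fin k => i)) ξ
    have h2 : ‖ξ‖ ^ k ≤ ‖symbol (fun _ : Fin k => i) ξ‖ := by
      simp only [symbol, norm_pow, norm_mul, Complex.norm_I, mul_one, Complex.norm_real,
        Finset.prod_const, Finset.card_univ, Fintype.card_fin, Real.norm_eq_abs, ← hi]
      gcongr
      have : (1 : ℝ) ≤ |2| * |Real.pi| := by
        rw [abs_of_pos (by norm_num : (0 : ℝ) < 2), abs_of_pos Real.pi_pos]
        linarith [Real.pi_gt_three]
      nlinarith
    set D := ‖fourierCoef (weakDeriv (fun _ : Fin k => i) f) ξ‖ with hD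
    have h3 : ‖ξ‖ ^ k * ‖fourierCoef f ξ‖ ≤ D := by
      rw [hD, h1, norm_mul]; gcongr
    have h4 : ‖fourierCoef f ξ‖ ≤ ‖ξ‖⁻¹ ^ k * D := by
      rw [inv_pow, ← div_eq_inv_mul, le_div_iff₀ (by positivity)]; linarith
    have h5 : D ^ 2 ≤ ∑ i : Fin d, ‖fourierCoef (weakDeriv (fun _ : Fin k => i) f) ξ‖ ^ 2 :=
      Finset.single_le_sum (f := fun i : Fin d =>
        ‖fourierCoef (weakDeriv (fun _ : Fin k => i) f) ξ‖ ^ 2)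
        (fun _ _ => by positivity) (Finset.mem_univ i)
    have h6 : ‖ξ‖⁻¹ ^ (2 * k) = (‖ξ‖⁻¹ ^ k) ^ 2 := by rw [mul_comm, pow_mul]
    rw [h6]
    nlinarith [sq_nonneg (‖ξ‖⁻¹ ^ k - D), sq_nonneg (‖ξ‖⁻¹ ^ k), sq_nonneg D]

/-- The real part of a trigonometric polynomial. -/
def trigPoly {d : ℕ} (F : Finset (Fin d → ℤ)) (a : (Fin d → ℤ) → ℂ) (x : Fin d → ℝ) : ℝ :=
  (∑ ξ ∈ F, a ξ * expo ξ x).re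

/-- The sum of the absolute values of the partial derivatives of order `k` of a trigonometric
polynomial. -/
def trigGrad (k : ℕ) {d : ℕ} (F : Finset (Fin d → ℤ)) (a : (Fin d → ℤ) → ℂ)
    (x : Fin d → ℝ) : ℝ :=
  ∑ I : Fin k → Fin d, |trigPoly F (fun ξ => symbol I ξ * a ξ) x|

lemma continuous_trigPoly {d : ℕ} (F : Finset (Fin d → ℤ)) (a : (Fin d → ℤ) → ℂ) :
    Continuous (trigPoly F a) := by
  have := fun ξ : Fin d → ℤ => continuous_expo ξ
  unfold trigPoly
  fun_prop

lemma continuous_trigGrad (k : ℕ) {d : ℕ} (F : Finset (Fin d → ℤ)) (a : (Fin d → ℤ) → ℂ) :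
    Continuous (trigGrad k F a) :=
  continuous_finsetSum _ fun _ _ => (continuous_trigPoly F _).abs

lemma trigGrad_nonneg (k : ℕ) {d : ℕ} (F : Finset (Fin d → ℤ)) (a : (Fin d → ℤ) → ℂ)
    (x : Fin d → ℝ) : 0 ≤ trigGrad k F a x :=
  Finset.sum_nonneg fun _ _ => abs_nonneg _

lemma integral_sq_trigPoly_le {d : ℕ} (F : Finset (Fin d → ℤ)) (a : (Fin d → ℤ) → ℂ) :
    ∫ x, trigPoly F a x ^ 2 ∂(torusMeasure d) ≤ ∑ ξ ∈ F, ‖a ξ‖ ^ 2 := by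
  rw [← integral_normSq_sum_expo]
  have hc := fun ξ : Fin d → ℤ => continuous_expo ξ
  refine integral_mono ?_ ?_ fun x => ?_
  · exact (memLp_torusMeasure_of_continuous (continuous_trigPoly F a) 2).integrable_sq
  · exact (memLp_torusMeasure_of_continuous (d := d) (by fun_prop) 1).integrable le_rfl
  · beta_reduce
    rw [← sq_abs]
    gcongr
    exact Complex.abs_re_le_norm _

/-- The bound is uniform in `F`: a derivative of the partial sum is a partial sum for the weak
derivative, so its `L²` norm only decreases. The factor `d ^ k` is Cauchy–Schwarz over the
multi-indices. -/
lemma integral_sq_trigGrad_le {k d : ℕ} {f : (Fin d → ℝ) → ℝ} (hf : f ∈ SobolevZero k d)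
    (F : Finset (Fin d → ℤ)) :
    ∫ x, trigGrad k F (fourierCoef f) x ^ 2 ∂(torusMeasure d)
      ≤ (d : ℝ) ^ k * sobolevInner k f f := by
  have hI : ∀ I : Fin k → Fin d,
      Integrable (fun x => trigPoly F (fun ξ => symbol I ξ * fourierCoef f ξ) x ^ 2)
        (torusMeasure d) := fun I =>
    (memLp_torusMeasure_of_continuous (continuous_trigPoly F _) 2).integrable_sq
  calc ∫ x, trigGrad k F (fourierCoef f) x ^ 2 ∂(torusMeasure d)
      ≤ ∫ x, (d : ℝ) ^ k * ∑ I : Fin k → Fin d,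
          trigPoly F (fun ξ => symbol I ξ * fourierCoef f ξ) x ^ 2 ∂(torusMeasure d) := by
        refine integral_mono
          (memLp_torusMeasure_of_continuous (continuous_trigGrad k F _) 2).integrable_sq
          ((integrable_finsetSum _ fun I _ => hI I).const_mul _) fun x => ?_
        have := sq_sum_le_card_mul_sum_sq (s := (Finset.univ : Finset (Fin k → Fin d)))
          (f := fun I => |trigPoly F (fun ξ => symbol I ξ * fourierCoef f ξ) x|)
        simpa [trigGrad, Finset.card_univ] using this
    _ = (d : ℝ) ^ k * ∑ I : Fin k → Fin d,
          ∫ x, trigPoly F (fun ξ => symbol I ξ * fourierCoef f ξ) x ^ 2 ∂(torusMeasure d) := by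
        rw [integral_const_mul, integral_finsetSum _ fun I _ => hI I]
    _ ≤ (d : ℝ) ^ k * sobolevInner k f f := by
        unfold sobolevInner
        refine mul_le_mul_of_nonneg_left (Finset.sum_le_sum fun I _ => ?_) (by positivity)
        refine (integral_sq_trigPoly_le F _).trans ?_
        have hw := SobolevZero.isWeakDeriv hf I
        have h2 := hasSum_sq_fourierCoef hw.1
        simp only [fourierCoef_weakDeriv (SobolevZero.memLp hf) hw] at h2
        simp only [← pow_two]
        exact sum_le_hasSum _ (fun _ _ => by positivity) h2

/-- Sobolev functions are uniform limits of the partial sums of their Fourier series. -/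
lemma exists_trigPoly_approx {k d : ℕ} (hk : d < 2 * k) {f : (Fin d → ℝ) → ℝ}
    (hf : f ∈ SobolevZero k d) {ε : ℝ} (hε : 0 < ε) :
    ∃ F : Finset (Fin d → ℤ), ∀ x, |f x - trigPoly F (fourierCoef f) x| ≤ ε := by
  have hs := summable_fourierCoef hk hf
  have hu := tendstoUniformly_tsum hs.norm
    (f := fun ξ (x : Fin d → ℝ) => fourierCoef f ξ * expo ξ x) (fun ξ x => by
      rw [norm_mul, norm_expo, mul_one])
  rw [Metric.tendstoUniformly_iff] at hu
  obtain ⟨F, hF⟩ := (hu ε hε).exists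
  refine ⟨F, fun x => ?_⟩
  have h1 := hF x
  rw [(hasSum_fourierCoef hf.1 hf.2.1 hs x).tsum_eq, dist_eq_norm] at h1
  refine le_trans ?_ h1.le
  have := Complex.abs_re_le_norm ((f x : ℂ) - ∑ ξ ∈ F, fourierCoef f ξ * expo ξ x)
  simpa [trigPoly] using this

/-! ### Taylor expansion of trigonometric polynomials -/

/-- The sum is the Taylor polynomial of `s ↦ exp (i s θ)` centred at `t` and evaluated at `s = 1`.
As the centre moves the derivative telescopes, leaving only the last term. Integrating over `[0,1]`
yields Taylor's formula with integral remainder. -/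
lemma hasDerivAt_exp_taylor (θ : ℝ) (k : ℕ) (t : ℝ) :
    HasDerivAt (fun t : ℝ => ∑ j ∈ Finset.range (k + 1), ((1 - t : ℝ) : ℂ) ^ j / (j.factorial : ℂ) *
        ((θ * Complex.I) ^ j * Complex.exp ((t * θ : ℝ) * Complex.I)))
      (((1 - t : ℝ) : ℂ) ^ k / (k.factorial : ℂ) *
        ((θ * Complex.I) ^ (k + 1) * Complex.exp ((t * θ : ℝ) * Complex.I))) t := by
  have he : HasDerivAt (fun t : ℝ => Complex.exp ((t * θ : ℝ) * Complex.I))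
      (Complex.exp ((t * θ : ℝ) * Complex.I) * (θ * Complex.I)) t := by
    have h1 : HasDerivAt (fun t : ℝ => ((t * θ : ℝ) : ℂ) * Complex.I) (θ * Complex.I) t := by
      simpa using (((hasDerivAt_id t).mul_const θ).ofReal_comp).mul_const Complex.I
    exact h1.cexp
  have hl : HasDerivAt (fun t : ℝ => ((1 - t : ℝ) : ℂ)) (-1) t := by
    simpa using ((hasDerivAt_id t).const_sub 1).ofReal_comp
  induction k with
  | zero =>
    simp only [zero_add, Finset.sum_range_one, pow_zero, Nat.factorial_zero, Nat.cast_one,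
      div_one, one_mul, pow_one]
    convert he using 1
    ring
  | succ n ih =>
    simp only [Finset.sum_range_succ _ (n + 1)]
    have h2 := (((hl.pow (n + 1)).div_const ((n + 1).factorial : ℂ)).mul
      (he.const_mul ((θ * Complex.I) ^ (n + 1))))
    refine (ih.add h2).congr_deriv ?_
    have h3 : ((n.factorial : ℕ) : ℂ) ≠ 0 := by exact_mod_cast n.factorial_ne_zero
    have h4 : ((n : ℂ) + 1) ≠ 0 := by exact_mod_cast n.succ_ne_zero
    rw [Nat.factorial_succ]
    push_cast
    simp only [Pi.pow_apply]
    field_simp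
    ring

lemma exp_taylor (θ : ℝ) (k : ℕ) :
    Complex.exp (θ * Complex.I) = (∑ j ∈ Finset.range (k + 1),
        (θ * Complex.I) ^ j / (j.factorial : ℂ)) +
      ∫ t in (0 : ℝ)..1, ((1 - t : ℝ) : ℂ) ^ k / (k.factorial : ℂ) *
        ((θ * Complex.I) ^ (k + 1) * Complex.exp ((t * θ : ℝ) * Complex.I)) := by
  rw [intervalIntegral.integral_eq_sub_of_hasDerivAt
    (fun t _ => hasDerivAt_exp_taylor θ k t) (by
      apply Continuous.intervalIntegrable
      fun_prop)]
  have h1 : ∑ j ∈ Finset.range (k + 1), ((1 - 1 : ℝ) : ℂ) ^ j / (j.factorial : ℂ) *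
        ((θ * Complex.I) ^ j * Complex.exp ((1 * θ : ℝ) * Complex.I))
      = Complex.exp (θ * Complex.I) := by
    rw [Finset.sum_range_succ']
    simp
  rw [h1]
  simp [div_eq_inv_mul]

/-- The Taylor polynomial of degree `k` of a trigonometric polynomial. -/
def taylorPoly (k : ℕ) {d : ℕ} (F : Finset (Fin d → ℤ)) (a : (Fin d → ℤ) → ℂ)
    (z y : Fin d → ℝ) : ℝ :=
  (∑ ξ ∈ F, a ξ * expo ξ z * ∑ j ∈ Finset.range (k + 1),
    (phase ξ (y - z) * Complex.I) ^ j / (j.factorial : ℂ)).re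

lemma continuous_taylorPoly (k : ℕ) {d : ℕ} (F : Finset (Fin d → ℤ)) (a : (Fin d → ℤ) → ℂ)
    (y : Fin d → ℝ) : Continuous fun z => taylorPoly k F a z y := by
  have h1 := fun ξ : Fin d → ℤ => continuous_expo ξ
  have h2 := fun ξ : Fin d → ℤ => continuous_phase ξ
  unfold taylorPoly
  fun_prop

lemma expo_add {d : ℕ} (ξ : Fin d → ℤ) (x y : Fin d → ℝ) :
    expo ξ (x + y) = expo ξ x * expo ξ y := by
  simp [expo, phase_add, add_mul, Complex.exp_add]

/-- The multinomial expansion indexed by words rather than by exponents, which matches the indexing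
of `symbol` and `trigGrad` and needs no multinomial coefficients. -/
lemma phase_pow {d : ℕ} (k : ℕ) (ξ : Fin d → ℤ) (h : Fin d → ℝ) :
    ((phase ξ h : ℂ) * Complex.I) ^ k =
      ∑ I : Fin k → Fin d, ((∏ j, h (I j) : ℝ) : ℂ) * symbol I ξ := by
  have h1 : (phase ξ h : ℂ) * Complex.I
      = ∑ i, (h i : ℂ) * (((2 * Real.pi * ξ i : ℝ) : ℂ) * Complex.I) := by
    unfold phase
    push_cast
    rw [Finset.mul_sum, Finset.sum_mul]
    exact Finset.sum_congr rfl fun i _ => by ring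
  rw [h1, Finset.sum_pow']
  simp only [Fintype.piFinset_univ]
  refine Finset.sum_congr rfl fun I _ => ?_
  rw [Finset.prod_mul_distrib]
  simp [symbol]

lemma abs_re_taylor_le (k : ℕ) {d : ℕ} (F : Finset (Fin d → ℤ)) (a : (Fin d → ℤ) → ℂ)
    (x h : Fin d → ℝ) :
    |(∑ ξ ∈ F, a ξ * expo ξ x * (phase ξ h * Complex.I) ^ k).re| ≤ ‖h‖ ^ k * trigGrad k F a x := by
  have h1 : (∑ ξ ∈ F, a ξ * expo ξ x * (phase ξ h * Complex.I) ^ k).re =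
      ∑ I : Fin k → Fin d, (∏ j, h (I j)) * trigPoly F (fun ξ => symbol I ξ * a ξ) x := by
    simp only [phase_pow, Finset.mul_sum, trigPoly]
    rw [Finset.sum_comm, Complex.re_sum]
    refine Finset.sum_congr rfl fun I _ => ?_
    rw [← Complex.re_ofReal_mul, Finset.mul_sum]
    congr 1
    exact Finset.sum_congr rfl fun i _ => by ring
  rw [h1, trigGrad, Finset.mul_sum]
  refine (Finset.abs_sum_le_sum_abs _ _).trans (Finset.sum_le_sum fun I _ => ?_)
  rw [abs_mul]
  gcongr
  rw [Finset.abs_prod]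
  calc ∏ j, |h (I j)| ≤ ∏ _j : Fin k, ‖h‖ :=
        Finset.prod_le_prod (fun _ _ => abs_nonneg _) fun j _ => norm_le_pi_norm h (I j)
    _ = ‖h‖ ^ k := by simp

/-- Factor `expo ξ z` out of each mode and apply the one-variable formula `exp_taylor` to the phase
of `y - z`. The factor `1 / k!` is dropped, but the weight `(1 - t) ^ k` must be kept: it later
compensates a singularity at `t = 1`. -/
lemma abs_sub_taylorPoly_le (k : ℕ) {d : ℕ} (F : Finset (Fin d → ℤ)) (a : (Fin d → ℤ) → ℂ)
    (z y : Fin d → ℝ) :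
    |trigPoly F a y - taylorPoly k F a z y| ≤ ‖y - z‖ ^ (k + 1) *
      ∫ t in (0 : ℝ)..1, (1 - t) ^ k * trigGrad (k + 1) F a (z + t • (y - z)) := by
  have h1 : ∀ ξ, expo ξ y = expo ξ z * Complex.exp (phase ξ (y - z) * Complex.I) := by
    intro ξ
    rw [← expo, ← expo_add, add_sub_cancel]
  have hI : ∀ ξ ∈ F, IntervalIntegrable (fun t : ℝ => a ξ * expo ξ z *
      (((1 - t : ℝ) : ℂ) ^ k / (k.factorial : ℂ) * ((phase ξ (y - z) * Complex.I) ^ (k + 1) *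
        Complex.exp ((t * phase ξ (y - z) : ℝ) * Complex.I)))) volume 0 1 := by
    intro ξ _
    apply Continuous.intervalIntegrable
    fun_prop
  have h2 : trigPoly F a y - taylorPoly k F a z y = ∫ t in (0 : ℝ)..1, (1 - t) ^ k / k.factorial *
      (∑ ξ ∈ F, a ξ * expo ξ (z + t • (y - z)) * (phase ξ (y - z) * Complex.I) ^ (k + 1)).re := by
    unfold trigPoly taylorPoly
    rw [← Complex.sub_re, ← Finset.sum_sub_distrib]
    have h3 : ∑ ξ ∈ F, (a ξ * expo ξ y - a ξ * expo ξ z * ∑ j ∈ Finset.range (k + 1),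
          (phase ξ (y - z) * Complex.I) ^ j / (j.factorial : ℂ))
        = ∫ t in (0 : ℝ)..1, ∑ ξ ∈ F, a ξ * expo ξ z *
      (((1 - t : ℝ) : ℂ) ^ k / (k.factorial : ℂ) * ((phase ξ (y - z) * Complex.I) ^ (k + 1) *
        Complex.exp ((t * phase ξ (y - z) : ℝ) * Complex.I))) := by
      rw [intervalIntegral.integral_finsetSum hI]
      refine Finset.sum_congr rfl fun ξ _ => ?_
      rw [intervalIntegral.integral_const_mul, h1, exp_taylor _ k]
      ring
    rw [h3]
    have h4 := Complex.reCLM.intervalIntegral_comp_comm (μ := volume) (a := 0) (b := 1)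
      (f := fun t : ℝ => ∑ ξ ∈ F, a ξ * expo ξ z *
      (((1 - t : ℝ) : ℂ) ^ k / (k.factorial : ℂ) * ((phase ξ (y - z) * Complex.I) ^ (k + 1) *
        Complex.exp ((t * phase ξ (y - z) : ℝ) * Complex.I)))) (by
      apply Continuous.intervalIntegrable
      fun_prop)
    simp only [Complex.reCLM_apply] at h4
    rw [← h4]
    refine intervalIntegral.integral_congr fun t _ => ?_
    rw [← Complex.re_ofReal_mul, Finset.mul_sum]
    congr 1
    refine Finset.sum_congr rfl fun ξ _ => ?_
    rw [expo_add, expo, expo, phase_smul]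
    push_cast
    ring
  rw [h2, ← intervalIntegral.integral_const_mul]
  have hcg := continuous_trigGrad (k + 1) F a
  have hce := fun ξ : Fin d → ℤ => continuous_expo ξ
  rw [← Real.norm_eq_abs]
  refine (intervalIntegral.norm_integral_le_integral_norm zero_le_one).trans
    (intervalIntegral.integral_mono_on zero_le_one ?_ ?_ fun t ht => ?_)
  · apply Continuous.intervalIntegrable
    fun_prop
  · apply Continuous.intervalIntegrable
    fun_prop
  · have h0 : 0 ≤ 1 - t := by linarith [ht.2]
    rw [Real.norm_eq_abs, abs_mul]
    have h5 := abs_re_taylor_le (k + 1) F a (z + t • (y - z)) (y - z)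
    have h6 : |(1 - t) ^ k / (k.factorial : ℝ)| ≤ (1 - t) ^ k := by
      rw [abs_of_nonneg (by positivity)]
      exact div_le_self (by positivity) (by exact_mod_cast k.factorial_pos)
    calc _ ≤ (1 - t) ^ k * (‖y - z‖ ^ (k + 1) * trigGrad (k + 1) F a (z + t • (y - z))) :=
          mul_le_mul h6 h5 (abs_nonneg _) (by positivity)
      _ = _ := by ring

/-- In the rescaled variable `s` every cube becomes the unit cube, so one compactness constant for
polynomials of degree at most `k` serves all cubes and all centres. -/
lemma taylorPoly_eq_eval (k : ℕ) {d : ℕ} (F : Finset (Fin d → ℤ)) (a : (Fin d → ℤ) → ℂ)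
    (z b : Fin d → ℝ) (h : ℝ) :
    ∃ p : MvPolynomial (Fin d) ℝ, p.totalDegree ≤ k ∧
      ∀ s : Fin d → ℝ, taylorPoly k F a z (b + h • s) = MvPolynomial.eval s p := by
  let l : (Fin d → ℤ) → MvPolynomial (Fin d) ℝ := fun ξ => MvPolynomial.C (phase ξ (b - z)) +
    ∑ i, MvPolynomial.C (2 * Real.pi * ξ i * h) * MvPolynomial.X i
  have hl : ∀ ξ s, MvPolynomial.eval s (l ξ) = phase ξ (b + h • s - z) := by
    intro ξ s
    have : b + h • s - z = (b - z) + h • s := by abel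
    rw [this, phase_add, phase_smul]
    simp only [l, phase, map_add, map_sum, MvPolynomial.eval_C, map_mul, MvPolynomial.eval_X,
      Finset.mul_sum]
    congr 1
    exact Finset.sum_congr rfl fun i _ => by ring
  have hdeg : ∀ ξ, (l ξ).totalDegree ≤ 1 := by
    intro ξ
    refine (MvPolynomial.totalDegree_add _ _).trans (max_le (by simp) ?_)
    refine MvPolynomial.totalDegree_finsetSum_le fun i _ => ?_
    refine (MvPolynomial.totalDegree_mul _ _).trans ?_
    rw [MvPolynomial.totalDegree_C, MvPolynomial.totalDegree_X]
  refine ⟨∑ ξ ∈ F, ∑ j ∈ Finset.range (k + 1), MvPolynomial.C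
    (a ξ * expo ξ z * (Complex.I ^ j / (j.factorial : ℂ))).re * l ξ ^ j, ?_, fun s => ?_⟩
  · refine MvPolynomial.totalDegree_finsetSum_le fun ξ _ =>
      MvPolynomial.totalDegree_finsetSum_le fun j hj => ?_
    refine (MvPolynomial.totalDegree_mul _ _).trans ?_
    rw [MvPolynomial.totalDegree_C, zero_add]
    refine (MvPolynomial.totalDegree_pow _ _).trans ?_
    have := hdeg ξ
    have hj' := Finset.mem_range.1 hj
    nlinarith
  · simp only [taylorPoly, map_sum, map_mul, map_pow, MvPolynomial.eval_C, hl, Complex.re_sum,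
      Finset.mul_sum]
    refine Finset.sum_congr rfl fun ξ _ => Finset.sum_congr rfl fun j _ => ?_
    rw [← Complex.re_mul_ofReal]
    congr 1
    push_cast
    ring

end MIND
end

noncomputable section
namespace MIND

/-! ### Averaged Taylor remainders on a cube -/

/-- The closed cube with lower corner `b` and side length `h`. -/
def closedCube {d : ℕ} (b : Fin d → ℝ) (h : ℝ) : Set (Fin d → ℝ) :=
  Set.Icc b (fun i => b i + h)

lemma isCompact_closedCube {d : ℕ} (b : Fin d → ℝ) (h : ℝ) : IsCompact (closedCube b h) :=
  isCompact_Icc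

lemma measurableSet_closedCube {d : ℕ} (b : Fin d → ℝ) (h : ℝ) :
    MeasurableSet (closedCube b h) := measurableSet_Icc

lemma convex_closedCube {d : ℕ} (b : Fin d → ℝ) (h : ℝ) : Convex ℝ (closedCube b h) :=
  convex_Icc _ _

lemma volume_closedCube {d : ℕ} (b : Fin d → ℝ) {h : ℝ} (hh : 0 ≤ h) :
    volume (closedCube b h) = ENNReal.ofReal (h ^ d) := by
  simp [closedCube, Real.volume_Icc_pi, ENNReal.ofReal_pow hh]

lemma volumeReal_closedCube {d : ℕ} (b : Fin d → ℝ) {h : ℝ} (hh : 0 ≤ h) :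
    volume.real (closedCube b h) = h ^ d := by
  rw [Measure.real, volume_closedCube b hh, ENNReal.toReal_ofReal (by positivity)]

lemma integrableOn_closedCube {d : ℕ} {b : Fin d → ℝ} {h : ℝ} {φ : (Fin d → ℝ) → ℝ}
    (hφ : Continuous φ) : IntegrableOn φ (closedCube b h) :=
  hφ.continuousOn.integrableOn_compact (isCompact_closedCube b h)

/-- The map contracts with centre `y` and ratio `s`; by convexity it sends the cube into itself, and
its Jacobian produces `s^(-d)`. -/
lemma setIntegral_homothety_le {d : ℕ} {b : Fin d → ℝ} {h : ℝ} {φ : (Fin d → ℝ) → ℝ}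
    (hφ : Continuous φ) (h0 : ∀ x, 0 ≤ φ x) {y : Fin d → ℝ} (hy : y ∈ closedCube b h)
    {s : ℝ} (hs : 0 < s) (hs1 : s ≤ 1) :
    ∫ z in closedCube b h, φ (s • z + (1 - s) • y) ≤ (s ^ d)⁻¹ * ∫ z in closedCube b h, φ z := by
  set Q := closedCube b h
  have hQ : MeasurableSet Q := measurableSet_closedCube b h
  have hi : Integrable (Q.indicator φ) := (integrableOn_closedCube hφ).integrable_indicator hQ
  have hi2 : Integrable (fun z => Q.indicator φ (s • z + (1 - s) • y)) :=
    (hi.comp_add_right ((1 - s) • y)).comp_smul hs.ne'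
  have hc : Continuous (fun z => φ (s • z + (1 - s) • y)) := by fun_prop
  calc ∫ z in Q, φ (s • z + (1 - s) • y)
      = ∫ z, Q.indicator (fun z => φ (s • z + (1 - s) • y)) z := (integral_indicator hQ).symm
    _ ≤ ∫ z, Q.indicator φ (s • z + (1 - s) • y) := by
        refine integral_mono ((integrableOn_closedCube hc).integrable_indicator hQ) hi2 fun z => ?_
        by_cases hz : z ∈ Q
        · have : s • z + (1 - s) • y ∈ Q :=
            convex_closedCube b h hz hy hs.le (by linarith) (by ring)
          simp [hz, this]
        · simp only [Set.indicator_of_notMem hz]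
          exact Set.indicator_nonneg (fun _ _ => h0 _) _
    _ = (s ^ d)⁻¹ * ∫ z in Q, φ z := by
        rw [Measure.integral_comp_smul volume (fun z => Q.indicator φ (z + (1 - s) • y)) s,
          integral_add_right_eq_self (Q.indicator φ), integral_indicator hQ]
        rw [Module.finrank_fin_fun, abs_of_pos (by positivity), smul_eq_mul]

lemma setIntegral_le_rpow {d : ℕ} {b : Fin d → ℝ} {h : ℝ} (hh : 0 < h)
    {φ : (Fin d → ℝ) → ℝ} (hφ : Continuous φ) (h0 : ∀ x, 0 ≤ φ x) {r : ℝ} (hr : 1 < r) :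
    ∫ z in closedCube b h, φ z ≤
      (∫ z in closedCube b h, φ z ^ r) ^ (1 / r) * (h ^ d) ^ (1 - 1 / r) := by
  have hpq := Real.HolderConjugate.conjExponent hr
  have hm : ∀ (p : ℝ≥0∞) (ψ : (Fin d → ℝ) → ℝ), Continuous ψ →
      MemLp ψ p (volume.restrict (closedCube b h)) := by
    intro p ψ hψ
    obtain ⟨B, hB⟩ := (isCompact_closedCube b h).exists_bound_of_continuousOn hψ.continuousOn
    have : IsFiniteMeasure (volume.restrict (closedCube b h)) :=
      ⟨by simpa using (isCompact_closedCube b h).measure_lt_top⟩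
    exact MemLp.of_bound hψ.aestronglyMeasurable B
      ((ae_restrict_iff' (measurableSet_closedCube b h)).2 (Filter.Eventually.of_forall hB))
  have := integral_mul_le_Lp_mul_Lq_of_nonneg (μ := volume.restrict (closedCube b h)) hpq
    (f := φ) (g := fun _ => 1) (Filter.Eventually.of_forall h0)
    (Filter.Eventually.of_forall fun _ => zero_le_one) (hm _ _ hφ) (hm _ _ continuous_const)
  simp only [mul_one, Real.one_rpow, integral_const, measureReal_restrict_apply_univ,
    volumeReal_closedCube b hh.le, smul_eq_mul] at this
  convert this using 3
  have := hpq.inv_add_inv_eq_one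
  rw [one_div, one_div]
  linarith

/-- The average over `z` of the Taylor remainder integral from `z` to `y`. -/
lemma setIntegral_remainder_le {d : ℕ} {b : Fin d → ℝ} {h : ℝ} (hh : 0 < h)
    {g : (Fin d → ℝ) → ℝ} (hg : Continuous g) (h0 : ∀ x, 0 ≤ g x) {r : ℝ} (hr : 1 < r) {k : ℕ}
    (hk : d / r < k + 1) {y : Fin d → ℝ} (hy : y ∈ closedCube b h) :
    ∫ z in closedCube b h, (∫ t in (0 : ℝ)..1, (1 - t) ^ k * g (z + t • (y - z))) ≤
      (k + 1 - d / r)⁻¹ * (h ^ d * ((h ^ d)⁻¹ * ∫ z in closedCube b h, g z ^ r) ^ (1 / r)) := by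
  set Q := closedCube b h
  set J := ∫ z in Q, g z ^ r
  have hr0 : 0 < r := by linarith
  have hJ : 0 ≤ J := integral_nonneg fun z => Real.rpow_nonneg (h0 z) r
  have hcr : Continuous fun z => g z ^ r := hg.rpow_const fun _ => Or.inr hr0.le
  have hc2 : Continuous (Function.uncurry fun (z : Fin d → ℝ) (t : ℝ) =>
      (1 - t) ^ k * g (z + t • (y - z))) := by
    unfold Function.uncurry
    fun_prop
  have hswap : ∫ z in Q, (∫ t in (0 : ℝ)..1, (1 - t) ^ k * g (z + t • (y - z)))
      = ∫ t in (0 : ℝ)..1, ∫ z in Q, (1 - t) ^ k * g (z + t • (y - z)) := by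
    simp only [intervalIntegral.integral_of_le zero_le_one]
    refine integral_integral_swap ?_
    rw [Measure.prod_restrict]
    have : IntegrableOn (Function.uncurry fun (z : Fin d → ℝ) (t : ℝ) =>
        (1 - t) ^ k * g (z + t • (y - z))) (Q ×ˢ Set.Icc (0 : ℝ) 1) (volume.prod volume) :=
      hc2.continuousOn.integrableOn_compact ((isCompact_closedCube b h).prod isCompact_Icc)
    exact this.mono_set (Set.prod_mono_right Set.Ioc_subset_Icc_self)
  -- The condition `d / r < k + 1` is exactly integrability of `(1 - t)^(k - d/r)` at `t = 1`.
  have hexp : -1 < (k : ℝ) - d / r := by linarith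
  have hint : ∫ t in (0 : ℝ)..1, (1 - t) ^ ((k : ℝ) - d / r) = (k + 1 - d / r)⁻¹ := by
    rw [intervalIntegral.integral_comp_sub_left (fun t => t ^ ((k : ℝ) - d / r)) 1]
    rw [sub_self, sub_zero, integral_rpow (Or.inl hexp), Real.one_rpow, Real.zero_rpow (by linarith)]
    rw [sub_zero, one_div]
    congr 1
    ring
  have hint2 : IntervalIntegrable (fun t : ℝ => (1 - t) ^ ((k : ℝ) - d / r)) volume 0 1 := by
    have := (intervalIntegral.intervalIntegrable_rpow' hexp (a := 0) (b := 1)).comp_sub_left 1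
    simpa using this.symm
  rw [hswap]
  have hcz : Continuous fun t => ∫ z in Q, (1 - t) ^ k * g (z + t • (y - z)) := by
    refine continuous_parametric_integral_of_continuous ?_ (isCompact_closedCube b h)
    unfold Function.uncurry
    fun_prop
  calc ∫ t in (0 : ℝ)..1, ∫ z in Q, (1 - t) ^ k * g (z + t • (y - z))
      ≤ ∫ t in (0 : ℝ)..1, (1 - t) ^ ((k : ℝ) - d / r) * (J ^ (1 / r) * (h ^ d) ^ (1 - 1 / r)) := by
        refine intervalIntegral.integral_mono_on_of_le_Ioo zero_le_one
          (hcz.intervalIntegrable _ _) (hint2.mul_const _) fun t ht => ?_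
        have hs : 0 < 1 - t := by linarith [ht.2]
        have hs1 : 1 - t ≤ 1 := by linarith [ht.1]
        have e1 : ∀ z, z + t • (y - z) = (1 - t) • z + (1 - (1 - t)) • y := by
          intro z
          ext i
          simp only [Pi.add_apply, Pi.smul_apply, Pi.sub_apply, smul_eq_mul]
          ring
        simp only [e1]
        rw [integral_const_mul]
        -- For fixed `t`, moving from `z` to `z + t (y - z)` is a contraction towards `y` with ratio
        -- `1 - t`. After Hölder, the change of variables costs only the `r`-th root of the
        -- Jacobian, `(1 - t)^(-d/r)`.
        have a1 := setIntegral_le_rpow (b := b) (h := h) hh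
          (φ := fun z => g ((1 - t) • z + (1 - (1 - t)) • y)) (by fun_prop) (fun z => h0 _) hr
        have a2 := setIntegral_homothety_le hcr (fun z => Real.rpow_nonneg (h0 z) r) hy hs hs1
        have a3 : (∫ z in Q, g ((1 - t) • z + (1 - (1 - t)) • y) ^ r) ^ (1 / r) ≤
            (1 - t) ^ (-(d / r) : ℝ) * J ^ (1 / r) := by
          refine (Real.rpow_le_rpow (integral_nonneg fun z => Real.rpow_nonneg (h0 _) r) a2
            (by positivity)).trans ?_
          rw [Real.mul_rpow (by positivity) hJ, ← Real.rpow_natCast, ← Real.rpow_neg hs.le,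
            ← Real.rpow_mul hs.le]
          apply le_of_eq
          congr 2
          ring
        have e2 : (1 - t) ^ ((k : ℝ) - d / r) = (1 - t) ^ k * (1 - t) ^ (-(d / r) : ℝ) := by
          rw [← Real.rpow_natCast, ← Real.rpow_add hs, ← sub_eq_add_neg]
        rw [e2, mul_assoc]
        refine mul_le_mul_of_nonneg_left ?_ (by positivity)
        rw [← mul_assoc]
        exact a1.trans (mul_le_mul_of_nonneg_right a3 (by positivity))
    _ = (k + 1 - d / r)⁻¹ * (h ^ d * ((h ^ d)⁻¹ * J) ^ (1 / r)) := by
        rw [intervalIntegral.integral_mul_const, hint]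
        congr 1
        have hd : (0 : ℝ) < h ^ d := by positivity
        rw [Real.mul_rpow (by positivity) hJ, Real.inv_rpow hd.le, Real.rpow_sub hd, Real.rpow_one]
        field_simp

end MIND
end

noncomputable section
namespace MIND

/-! ### Uniform continuity of normalized polynomials -/

lemma exists_linearMap_bound {E : Type*} [NormedAddCommGroup E] [NormedSpace ℝ E]
    [FiniteDimensional ℝ E] (l : E →ₗ[ℝ] ℝ) : ∃ C, 0 ≤ C ∧ ∀ x, |l x| ≤ C * ‖x‖ :=
  ⟨‖l.toContinuousLinearMap‖, norm_nonneg _, fun x => l.toContinuousLinearMap.le_opNorm x⟩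

/-- The normalized elements of a finite-dimensional space of continuous functions on a compact
metric space are uniformly equicontinuous. -/
lemma exists_modulus_of_finiteDimensional {X : Type*} [PseudoMetricSpace X] [CompactSpace X]
    (W : Submodule ℝ C(X, ℝ)) [FiniteDimensional ℝ W] {ε : ℝ} (hε : 0 < ε) :
    ∃ δ > 0, ∀ f ∈ W, ∀ x y : X, dist x y ≤ δ → |f x - f y| ≤ ε * ‖f‖ := by
  let B := Module.finBasis ℝ W
  choose c hc0 hc using fun i => exists_linearMap_bound (B.coord i)
  set S : ℝ := ∑ i, c i
  have hS : 0 ≤ S := Finset.sum_nonneg fun i _ => hc0 i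
  -- Dividing by `S + 1` rather than `S` covers the trivial space, where `S = 0`.
  have hε' : 0 < ε / (S + 1) := by positivity
  have hu : ∀ i, ∃ δ > 0, ∀ x y : X, dist x y ≤ δ →
      |(B i : C(X, ℝ)) x - (B i : C(X, ℝ)) y| ≤ ε / (S + 1) := by
    intro i
    have h1 := CompactSpace.uniformContinuous_of_continuous (B i : C(X, ℝ)).continuous
    obtain ⟨δ, hδ, h⟩ := Metric.uniformContinuous_iff.1 h1 _ hε'
    refine ⟨δ / 2, by positivity, fun x y hxy => ?_⟩
    have := h (a := x) (b := y) (by linarith)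
    rw [Real.dist_eq] at this
    exact this.le
  choose δ hδ hδ' using hu
  obtain ⟨δ₀, hδ₀, hle⟩ : ∃ δ₀ > 0, ∀ i, δ₀ ≤ δ i := by
    rcases isEmpty_or_nonempty (Fin (Module.finrank ℝ W)) with h | h
    · exact ⟨1, one_pos, fun i => h.elim i⟩
    · exact ⟨Finset.univ.inf' Finset.univ_nonempty δ,
        (Finset.lt_inf'_iff _).2 fun i _ => hδ i, fun i => Finset.inf'_le _ (Finset.mem_univ i)⟩
  refine ⟨δ₀, hδ₀, fun f hf x y hxy => ?_⟩
  have hrep : f = ∑ i, B.repr ⟨f, hf⟩ i • (B i : C(X, ℝ)) := by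
    have := congrArg Subtype.val (B.sum_repr ⟨f, hf⟩)
    rw [Submodule.coe_sum] at this
    exact this.symm
  have hx : ∀ x, f x = ∑ i, B.repr ⟨f, hf⟩ i * (B i : C(X, ℝ)) x := by
    intro x
    conv_lhs => rw [hrep]
    simp [ContinuousMap.sum_apply]
  rw [hx x, hx y, ← Finset.sum_sub_distrib]
  calc |∑ i, (B.repr ⟨f, hf⟩ i * (B i : C(X, ℝ)) x - B.repr ⟨f, hf⟩ i * (B i : C(X, ℝ)) y)|
      ≤ ∑ i, c i * ‖f‖ * (ε / (S + 1)) := by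
        refine (Finset.abs_sum_le_sum_abs _ _).trans (Finset.sum_le_sum fun i _ => ?_)
        rw [← mul_sub, abs_mul]
        refine mul_le_mul ?_ (hδ' i x y (hxy.trans (hle i))) (abs_nonneg _)
          (mul_nonneg (hc0 i) (norm_nonneg _))
        exact hc i ⟨f, hf⟩
    _ = (S / (S + 1)) * (ε * ‖f‖) := by
        rw [← Finset.sum_mul, ← Finset.sum_mul]
        ring
    _ ≤ 1 * (ε * ‖f‖) := by
        gcongr
        rw [div_le_one (by positivity)]
        linarith
    _ = ε * ‖f‖ := one_mul _

/-- Polynomials of degree at most `k` vary by at most half of their maximum over the unit cube on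
cubes of a fixed side length `1 / L`. -/
lemma exists_polynomial_modulus (k d : ℕ) : ∃ L : ℕ, 0 < L ∧
    ∀ p : MvPolynomial (Fin d) ℝ, p.totalDegree ≤ k → ∀ S : ℝ,
      (∀ s ∈ Set.Icc (0 : Fin d → ℝ) 1, |MvPolynomial.eval s p| ≤ S) →
      ∀ x ∈ Set.Icc (0 : Fin d → ℝ) 1, ∀ y ∈ Set.Icc (0 : Fin d → ℝ) 1,
        dist x y ≤ 1 / (L : ℝ) → |MvPolynomial.eval x p - MvPolynomial.eval y p| ≤ S / 2 := by
  let K := Set.Icc (0 : Fin d → ℝ) 1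
  let ev : MvPolynomial (Fin d) ℝ →ₗ[ℝ] C(K, ℝ) :=
    { toFun := fun p => ⟨fun s => MvPolynomial.eval s.1 p, (MvPolynomial.continuous_eval p).comp continuous_subtype_val⟩
      map_add' := fun p q => by ext; simp
      map_smul' := fun c p => by ext; simp }
  let M : Set (MvPolynomial (Fin d) ℝ) :=
    (fun e => MvPolynomial.monomial e (1 : ℝ)) '' {e : Fin d →₀ ℕ | e.degree ≤ k}
  have hM : M.Finite := (Finsupp.finite_of_degree_le k).image _
  let W : Submodule ℝ C(K, ℝ) := Submodule.span ℝ (ev '' M)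
  have : FiniteDimensional ℝ W := FiniteDimensional.span_of_finite ℝ (hM.image _)
  obtain ⟨δ, hδ, h⟩ := exists_modulus_of_finiteDimensional W (ε := 1 / 2) (by norm_num)
  obtain ⟨n, hn⟩ := exists_nat_one_div_lt hδ
  refine ⟨n + 1, by omega, fun p hp S hS x hx y hy hxy => ?_⟩
  have hmem : ev p ∈ W := by
    have h1 : p ∈ Submodule.span ℝ M := by
      rw [p.as_sum]
      refine Submodule.sum_mem _ fun e he => ?_
      have : MvPolynomial.monomial e (p.coeff e) =
          (p.coeff e) • MvPolynomial.monomial e (1 : ℝ) := by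
        rw [MvPolynomial.smul_monomial, smul_eq_mul, mul_one]
      rw [this]
      refine Submodule.smul_mem _ _ (Submodule.subset_span ⟨e, ?_, rfl⟩)
      exact (MvPolynomial.le_totalDegree he).trans hp
    have h2 := Submodule.mem_map_of_mem (f := ev) h1
    rwa [Submodule.map_span] at h2
  have h3 := h (ev p) hmem ⟨x, hx⟩ ⟨y, hy⟩ (by
    refine le_trans ?_ hn.le
    push_cast at hxy
    exact hxy)
  have h4 : ‖ev p‖ ≤ S := by
    have hS0 : 0 ≤ S := (abs_nonneg _).trans (hS x hx)
    exact (ContinuousMap.norm_le _ hS0).2 fun s => hS s.1 s.2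
  calc _ ≤ 1 / 2 * ‖ev p‖ := h3
    _ ≤ S / 2 := by linarith

end MIND
end

noncomputable section
namespace MIND

/-! ### Grid points in cubes and the multiresolution norm -/

/-- The half-open cube with lower corner `a` and side length `h`. -/
def openCube {d : ℕ} (a : Fin d → ℝ) (h : ℝ) : Set (Fin d → ℝ) :=
  Set.univ.pi fun i => Set.Ico (a i) (a i + h)

lemma volumeReal_openCube {d : ℕ} (a : Fin d → ℝ) {h : ℝ} (hh : 0 ≤ h) :
    volume.real (openCube a h) = h ^ d := by
  rw [Measure.real, openCube, Real.volume_pi_Ico, ENNReal.toReal_prod]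
  simp [hh]

lemma bounds_of_openCube_subset {d : ℕ} {a : Fin d → ℝ} {h : ℝ} (hh : 0 < h)
    (hs : openCube a h ⊆ Set.Icc 0 1) (i : Fin d) : 0 ≤ a i ∧ a i + h ≤ 1 := by
  refine ⟨(hs (a := a) fun j _ => ⟨le_rfl, by linarith⟩).1 i, ?_⟩
  by_contra! hlt
  -- The midpoint of `1 - a i` and `h`, clipped at `0`: moving by `t` stays in the half-open cube
  -- but leaves the unit cube.
  set t := max 0 ((1 - a i + h) / 2) with ht
  have h1 : t < h := max_lt hh (by linarith)
  have h2 : (fun j => a j + t) ∈ openCube a h := fun j _ =>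
    ⟨by linarith [le_max_left 0 ((1 - a i + h) / 2)], by linarith⟩
  have h3 := (hs h2).2 i
  simp only [Pi.one_apply] at h3
  linarith [le_max_right 0 ((1 - a i + h) / 2)]

/-- A half-open interval of length `N h` contains more than `N h - 1` integers, and `N h - 1 ≥ N h /
2` once `N h ≥ 2`. -/
lemma card_filter_Ico_ge {N : ℕ} {a h : ℝ} (ha : 0 ≤ a) (ha1 : a + h ≤ 1)
    (hNh : 2 ≤ N * h) :
    N * h / 2 ≤ ((Finset.univ.filter fun n : Fin N =>
      ((n : ℕ) : ℝ) / N ∈ Set.Ico a (a + h)).card : ℝ) := by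
  classical
  have hN : (0 : ℝ) < N := by
    rcases Nat.eq_zero_or_pos N with h0 | h0
    · subst h0; norm_num at hNh
    · exact_mod_cast h0
  have hle : (Finset.Ico ⌈N * a⌉₊ ⌈N * (a + h)⌉₊).card ≤
      (Finset.univ.filter fun n : Fin N => ((n : ℕ) : ℝ) / N ∈ Set.Ico a (a + h)).card := by
    refine Finset.card_le_card_of_surjOn (fun n : Fin N => (n : ℕ)) fun m hm => ?_
    simp only [Finset.coe_Ico, Set.mem_Ico] at hm
    have hm1 := Nat.ceil_le.1 hm.1
    have hm2 := Nat.lt_ceil.1 hm.2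
    have hmN : m < N := by
      have : (m : ℝ) < N := by nlinarith
      exact_mod_cast this
    refine ⟨⟨m, hmN⟩, ?_, rfl⟩
    simp only [Finset.coe_filter, Finset.mem_univ, true_and, Set.mem_ofPred_eq, Set.mem_Ico]
    rw [le_div_iff₀ hN, div_lt_iff₀ hN]
    constructor <;> linarith
  have h1 : (⌈N * (a + h)⌉₊ : ℝ) - ⌈N * a⌉₊ ≤ ((Finset.Ico ⌈N * a⌉₊ ⌈N * (a + h)⌉₊).card : ℝ) := by
    rw [Nat.card_Ico, sub_le_iff_le_add]
    have : ⌈N * (a + h)⌉₊ ≤ ⌈N * (a + h)⌉₊ - ⌈N * a⌉₊ + ⌈N * a⌉₊ := by omega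
    exact_mod_cast this
  have h2 := Nat.le_ceil (N * (a + h))
  have h3 := Nat.ceil_lt_add_one (show 0 ≤ N * a by positivity)
  have h4 : ((Finset.Ico ⌈N * a⌉₊ ⌈N * (a + h)⌉₊).card : ℝ) ≤ _ := Nat.cast_le.2 hle
  linarith

lemma card_gridIn_ge {d N : ℕ} {a : Fin d → ℝ} {h : ℝ} (hh : 0 < h)
    (hs : openCube a h ⊆ Set.Icc 0 1) (hNh : 2 ≤ N * h) :
    (N * h / 2) ^ d ≤ ((gridIn N (openCube a h)).card : ℝ) := by
  classical
  have : gridIn N (openCube a h) = Fintype.piFinset fun i => Finset.univ.filter fun n : Fin N =>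
      ((n : ℕ) : ℝ) / N ∈ Set.Ico (a i) (a i + h) := by
    ext τ
    simp [gridIn, openCube, gridPoint, Set.mem_pi]
  rw [this, Fintype.card_piFinset]
  push_cast
  calc (N * h / 2) ^ d = ∏ _i : Fin d, (N * h / 2) := by
        rw [Finset.prod_const, Finset.card_univ, Fintype.card_fin]
    _ ≤ _ := Finset.prod_le_prod (fun _ _ => by linarith) fun i _ =>
      card_filter_Ico_ge (bounds_of_openCube_subset hh hs i).1
        (bounds_of_openCube_subset hh hs i).2 hNh

/-- A real supremum dominates its terms only if the family is bounded. Here `∑ |y τ|` is a bound,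
because a nonempty grid intersection has `√card ≥ 1` and an empty one contributes `0`. -/
lemma le_multiresNorm {d N : ℕ} {𝓑 : Set (Set (Fin d → ℝ))} {B : Set (Fin d → ℝ)} (hB : B ∈ 𝓑)
    (y : (Fin d → Fin N) → ℝ) :
    |∑ τ ∈ gridIn N B, y τ| ≤ multiresNorm 𝓑 y * Real.sqrt ((gridIn N B).card : ℝ) := by
  have hbdd : BddAbove (Set.range fun B : 𝓑 => |∑ τ ∈ gridIn N (B : Set (Fin d → ℝ)), y τ| /
      Real.sqrt ((gridIn N (B : Set (Fin d → ℝ))).card : ℝ)) := by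
    refine ⟨∑ τ, |y τ|, ?_⟩
    rintro _ ⟨B, rfl⟩
    have h1 : |∑ τ ∈ gridIn N (B : Set (Fin d → ℝ)), y τ| ≤ ∑ τ, |y τ| :=
      (Finset.abs_sum_le_sum_abs _ _).trans
        (Finset.sum_le_sum_of_subset_of_nonneg (Finset.subset_univ _) fun _ _ _ => abs_nonneg _)
    rcases Nat.eq_zero_or_pos (gridIn N (B : Set (Fin d → ℝ))).card with h0 | h0
    · simp only [h0, Nat.cast_zero, Real.sqrt_zero, div_zero]
      exact Finset.sum_nonneg fun _ _ => abs_nonneg _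
    · refine (div_le_self (abs_nonneg _) ?_).trans h1
      rw [Real.one_le_sqrt]
      exact_mod_cast h0
  rcases Nat.eq_zero_or_pos (gridIn N B).card with h0 | h0
  · rw [Finset.card_eq_zero.1 h0]
    simp
  · rw [← div_le_iff₀ (Real.sqrt_pos.2 (by exact_mod_cast h0))]
    exact le_ciSup hbdd ⟨B, hB⟩

lemma multiresNorm_nonneg {d N : ℕ} (𝓑 : Set (Set (Fin d → ℝ))) (y : (Fin d → Fin N) → ℝ) :
    0 ≤ multiresNorm 𝓑 y :=
  Real.iSup_nonneg fun _ => by positivity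

lemma multiresNorm_le {d N : ℕ} {𝓑 : Set (Set (Fin d → ℝ))} {y : (Fin d → Fin N) → ℝ} {A : ℝ}
    (hA : 0 ≤ A)
    (h : ∀ B ∈ 𝓑, |∑ τ ∈ gridIn N B, y τ| ≤ A * Real.sqrt ((gridIn N B).card : ℝ)) :
    multiresNorm 𝓑 y ≤ A := by
  refine Real.iSup_le (fun B => ?_) hA
  exact div_le_of_le_mul₀ (Real.sqrt_nonneg _) hA (h B B.2)

lemma multiresNorm_add_le {d N : ℕ} (𝓑 : Set (Set (Fin d → ℝ))) (y z : (Fin d → Fin N) → ℝ) :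
    multiresNorm 𝓑 (y + z) ≤ multiresNorm 𝓑 y + multiresNorm 𝓑 z := by
  refine multiresNorm_le (add_nonneg (multiresNorm_nonneg _ _) (multiresNorm_nonneg _ _))
    fun B hB => ?_
  simp only [Pi.add_apply, Finset.sum_add_distrib, add_mul]
  exact (abs_add_le _ _).trans (add_le_add (le_multiresNorm hB y) (le_multiresNorm hB z))

lemma multiresNorm_smul_le {d N : ℕ} (𝓑 : Set (Set (Fin d → ℝ))) (s : ℝ)
    (y : (Fin d → Fin N) → ℝ) :
    multiresNorm 𝓑 (s • y) ≤ |s| * multiresNorm 𝓑 y := by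
  refine multiresNorm_le (mul_nonneg (abs_nonneg _) (multiresNorm_nonneg _ _)) fun B hB => ?_
  simp only [Pi.smul_apply, smul_eq_mul, ← Finset.mul_sum, abs_mul, mul_assoc]
  exact mul_le_mul_of_nonneg_left (le_multiresNorm hB y) (abs_nonneg _)

lemma multiresNorm_le_sup {d N : ℕ} (𝓑 : Set (Set (Fin d → ℝ))) {y : (Fin d → Fin N) → ℝ} {ε : ℝ}
    (hε : 0 ≤ ε) (h : ∀ τ, |y τ| ≤ ε) :
    multiresNorm 𝓑 y ≤ ε * Real.sqrt ((N : ℝ) ^ d) := by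
  refine multiresNorm_le (by positivity) fun B _ => ?_
  have hc : ((gridIn N B).card : ℝ) ≤ (N : ℝ) ^ d := by
    have := Finset.card_le_univ (gridIn N B)
    simp only [Fintype.card_fun, Fintype.card_fin] at this
    exact_mod_cast this
  calc |∑ τ ∈ gridIn N B, y τ| ≤ ∑ τ ∈ gridIn N B, ε :=
        (Finset.abs_sum_le_sum_abs _ _).trans (Finset.sum_le_sum fun τ _ => h τ)
    _ = ε * (Real.sqrt ((gridIn N B).card : ℝ) * Real.sqrt ((gridIn N B).card : ℝ)) := by
        rw [Real.mul_self_sqrt (by positivity), Finset.sum_const, nsmul_eq_mul, mul_comm]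
    _ ≤ ε * Real.sqrt ((N : ℝ) ^ d) * Real.sqrt ((gridIn N B).card : ℝ) := by
        rw [mul_assoc]
        gcongr

/-- A normal system contains, in every cube, a cube with many grid points. -/
lemma IsNormalSystem.exists_card_ge {d : ℕ} (hd : 1 ≤ d) {c : ℝ} {𝓑 : Set (Set (Fin d → ℝ))}
    (h𝓑 : IsNormalSystem c 𝓑) {a : Fin d → ℝ} {h : ℝ} (hh : 0 < h)
    (hs : openCube a h ⊆ Set.Icc 0 1) {N : ℕ} (hN : 2 * c ≤ N * h) :
    ∃ B ∈ 𝓑, B ⊆ openCube a h ∧ (N * h / (2 * c)) ^ d ≤ ((gridIn N B).card : ℝ) := by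
  have hc := h𝓑.1
  have hh1 : h ≤ 1 := by
    have := bounds_of_openCube_subset hh hs ⟨0, hd⟩
    linarith
  obtain ⟨B, hB, hBs, hv⟩ := h𝓑.2.2 (openCube a h) ⟨a, h, hh, hh1, rfl, hs⟩
  refine ⟨B, hB, hBs, ?_⟩
  obtain ⟨a', h', hh', -, rfl, hs'⟩ := h𝓑.2.1 B hB
  change volume.real (openCube a h) / c ≤ volume.real (openCube a' h') at hv
  change openCube a' h' ⊆ _ at hs'
  change _ ≤ ((gridIn N (openCube a' h')).card : ℝ)
  rw [volumeReal_openCube a hh.le, volumeReal_openCube a' hh'.le] at hv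
  -- The volume comparison would allow `c^(1/d)`; since `c > 1` and `d ≥ 1`, the cruder factor `c`
  -- avoids roots.
  have hside : h / c ≤ h' := by
    by_contra! hlt
    have h1 : h' ^ d < (h / c) ^ d := pow_lt_pow_left₀ hlt hh'.le (by omega)
    have h2 : (h / c) ^ d ≤ h ^ d / c := by
      rw [div_pow]
      gcongr
      exact le_self_pow₀ hc.le (by omega)
    linarith
  have hc0 : 0 < c := by linarith
  have h3 : N * h / c ≤ N * h' := by
    rw [mul_div_assoc]
    gcongr
  have h4 : 2 ≤ N * h / c := by
    rw [le_div_iff₀ hc0]; exact hN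
  refine le_trans ?_ (card_gridIn_ge hh' hs' (h4.trans h3))
  have h5 : N * h / (2 * c) = N * h / c / 2 := by field_simp
  rw [h5]
  gcongr

end MIND
end

noncomputable section
namespace MIND

/-! ### The local estimate -/

/-- `v` has Taylor polynomials `T z` of degree at most `k`, with a remainder controlled by the
function `g`. -/
structure HasTaylor (k : ℕ) {d : ℕ} (v g : (Fin d → ℝ) → ℝ)
    (T : (Fin d → ℝ) → (Fin d → ℝ) → ℝ) : Prop where
  continuous_grad : Continuous g
  grad_nonneg : ∀ x, 0 ≤ g x
  continuous_poly : ∀ y, Continuous fun z => T z y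
  poly : ∀ (z b : Fin d → ℝ) (h : ℝ), ∃ p : MvPolynomial (Fin d) ℝ, p.totalDegree ≤ k ∧
    ∀ s : Fin d → ℝ, T z (b + h • s) = MvPolynomial.eval s p
  bound : ∀ z y, |v y - T z y| ≤ ‖y - z‖ ^ (k + 1) *
    ∫ t in (0 : ℝ)..1, (1 - t) ^ k * g (z + t • (y - z))

lemma hasTaylor_trigPoly (k : ℕ) {d : ℕ} (F : Finset (Fin d → ℤ)) (a : (Fin d → ℤ) → ℂ) :
    HasTaylor k (trigPoly F a) (trigGrad (k + 1) F a) (taylorPoly k F a) :=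
  ⟨continuous_trigGrad _ F a, trigGrad_nonneg _ F a, continuous_taylorPoly k F a,
    taylorPoly_eq_eval k F a, abs_sub_taylorPoly_le k F a⟩

/-- The `L^r` average of `g` over a cube. -/
def cubeAvg {d : ℕ} (g : (Fin d → ℝ) → ℝ) (r : ℝ) (b : Fin d → ℝ) (h : ℝ) : ℝ :=
  ((h ^ d)⁻¹ * ∫ z in closedCube b h, g z ^ r) ^ (1 / r)

lemma cubeAvg_nonneg {d : ℕ} {g : (Fin d → ℝ) → ℝ} (h0 : ∀ x, 0 ≤ g x) (r : ℝ)
    (b : Fin d → ℝ) {h : ℝ} (hh : 0 ≤ h) : 0 ≤ cubeAvg g r b h :=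
  Real.rpow_nonneg (mul_nonneg (by positivity)
    (integral_nonneg fun x => Real.rpow_nonneg (h0 x) r)) _

lemma norm_sub_le_of_mem_closedCube {d : ℕ} {b y z : Fin d → ℝ} {h : ℝ} (hh : 0 ≤ h)
    (hy : y ∈ closedCube b h) (hz : z ∈ closedCube b h) : ‖y - z‖ ≤ h := by
  rw [pi_norm_le_iff_of_nonneg hh]
  intro i
  rw [Pi.sub_apply, Real.norm_eq_abs, abs_le]
  have h1 := hy.1 i
  have h2 := hy.2 i
  have h3 := hz.1 i
  have h4 := hz.2 i
  constructor <;> linarith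

/-- For a single centre `z`, the integral of `g` along a segment is not controlled by an `L^r` mean
of `g`. Averaging over all centres turns it into a volume integral. -/
lemma HasTaylor.setIntegral_le {k d : ℕ} {v g : (Fin d → ℝ) → ℝ}
    {T : (Fin d → ℝ) → (Fin d → ℝ) → ℝ} (H : HasTaylor k v g T) {r : ℝ} (hr : 1 < r)
    (hk : d / r < k + 1) {b : Fin d → ℝ} {h : ℝ} (hh : 0 < h) {y : Fin d → ℝ}
    (hy : y ∈ closedCube b h) :
    ∫ z in closedCube b h, |v y - T z y| ≤
      h ^ d * ((k + 1 - d / r)⁻¹ * (h ^ (k + 1) * cubeAvg g r b h)) := by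
  have hg := H.continuous_grad
  have hcT := H.continuous_poly y
  have hc : Continuous fun z => ∫ t in (0 : ℝ)..1, (1 - t) ^ k * g (z + t • (y - z)) := by
    refine intervalIntegral.continuous_parametric_intervalIntegral_of_continuous' ?_ 0 1
    unfold Function.uncurry
    fun_prop
  calc ∫ z in closedCube b h, |v y - T z y|
      ≤ ∫ z in closedCube b h, h ^ (k + 1) *
          ∫ t in (0 : ℝ)..1, (1 - t) ^ k * g (z + t • (y - z)) := by
        refine setIntegral_mono_on (integrableOn_closedCube (by fun_prop))
          (integrableOn_closedCube (by fun_prop)) (measurableSet_closedCube b h) fun z hz => ?_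
        refine (H.bound z y).trans ?_
        refine mul_le_mul_of_nonneg_right ?_ ?_
        · gcongr
          exact norm_sub_le_of_mem_closedCube hh.le hy hz
        · refine intervalIntegral.integral_nonneg zero_le_one fun t ht => ?_
          have : 0 ≤ 1 - t := by linarith [ht.2]
          exact mul_nonneg (by positivity) (H.grad_nonneg _)
    _ ≤ h ^ (k + 1) * ((k + 1 - d / r)⁻¹ * (h ^ d * cubeAvg g r b h)) := by
        rw [integral_const_mul]
        refine mul_le_mul_of_nonneg_left ?_ (by positivity)
        exact setIntegral_remainder_le hh hg H.grad_nonneg hr hk hy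
    _ = _ := by ring

lemma exists_subcube {d L : ℕ} (hL : 0 < L) {s : Fin d → ℝ}
    (hs : s ∈ Set.Icc (0 : Fin d → ℝ) 1) :
    ∃ l : Fin d → Fin L, ∀ i, ((l i : ℕ) : ℝ) / L ≤ s i ∧ s i ≤ ((l i : ℕ) : ℝ) / L + 1 / L := by
  have hL' : (0 : ℝ) < L := by exact_mod_cast hL
  have : ∀ i, ∃ n : Fin L, ((n : ℕ) : ℝ) / L ≤ s i ∧ s i ≤ ((n : ℕ) : ℝ) / L + 1 / L := by
    intro i
    have h0 : 0 ≤ s i := hs.1 i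
    have h1 : s i ≤ 1 := hs.2 i
    simp only [← add_div, div_le_iff₀ hL', le_div_iff₀ hL']
    -- At the right endpoint the floor would give the index `L`, so the last interval is used
    -- instead.
    by_cases hlt : s i < 1
    · have hf := Nat.floor_le (show 0 ≤ s i * L by positivity)
      have hf2 := Nat.lt_floor_add_one (s i * L)
      refine ⟨⟨⌊s i * L⌋₊, ?_⟩, hf, hf2.le⟩
      have : (⌊s i * L⌋₊ : ℝ) < L := by nlinarith
      exact_mod_cast this
    · have h2 : s i = 1 := le_antisymm h1 (not_lt.1 hlt)
      refine ⟨⟨L - 1, by omega⟩, ?_⟩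
      have : ((L - 1 : ℕ) : ℝ) = L - 1 := by
        rw [Nat.cast_sub (by omega)]; simp
      simp only [this, h2]
      constructor <;> linarith
  choose l hl using this
  exact ⟨l, hl⟩

/-- On every cube that is large compared to the grid, a function is bounded by its multiresolution
norm and the `L^r` average of its derivatives of order `k + 1`. -/
lemma exists_local_estimate (k : ℕ) {d : ℕ} (hd : 1 ≤ d) {r : ℝ} (hr : 1 < r)
    (hk : d / r < k + 1) {c : ℝ} (hc : 1 < c) :
    ∃ C₁ C₀ : ℝ, 1 ≤ C₁ ∧ 1 ≤ C₀ ∧ ∀ 𝓑 : Set (Set (Fin d → ℝ)), IsNormalSystem c 𝓑 →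
      ∀ (N : ℕ) (v g : (Fin d → ℝ) → ℝ) (T : (Fin d → ℝ) → (Fin d → ℝ) → ℝ), HasTaylor k v g T →
      ∀ A : ℝ, multiresNorm 𝓑 (sample N v) ≤ A →
      ∀ (b : Fin d → ℝ) (h : ℝ), 0 < h → closedCube b h ⊆ Set.Icc 0 1 → C₀ ≤ N * h →
      ∀ y ∈ closedCube b h,
        |v y| ≤ C₁ * (A / Real.sqrt ((N * h) ^ d) + h ^ (k + 1) * cubeAvg g r b h) := by
  obtain ⟨L, hL, hmod⟩ := exists_polynomial_modulus k d
  have hL' : (0 : ℝ) < L := by exact_mod_cast hL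
  have hL1 : (1 : ℝ) ≤ L := by exact_mod_cast hL
  have hc0 : 0 < c := by linarith
  have hpos : 0 < k + 1 - d / r := by linarith
  set K := (k + 1 - d / r)⁻¹
  have hK : 0 < K := inv_pos.2 hpos
  set D : ℝ := Real.sqrt ((2 * L * c) ^ d)
  -- `C₀ = 2 L c` makes each subcube of side `h / L` large enough for
  -- `IsNormalSystem.exists_card_ge`. `D` converts the number of grid points found there into `(N
  -- h)^d`, and `1 + L^d` counts the averages that the centre must control simultaneously.
  refine ⟨max 1 (max (2 * D) (2 * ((1 + (L : ℝ) ^ d) * K))), 2 * L * c, le_max_left _ _,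
    by nlinarith, ?_⟩
  intro 𝓑 h𝓑 N v g T H A hA b h hh hsub hNh y hy
  set Q := closedCube b h with hQ
  have hA0 : 0 ≤ A := (multiresNorm_nonneg _ _).trans hA
  have hNpos : 0 < N * h := lt_of_lt_of_le (by positivity) hNh
  set ρ := cubeAvg g r b h
  have hρ : 0 ≤ ρ := cubeAvg_nonneg H.grad_nonneg r b hh.le
  -- the subcubes
  have hbl : ∀ l : Fin d → Fin L, ∀ x ∈ openCube (fun i => b i + h * (((l i : ℕ) : ℝ) / L)) (h / L),
      ∃ s ∈ Set.Icc (0 : Fin d → ℝ) 1, x = b + h • s ∧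
        ∀ i, ((l i : ℕ) : ℝ) / L ≤ s i ∧ s i ≤ ((l i : ℕ) : ℝ) / L + 1 / L := by
    intro l x hx
    refine ⟨fun i => (x i - b i) / h, ?_, ?_, ?_⟩
    rotate_left
    · ext i
      simp only [Pi.add_apply, Pi.smul_apply, smul_eq_mul]
      field_simp
      ring
    · intro i
      have hxi := hx i (Set.mem_univ i)
      rw [le_div_iff₀ hh, div_le_iff₀ hh]
      have e : h / L = 1 / L * h := by ring
      constructor
      · linarith [hxi.1]
      · rw [add_mul, ← e]
        linarith [hxi.2]
    · have hb : ∀ i, ((l i : ℕ) : ℝ) / L + 1 / L ≤ 1 := by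
        intro i
        rw [← add_div, div_le_one hL']
        exact_mod_cast (l i).2
      have e : h / L = h * (1 / L) := by ring
      constructor <;> intro i <;> have hxi := hx i (Set.mem_univ i)
      · simp only [Pi.zero_apply]
        have : 0 ≤ h * (((l i : ℕ) : ℝ) / L) := by positivity
        exact div_nonneg (by linarith [hxi.1]) hh.le
      · simp only [Pi.one_apply]
        rw [div_le_one hh]
        have h1 := hxi.2
        rw [e] at h1
        nlinarith [hb i]
  have hQmem : ∀ s ∈ Set.Icc (0 : Fin d → ℝ) 1, b + h • s ∈ Q := by
    intro s hs
    refine ⟨fun i => ?_, fun i => ?_⟩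
    · have : 0 ≤ s i := hs.1 i
      simp only [Pi.add_apply, Pi.smul_apply, smul_eq_mul]
      nlinarith
    · have : s i ≤ 1 := hs.2 i
      simp only [Pi.add_apply, Pi.smul_apply, smul_eq_mul]
      nlinarith
  have hcube : ∀ l : Fin d → Fin L, ∃ B ∈ 𝓑,
      B ⊆ openCube (fun i => b i + h * (((l i : ℕ) : ℝ) / L)) (h / L) ∧
      (N * h / (2 * L * c)) ^ d ≤ ((gridIn N B).card : ℝ) := by
    intro l
    have h1 : openCube (fun i => b i + h * (((l i : ℕ) : ℝ) / L)) (h / L) ⊆ Set.Icc 0 1 := by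
      intro x hx
      obtain ⟨s, hs, rfl, -⟩ := hbl l x hx
      exact hsub (hQmem s hs)
    obtain ⟨B, hB, hBs, hcard⟩ := h𝓑.exists_card_ge hd (N := N) (by positivity) h1 (by
      rw [← mul_div_assoc, le_div_iff₀ hL']
      linarith)
    refine ⟨B, hB, hBs, ?_⟩
    convert hcard using 2
    field_simp
  choose B hB hBs hcard using hcube
  have hgrid : ∀ l, ∀ τ ∈ gridIn N (B l), gridPoint τ ∈ B l := by
    intro l τ hτ
    simpa [gridIn] using hτ
  have hcard0 : ∀ l, (0 : ℝ) < (gridIn N (B l)).card := fun l =>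
    lt_of_lt_of_le (by positivity) (hcard l)
  -- choice of the centre of the expansion
  set E : ℝ := K * (h ^ (k + 1) * ρ) with hE
  have hE0 : 0 ≤ E := by positivity
  let R : (Fin d → ℝ) → (Fin d → ℝ) → ℝ := fun x z => |v x - T z x|
  have hRc : ∀ x, Continuous (R x) := fun x => by
    have := H.continuous_poly x
    fun_prop
  have hR0 : ∀ x z, 0 ≤ R x z := fun x z => abs_nonneg _
  let M : (Fin d → Fin L) → (Fin d → ℝ) → ℝ := fun l z =>
    ((gridIn N (B l)).card : ℝ)⁻¹ * ∑ τ ∈ gridIn N (B l), R (gridPoint τ) z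
  have hMc : ∀ l, Continuous (M l) := fun l =>
    continuous_const.mul (continuous_finsetSum _ fun τ _ => hRc _)
  have hM0 : ∀ l z, 0 ≤ M l z := fun l z =>
    mul_nonneg (by positivity) (Finset.sum_nonneg fun _ _ => hR0 _ _)
  have hRint : ∀ x ∈ Q, ∫ z in Q, R x z ≤ h ^ d * E := fun x hx => H.setIntegral_le hr hk hh hx
  have hMint : ∀ l, ∫ z in Q, M l z ≤ h ^ d * E := by
    intro l
    rw [integral_const_mul, integral_finsetSum _ fun τ _ => integrableOn_closedCube (hRc _),
      inv_mul_le_iff₀ (hcard0 l)]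
    calc ∑ τ ∈ gridIn N (B l), ∫ z in Q, R (gridPoint τ) z
        ≤ ∑ τ ∈ gridIn N (B l), h ^ d * E := by
          refine Finset.sum_le_sum fun τ hτ => hRint _ ?_
          obtain ⟨s, hs, he, -⟩ := hbl l _ (hBs l (hgrid l τ hτ))
          rw [he]
          exact hQmem s hs
      _ = _ := by rw [Finset.sum_const, nsmul_eq_mul]
  -- The same centre must serve the point `y` and all `L^d` grid averages, since the subcube to be
  -- used depends on the polynomial and hence on `z`. A point where the sum of the remainders does
  -- not exceed its mean does this.
  obtain ⟨z, hz, hfz⟩ : ∃ z ∈ Q, R y z + ∑ l, M l z ≤ (1 + (L : ℝ) ^ d) * E := by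
    have hvol := volume_closedCube b hh.le
    obtain ⟨z, hz, hle⟩ := exists_le_setAverage (μ := volume) (s := Q)
      (f := fun z => R y z + ∑ l, M l z) (by
        rw [hvol]
        simp only [ne_eq, ENNReal.ofReal_eq_zero, not_le]
        positivity) (by rw [hvol]; exact ENNReal.ofReal_ne_top)
      (integrableOn_closedCube ((hRc y).add (continuous_finsetSum _ fun l _ => hMc l)))
    refine ⟨z, hz, hle.trans ?_⟩
    rw [setAverage_eq, volumeReal_closedCube b hh.le, smul_eq_mul,
      inv_mul_le_iff₀ (by positivity), integral_add (integrableOn_closedCube (hRc y))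
        (integrableOn_closedCube (continuous_finsetSum _ fun l _ => hMc l)),
      integral_finsetSum _ fun l _ => integrableOn_closedCube (hMc l)]
    calc _ ≤ h ^ d * E + ∑ l : Fin d → Fin L, h ^ d * E :=
          add_le_add (hRint y hy) (Finset.sum_le_sum fun l _ => hMint l)
      _ = _ := by
          rw [Finset.sum_const, Finset.card_univ, Fintype.card_fun, Fintype.card_fin,
            Fintype.card_fin, nsmul_eq_mul]
          push_cast
          ring
  -- the maximum of the Taylor polynomial
  obtain ⟨p, hpdeg, hp⟩ := H.poly z b h
  obtain ⟨s, hs, hmax⟩ := (isCompact_Icc (a := (0 : Fin d → ℝ)) (b := 1)).exists_isMaxOn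
    ⟨0, le_rfl, fun _ => zero_le_one⟩
    ((MvPolynomial.continuous_eval p).abs.continuousOn)
  set S := |MvPolynomial.eval s p|
  have hS0 : 0 ≤ S := abs_nonneg _
  have hSmax : ∀ x ∈ Set.Icc (0 : Fin d → ℝ) 1, |MvPolynomial.eval x p| ≤ S := fun x hx => hmax hx
  obtain ⟨l, hl⟩ := exists_subcube hL hs
  set n : ℝ := ((gridIn N (B l)).card : ℝ)
  have hn : 0 < n := hcard0 l
  -- On the subcube containing the maximum point `s`, the polynomial stays within `S / 2` of its
  -- extreme value. No cancellation can occur, and the grid average over `B l` has modulus at least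
  -- `S / 2`.
  have hclose : ∀ τ ∈ gridIn N (B l), |T z (gridPoint τ) - MvPolynomial.eval s p| ≤ S / 2 := by
    intro τ hτ
    obtain ⟨s', hs', he, hl'⟩ := hbl l _ (hBs l (hgrid l τ hτ))
    rw [he, hp]
    refine hmod p hpdeg S hSmax _ hs' _ hs ?_
    rw [dist_pi_le_iff (by positivity)]
    intro i
    rw [Real.dist_eq, abs_le]
    have := hl i
    have := hl' i
    constructor <;> linarith
  have hsum : n * S - n * (S / 2) ≤ |∑ τ ∈ gridIn N (B l), T z (gridPoint τ)| := by
    have h1 : |∑ τ ∈ gridIn N (B l), T z (gridPoint τ) - n * MvPolynomial.eval s p| ≤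
        n * (S / 2) := by
      have : n * MvPolynomial.eval s p = ∑ τ ∈ gridIn N (B l), MvPolynomial.eval s p := by
        rw [Finset.sum_const, nsmul_eq_mul]
      rw [this, ← Finset.sum_sub_distrib]
      refine (Finset.abs_sum_le_sum_abs _ _).trans ((Finset.sum_le_sum hclose).trans ?_)
      rw [Finset.sum_const, nsmul_eq_mul]
    have h2 := abs_sub_abs_le_abs_sub (n * MvPolynomial.eval s p)
      (∑ τ ∈ gridIn N (B l), T z (gridPoint τ))
    rw [abs_sub_comm] at h2
    rw [abs_mul, abs_of_pos hn] at h2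
    linarith
  have hsum2 : |∑ τ ∈ gridIn N (B l), T z (gridPoint τ)| ≤ A * Real.sqrt n + n * M l z := by
    have h1 : ∑ τ ∈ gridIn N (B l), T z (gridPoint τ) = ∑ τ ∈ gridIn N (B l), sample N v τ -
        ∑ τ ∈ gridIn N (B l), (v (gridPoint τ) - T z (gridPoint τ)) := by
      rw [← Finset.sum_sub_distrib]
      exact Finset.sum_congr rfl fun τ _ => by simp [sample]
    rw [h1]
    refine (abs_sub _ _).trans (add_le_add ?_ ?_)
    · exact (le_multiresNorm (hB l) _).trans (mul_le_mul_of_nonneg_right hA (Real.sqrt_nonneg _))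
    · have : n * M l z = ∑ τ ∈ gridIn N (B l), R (gridPoint τ) z :=
        mul_inv_cancel_left₀ hn.ne' _
      rw [this]
      exact Finset.abs_sum_le_sum_abs _ _
  have hsq : 0 < Real.sqrt n := Real.sqrt_pos.2 hn
  have hnn : n = Real.sqrt n * Real.sqrt n := (Real.mul_self_sqrt hn.le).symm
  have hSle : S ≤ 2 * (A / Real.sqrt n) + 2 * M l z := by
    have h1 : A * Real.sqrt n = n * (A / Real.sqrt n) := by
      rw [mul_div_assoc', eq_div_iff hsq.ne', mul_assoc, ← hnn, mul_comm]
    have h2 : n * S ≤ n * (2 * (A / Real.sqrt n) + 2 * M l z) := by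
      rw [h1] at hsum2
      linarith
    exact le_of_mul_le_mul_left h2 hn
  have hTy : |T z y| ≤ S := by
    have h1 : y = b + h • (fun i => (y i - b i) / h) := by
      ext i
      simp only [Pi.add_apply, Pi.smul_apply, smul_eq_mul]
      field_simp
      ring
    rw [h1, hp]
    refine hSmax _ ⟨fun i => ?_, fun i => ?_⟩
    · exact div_nonneg (sub_nonneg.2 (hy.1 i)) hh.le
    · simp only [Pi.one_apply]
      rw [div_le_one hh]
      linarith [hy.2 i]
  have hMle : M l z ≤ ∑ l, M l z :=
    Finset.single_le_sum (f := fun l => M l z) (fun _ _ => hM0 _ _) (Finset.mem_univ l)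
  have hv : |v y| ≤ |T z y| + R y z := by
    have := abs_add_le (T z y) (v y - T z y)
    rwa [add_sub_cancel] at this
  have hD : A / Real.sqrt n ≤ D * (A / Real.sqrt ((N * h) ^ d)) := by
    have h1 : Real.sqrt ((N * h) ^ d) ≤ D * Real.sqrt n := by
      rw [← Real.sqrt_mul (by positivity)]
      refine Real.sqrt_le_sqrt ?_
      have h2 := hcard l
      rw [div_pow, div_le_iff₀ (by positivity)] at h2
      linarith
    have h3 : 0 < Real.sqrt ((N * h) ^ d) := Real.sqrt_pos.2 (by positivity)
    rw [mul_div_assoc', div_le_div_iff₀ hsq h3]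
    calc A * Real.sqrt ((N * h) ^ d) ≤ A * (D * Real.sqrt n) := by gcongr
      _ = _ := by ring
  set X := A / Real.sqrt ((N * h) ^ d)
  have hX : 0 ≤ X := by positivity
  set Y := h ^ (k + 1) * ρ
  have hY : 0 ≤ Y := by positivity
  have hRy := hR0 y z
  calc |v y| ≤ 2 * D * X + 2 * ((1 + (L : ℝ) ^ d) * K) * Y := by
        rw [hE] at hfz
        linarith
    _ ≤ max 1 (max (2 * D) (2 * ((1 + (L : ℝ) ^ d) * K))) * X +
        max 1 (max (2 * D) (2 * ((1 + (L : ℝ) ^ d) * K))) * Y := by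
        gcongr
        · exact (le_max_left _ _).trans (le_max_right _ _)
        · exact (le_max_right _ _).trans (le_max_right _ _)
    _ = _ := by ring

end MIND
end

noncomputable section
namespace MIND

/-! ### The partition of the unit cube into cells -/

/-- The lower corner of a cell of the partition of the unit cube into `M ^ d` cells. -/
def cellCorner {d M : ℕ} (m : Fin d → Fin M) : Fin d → ℝ := fun i => ((m i : ℕ) : ℝ) / M

lemma closedCube_cellCorner_subset {d M : ℕ} (hM : 0 < M) (m : Fin d → Fin M) :
    closedCube (cellCorner m) (1 / (M : ℝ)) ⊆ Set.Icc 0 1 := by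
  have hM' : (0 : ℝ) < M := by exact_mod_cast hM
  intro x hx
  refine ⟨fun i => ?_, fun i => ?_⟩
  · refine le_trans ?_ (hx.1 i)
    simp only [Pi.zero_apply, cellCorner]
    positivity
  · refine (hx.2 i).trans ?_
    simp only [Pi.one_apply, cellCorner]
    rw [← add_div, div_le_one hM']
    exact_mod_cast (m i).2

lemma exists_mem_closedCube_cellCorner {d M : ℕ} (hM : 0 < M) {x : Fin d → ℝ}
    (hx : x ∈ Set.Icc (0 : Fin d → ℝ) 1) :
    ∃ m : Fin d → Fin M, x ∈ closedCube (cellCorner m) (1 / (M : ℝ)) := by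
  obtain ⟨m, hm⟩ := exists_subcube hM hx
  exact ⟨m, fun i => (hm i).1, fun i => (hm i).2⟩

lemma openCube_ae_eq_closedCube {d : ℕ} (b : Fin d → ℝ) (h : ℝ) :
    openCube b h =ᵐ[volume] closedCube b h :=
  Measure.univ_pi_Ico_ae_eq_Icc (μ := fun _ : Fin d => (volume : Measure ℝ))
    (f := b) (g := fun i => b i + h)

/-- Closed cells overlap only in null sets; replacing them by half-open ones makes them disjoint. -/
lemma sum_setIntegral_cells_le {d M : ℕ} (hM : 0 < M) {φ : (Fin d → ℝ) → ℝ}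
    (hφ : IntegrableOn φ (Set.Icc 0 1)) (h0 : ∀ x, 0 ≤ φ x) :
    ∑ m : Fin d → Fin M, ∫ x in closedCube (cellCorner m) (1 / (M : ℝ)), φ x ≤
      ∫ x in Set.Icc 0 1, φ x := by
  have hM' : (0 : ℝ) < M := by exact_mod_cast hM
  have hsub : ∀ m : Fin d → Fin M, openCube (cellCorner m) (1 / (M : ℝ)) ⊆ Set.Icc 0 1 := by
    intro m x hx
    exact closedCube_cellCorner_subset hM m
      ⟨fun i => (hx i (Set.mem_univ i)).1, fun i => (hx i (Set.mem_univ i)).2.le⟩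
  have hdisj : ∀ m m' : Fin d → Fin M, ∀ x, x ∈ openCube (cellCorner m) (1 / (M : ℝ)) →
      x ∈ openCube (cellCorner m') (1 / (M : ℝ)) → m = m' := by
    intro m m' x hx hx'
    ext i
    have h1 := hx i (Set.mem_univ i)
    have h2 := hx' i (Set.mem_univ i)
    simp only [cellCorner, Set.mem_Ico, ← add_div, div_le_iff₀ hM', lt_div_iff₀ hM'] at h1 h2
    have a1 : ((m i : ℕ) : ℝ) < (m' i : ℕ) + 1 := by linarith
    have a2 : ((m' i : ℕ) : ℝ) < (m i : ℕ) + 1 := by linarith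
    have a1' : (m i : ℕ) < (m' i : ℕ) + 1 := by exact_mod_cast a1
    have a2' : (m' i : ℕ) < (m i : ℕ) + 1 := by exact_mod_cast a2
    omega
  calc ∑ m : Fin d → Fin M, ∫ x in closedCube (cellCorner m) (1 / (M : ℝ)), φ x
      = ∑ m : Fin d → Fin M, ∫ x in openCube (cellCorner m) (1 / (M : ℝ)), φ x :=
        Finset.sum_congr rfl fun m _ =>
          (setIntegral_congr_set (openCube_ae_eq_closedCube _ _)).symm
    _ = ∫ x in ⋃ m ∈ (Finset.univ : Finset (Fin d → Fin M)),
          openCube (cellCorner m) (1 / (M : ℝ)), φ x := by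
        rw [integral_biUnion_finset]
        · exact fun m _ => MeasurableSet.univ_pi fun _ => measurableSet_Ico
        · intro m _ m' _ hne
          rw [Function.onFun, Set.disjoint_left]
          exact fun x hx hx' => hne (hdisj m m' x hx hx')
        · exact fun m _ => hφ.mono_set (hsub m)
    _ ≤ ∫ x in Set.Icc 0 1, φ x := by
        refine setIntegral_mono_set hφ (Filter.Eventually.of_forall h0)
          (Filter.Eventually.of_forall ?_)
        exact Set.iUnion₂_subset fun m _ => hsub m

/-- Hölder passes from the `L^r` mean to the `L²` mean over the cube, and the global integral bounds
the local one; `h^(-d/2)` is the normalization of the `L²` mean. -/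
lemma cubeAvg_le {d : ℕ} {g : (Fin d → ℝ) → ℝ} (hg : Continuous g) (h0 : ∀ x, 0 ≤ g x)
    {r : ℝ} (hr : 1 < r) (hr2 : r < 2) {b : Fin d → ℝ} {h : ℝ} (hh : 0 < h)
    (hsub : closedCube b h ⊆ Set.Icc 0 1) {R : ℝ} (hR : 0 ≤ R)
    (hgR : ∫ x in Set.Icc 0 1, g x ^ 2 ≤ R ^ 2) :
    cubeAvg g r b h ≤ h ^ (-(d / 2 : ℝ)) * R := by
  have hr0 : 0 < r := by linarith
  have hd : (0 : ℝ) < h ^ d := by positivity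
  have hI : ∫ x in closedCube b h, g x ^ 2 ≤ R ^ 2 := by
    refine le_trans (setIntegral_mono_set ?_ ?_ ?_) hgR
    · exact (hg.pow 2).continuousOn.integrableOn_compact isCompact_Icc
    · exact Filter.Eventually.of_forall fun x => sq_nonneg _
    · exact Filter.Eventually.of_forall hsub
  have h1 := setIntegral_le_rpow (b := b) hh (φ := fun x => g x ^ r)
    (hg.rpow_const fun _ => Or.inr hr0.le) (fun x => Real.rpow_nonneg (h0 x) r)
    (r := 2 / r) (by rw [lt_div_iff₀ hr0]; linarith)
  have h2 : ∀ x, (g x ^ r) ^ (2 / r) = g x ^ 2 := by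
    intro x
    rw [← Real.rpow_mul (h0 x), mul_div_cancel₀ _ hr0.ne', Real.rpow_two]
  simp only [h2] at h1
  have h3 : ∫ x in closedCube b h, g x ^ r ≤ (R ^ 2) ^ (1 / (2 / r)) * (h ^ d) ^ (1 - 1 / (2 / r)) :=
    h1.trans (mul_le_mul_of_nonneg_right (Real.rpow_le_rpow
      (integral_nonneg fun _ => sq_nonneg _) hI (by positivity)) (by positivity))
  have hI0 : 0 ≤ ∫ x in closedCube b h, g x ^ r :=
    integral_nonneg fun x => Real.rpow_nonneg (h0 x) r
  have e1 : (h ^ d : ℝ) = h ^ (d : ℝ) := (Real.rpow_natCast h d).symm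
  calc cubeAvg g r b h
      ≤ ((h ^ d)⁻¹ * ((R ^ 2) ^ (1 / (2 / r)) * (h ^ d) ^ (1 - 1 / (2 / r)))) ^ (1 / r) := by
        unfold cubeAvg
        refine Real.rpow_le_rpow (by positivity) ?_ (by positivity)
        gcongr
    _ = h ^ (-(d / 2 : ℝ)) * R := by
        have e2 : (h ^ d)⁻¹ * ((R ^ 2) ^ (1 / (2 / r)) * (h ^ d) ^ (1 - 1 / (2 / r)))
            = R ^ r * h ^ (-(d / 2 * r : ℝ)) := by
          rw [← Real.rpow_two, ← Real.rpow_mul hR, e1, ← Real.rpow_neg hh.le, ← Real.rpow_mul hh.le,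
            mul_left_comm, ← Real.rpow_add hh]
          congr 2
          · field_simp
          · field_simp
            ring
        rw [e2, Real.mul_rpow (by positivity) (by positivity), ← Real.rpow_mul hR,
          ← Real.rpow_mul hh.le, mul_one_div_cancel hr0.ne', Real.rpow_one, mul_comm]
        congr 2
        field_simp

/-! ### Level sets of the averages -/

/-- The union of the cells on which the average of `g` exceeds `s`. -/
def badSet {d : ℕ} (g : (Fin d → ℝ) → ℝ) (r : ℝ) (M : ℕ) (s : ℝ) : Set (Fin d → ℝ) :=
  ⋃ m ∈ {m : Fin d → Fin M | s < cubeAvg g r (cellCorner m) (1 / (M : ℝ))},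
    closedCube (cellCorner m) (1 / (M : ℝ))

lemma measurableSet_badSet {d : ℕ} (g : (Fin d → ℝ) → ℝ) (r : ℝ) (M : ℕ) (s : ℝ) :
    MeasurableSet (badSet g r M s) :=
  (Set.toFinite _).measurableSet_biUnion fun _ _ => measurableSet_closedCube _ _

lemma badSet_subset {d : ℕ} (g : (Fin d → ℝ) → ℝ) (r : ℝ) {M : ℕ} (hM : 0 < M) (s : ℝ) :
    badSet g r M s ⊆ Set.Icc 0 1 :=
  Set.iUnion₂_subset fun m _ => closedCube_cellCorner_subset hM m

lemma integrableOn_truncation {d : ℕ} {g : (Fin d → ℝ) → ℝ} (hg : Continuous g)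
    {r : ℝ} (hr : 0 < r) (s : ℝ) (K : Set (Fin d → ℝ)) (hK : IsCompact K) :
    IntegrableOn ({x | s < 2 * g x}.indicator fun x => g x ^ r) K :=
  ((hg.rpow_const fun _ => Or.inr hr.le).continuousOn.integrableOn_compact hK).indicator
    (measurableSet_lt measurable_const (hg.measurable.const_mul 2))

/-- On a cell with mean above `s`, the values `g ≤ s / 2` contribute at most `(s/2)^r ≤ s^r / 2` to
the mean of `g^r`. The larger values therefore carry at least half of it, and Chebyshev applies to
the truncated function. The cells form a fixed partition, so no covering argument is needed. -/
lemma volume_badSet_le {d : ℕ} {g : (Fin d → ℝ) → ℝ} (hg : Continuous g) (h0 : ∀ x, 0 ≤ g x)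
    {r : ℝ} (hr : 1 < r) {M : ℕ} (hM : 0 < M) {s : ℝ} (hs : 0 < s) :
    volume.real (badSet g r M s) ≤
      2 * s ^ (-r) * ∫ x in Set.Icc 0 1, {x | s < 2 * g x}.indicator (fun x => g x ^ r) x := by
  classical
  have hM' : (0 : ℝ) < M := by exact_mod_cast hM
  have hr0 : 0 < r := by linarith
  set h : ℝ := 1 / (M : ℝ)
  have hh : 0 < h := by positivity
  set G : (Fin d → ℝ) → ℝ := {x | s < 2 * g x}.indicator fun x => g x ^ r
  have hG0 : ∀ x, 0 ≤ G x := fun x => Set.indicator_nonneg (fun x _ => Real.rpow_nonneg (h0 x) r) x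
  have hcell : ∀ m : Fin d → Fin M, s < cubeAvg g r (cellCorner m) h →
      h ^ d ≤ 2 * s ^ (-r) * ∫ x in closedCube (cellCorner m) h, G x := by
    intro m hm
    set Q := closedCube (cellCorner m) h
    have h1 : s ^ r < (h ^ d)⁻¹ * ∫ x in Q, g x ^ r := by
      have := Real.rpow_lt_rpow hs.le hm hr0
      rwa [cubeAvg, ← Real.rpow_mul (mul_nonneg (by positivity)
        (integral_nonneg fun x => Real.rpow_nonneg (h0 x) r)), one_div_mul_cancel hr0.ne',
        Real.rpow_one] at this
    have h2 : ∫ x in Q, g x ^ r ≤ (∫ x in Q, G x) + (s / 2) ^ r * h ^ d := by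
      have hGi : IntegrableOn G Q :=
        integrableOn_truncation hg hr0 s Q (isCompact_closedCube _ _)
      have hci : IntegrableOn (fun _ => (s / 2) ^ r) Q :=
        integrableOn_closedCube continuous_const
      have : (∫ x in Q, G x) + (s / 2) ^ r * h ^ d = ∫ x in Q, (G x + (s / 2) ^ r) := by
        rw [integral_add hGi hci, setIntegral_const, volumeReal_closedCube _ hh.le, smul_eq_mul,
          mul_comm (h ^ d)]
      rw [this]
      refine setIntegral_mono (integrableOn_closedCube
        (hg.rpow_const fun _ => Or.inr hr0.le)) (hGi.add hci) fun x => ?_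
      by_cases hx : s < 2 * g x
      · have : G x = g x ^ r := Set.indicator_of_mem (s := {x | s < 2 * g x}) hx _
        rw [this]
        have : 0 ≤ (s / 2) ^ r := by positivity
        linarith
      · have h3 : g x ^ r ≤ (s / 2) ^ r :=
          Real.rpow_le_rpow (h0 x) (by linarith [not_lt.1 hx]) hr0.le
        linarith [hG0 x]
    have h3 : (s / 2) ^ r ≤ s ^ r / 2 := by
      rw [Real.div_rpow hs.le (by norm_num)]
      gcongr
      calc (2 : ℝ) = 2 ^ (1 : ℝ) := by norm_num
        _ ≤ 2 ^ r := Real.rpow_le_rpow_of_exponent_le (by norm_num) hr.le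
    have hd : 0 < h ^ d := by positivity
    have h4 : s ^ r * h ^ d ≤ ∫ x in Q, g x ^ r := by
      rw [lt_inv_mul_iff₀ hd] at h1
      linarith
    have hsr : 0 < s ^ r := by positivity
    rw [Real.rpow_neg hs.le, mul_assoc, mul_left_comm, ← div_eq_inv_mul, le_div_iff₀ hsr]
    have h5 : (s / 2) ^ r * h ^ d ≤ s ^ r / 2 * h ^ d := mul_le_mul_of_nonneg_right h3 hd.le
    linarith
  have hset : badSet g r M s = ⋃ m ∈ Finset.univ.filter fun m : Fin d → Fin M =>
      s < cubeAvg g r (cellCorner m) h, closedCube (cellCorner m) h := by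
    ext x
    simp [badSet, h]
  calc volume.real (badSet g r M s)
      ≤ ∑ m ∈ Finset.univ.filter fun m : Fin d → Fin M =>
          s < cubeAvg g r (cellCorner m) h, volume.real (closedCube (cellCorner m) h) := by
        rw [hset]
        exact measureReal_biUnion_finset_le _ _
    _ ≤ ∑ m ∈ Finset.univ.filter fun m : Fin d → Fin M => s < cubeAvg g r (cellCorner m) h,
          2 * s ^ (-r) * ∫ x in closedCube (cellCorner m) h, G x := by
        refine Finset.sum_le_sum fun m hm => ?_
        rw [volumeReal_closedCube _ hh.le]
        exact hcell m (Finset.mem_filter.1 hm).2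
    _ ≤ ∑ m : Fin d → Fin M, 2 * s ^ (-r) * ∫ x in closedCube (cellCorner m) h, G x :=
        Finset.sum_le_sum_of_subset_of_nonneg (Finset.filter_subset _ _) fun m _ _ =>
          mul_nonneg (by positivity) (integral_nonneg hG0)
    _ ≤ 2 * s ^ (-r) * ∫ x in Set.Icc 0 1, G x := by
        rw [← Finset.mul_sum]
        refine mul_le_mul_of_nonneg_left ?_ (by positivity)
        exact sum_setIntegral_cells_le hM
          (integrableOn_truncation hg hr0 s _ isCompact_Icc) hG0

end MIND
end

noncomputable section
namespace MIND

/-! ### From local bounds to norm bounds -/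

/-- The local estimate on all cells of side length at least `C₀ / N`. -/
def LocalBound (C₁ C₀ : ℝ) (κ : ℕ) (r : ℝ) (N : ℕ) {d : ℕ} (b : ℝ) (v g : (Fin d → ℝ) → ℝ) :
    Prop :=
  ∀ M : ℕ, 0 < M → C₀ * M ≤ N → ∀ m : Fin d → Fin M,
    ∀ y ∈ closedCube (cellCorner m) (1 / (M : ℝ)), |v y| ≤
      C₁ * (b * (M : ℝ) ^ (d / 2 : ℝ) + (1 / (M : ℝ)) ^ κ * cubeAvg g r (cellCorner m) (1 / (M : ℝ)))

section
variable {C₁ C₀ : ℝ} {κ : ℕ} {r : ℝ} {N d : ℕ} {b R : ℝ} {v g : (Fin d → ℝ) → ℝ}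

/-- With the `L²` bound, both terms of the local estimate scale like `M^(d/2)`, with coefficients
`b` and `M^(-κ) R`. The number `D` records how far `M` may fall short of the balance `R = b M^κ`. -/
lemma LocalBound.abs_le (H : LocalBound C₁ C₀ κ r N b v g) (hC₁ : 0 ≤ C₁)
    (hg : Continuous g) (h0 : ∀ x, 0 ≤ g x) (hr : 1 < r) (hr2 : r < 2) (hR : 0 ≤ R)
    (hgR : ∫ x in Set.Icc 0 1, g x ^ 2 ≤ R ^ 2) {M : ℕ} (hM : 0 < M) (hMN : C₀ * M ≤ N)
    {D : ℝ} (hRD : R ≤ b * (D * M) ^ κ) {y : Fin d → ℝ} (hy : y ∈ Set.Icc (0 : Fin d → ℝ) 1) :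
    |v y| ≤ C₁ * (1 + D ^ κ) * b * (M : ℝ) ^ (d / 2 : ℝ) := by
  have hM' : (0 : ℝ) < M := by exact_mod_cast hM
  obtain ⟨m, hm⟩ := exists_mem_closedCube_cellCorner hM hy
  refine (H M hM hMN m y hm).trans ?_
  have h1 := cubeAvg_le hg h0 hr hr2 (one_div_pos.2 hM') (closedCube_cellCorner_subset hM m) hR hgR
  rw [one_div, Real.inv_rpow hM'.le, Real.rpow_neg hM'.le, inv_inv] at h1
  have h2 : (1 / (M : ℝ)) ^ κ * R ≤ b * D ^ κ := by
    rw [one_div, inv_pow, inv_mul_le_iff₀ (by positivity)]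
    refine hRD.trans (le_of_eq ?_)
    rw [mul_pow]
    ring
  have hX : 0 < (M : ℝ) ^ (d / 2 : ℝ) := by positivity
  have h3 : (1 / (M : ℝ)) ^ κ * cubeAvg g r (cellCorner m) (1 / (M : ℝ)) ≤
      b * D ^ κ * (M : ℝ) ^ (d / 2 : ℝ) := by
    calc _ ≤ (1 / (M : ℝ)) ^ κ * ((M : ℝ) ^ (d / 2 : ℝ) * R) := by
          rw [← one_div] at h1
          gcongr
      _ = ((1 / (M : ℝ)) ^ κ * R) * (M : ℝ) ^ (d / 2 : ℝ) := by ring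
      _ ≤ _ := mul_le_mul_of_nonneg_right h2 hX.le
  calc _ ≤ C₁ * (b * (M : ℝ) ^ (d / 2 : ℝ) + b * D ^ κ * (M : ℝ) ^ (d / 2 : ℝ)) := by gcongr
    _ = _ := by ring

/-- The threshold `b M^(κ + d/2)` is the size of the mean at which the derivative term equals the
data term `b M^(d/2)`. -/
lemma LocalBound.abs_le_of_notMem (H : LocalBound C₁ C₀ κ r N b v g) (hC₁ : 0 ≤ C₁)
    {M : ℕ} (hM : 0 < M) (hMN : C₀ * M ≤ N) {y : Fin d → ℝ} (hy : y ∈ Set.Icc (0 : Fin d → ℝ) 1)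
    (hyE : y ∉ badSet g r M (b * (M : ℝ) ^ (κ + d / 2 : ℝ))) :
    |v y| ≤ 2 * C₁ * b * (M : ℝ) ^ (d / 2 : ℝ) := by
  have hM' : (0 : ℝ) < M := by exact_mod_cast hM
  obtain ⟨m, hm⟩ := exists_mem_closedCube_cellCorner hM hy
  refine (H M hM hMN m y hm).trans ?_
  have h1 : cubeAvg g r (cellCorner m) (1 / (M : ℝ)) ≤ b * (M : ℝ) ^ (κ + d / 2 : ℝ) := by
    by_contra! hlt
    exact hyE (Set.mem_iUnion₂.2 ⟨m, hlt, hm⟩)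
  have h2 : (1 / (M : ℝ)) ^ κ * (b * (M : ℝ) ^ (κ + d / 2 : ℝ)) = b * (M : ℝ) ^ (d / 2 : ℝ) := by
    rw [Real.rpow_add hM', Real.rpow_natCast, one_div, inv_pow]
    field_simp
  calc _ ≤ C₁ * (b * (M : ℝ) ^ (d / 2 : ℝ) + (1 / (M : ℝ)) ^ κ * (b * (M : ℝ) ^ (κ + d / 2 : ℝ))) := by
        gcongr
    _ = _ := by rw [h2]; ring

/-- When `R ≤ b` the balance is already reached with the whole unit cube as the only cell. -/
lemma LocalBound.abs_le_of_le (H : LocalBound C₁ C₀ κ r N b v g) (hC₁ : 0 ≤ C₁)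
    (hg : Continuous g) (h0 : ∀ x, 0 ≤ g x) (hr : 1 < r) (hr2 : r < 2) (hR : 0 ≤ R)
    (hgR : ∫ x in Set.Icc 0 1, g x ^ 2 ≤ R ^ 2) (hN : C₀ ≤ N) (hRb : R ≤ b)
    {y : Fin d → ℝ} (hy : y ∈ Set.Icc (0 : Fin d → ℝ) 1) : |v y| ≤ 2 * C₁ * b := by
  have := H.abs_le hC₁ hg h0 hr hr2 hR hgR (M := 1) one_pos (by simpa using hN) (D := 1)
    (by simpa using hRb) hy
  simp only [one_pow, Nat.cast_one, Real.one_rpow, mul_one] at this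
  linarith

lemma LocalBound.abs_le_of_lt (H : LocalBound C₁ C₀ κ r N b v g) (hC₁ : 0 ≤ C₁) (hC₀ : 1 ≤ C₀)
    (hκ : 0 < κ)
    (hg : Continuous g) (h0 : ∀ x, 0 ≤ g x) (hr : 1 < r) (hr2 : r < 2) (hR : 0 ≤ R)
    (hgR : ∫ x in Set.Icc 0 1, g x ^ 2 ≤ R ^ 2) (hN : C₀ ≤ N) (hb : 0 < b) (hRb : b < R)
    (hRN : R ≤ b * (N : ℝ) ^ κ)
    {y : Fin d → ℝ} (hy : y ∈ Set.Icc (0 : Fin d → ℝ) 1) :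
    |v y| ≤ C₁ * (1 + (2 * C₀) ^ κ) * b * (R / b) ^ (d / (2 * κ) : ℝ) := by
  have hκ' : (0 : ℝ) < κ := by exact_mod_cast hκ
  -- `X` is the ideal number of cells per side, solving `b X^κ = R`.
  set X : ℝ := (R / b) ^ (1 / (κ : ℝ)) with hX
  have hRb1 : 1 ≤ R / b := by rw [le_div_iff₀ hb]; linarith
  have hX1 : 1 ≤ X := Real.one_le_rpow hRb1 (by positivity)
  have hXκ : X ^ κ = R / b := by
    rw [hX, ← Real.rpow_natCast, ← Real.rpow_mul (by positivity), one_div_mul_cancel hκ'.ne',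
      Real.rpow_one]
  have hXN : X ≤ N := by
    have : X ^ κ ≤ (N : ℝ) ^ κ := by
      rw [hXκ, div_le_iff₀ hb]; linarith
    exact le_of_pow_le_pow_left₀ hκ.ne' (by positivity) this
  have hC₀' : 0 < C₀ := by linarith
  -- Dividing by `C₀` keeps the cells coarse relative to the grid, as `X ≤ N`. Rounding loses at
  -- most a factor `2`, whence `D = 2 C₀`.
  set M : ℕ := max 1 ⌊X / C₀⌋₊ with hM
  have hM1 : 0 < M := lt_of_lt_of_le one_pos (le_max_left _ _)
  have hfl := Nat.floor_le (show 0 ≤ X / C₀ by positivity)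
  have hMle : C₀ * M ≤ max C₀ X := by
    rw [hM, Nat.cast_max, Nat.cast_one, mul_max_of_nonneg _ _ hC₀'.le, mul_one]
    refine max_le_max le_rfl ?_
    rw [le_div_iff₀ hC₀'] at hfl
    linarith
  have hMX : (M : ℝ) ≤ X := by
    rw [hM, Nat.cast_max, Nat.cast_one]
    exact max_le hX1 (hfl.trans (div_le_self (by positivity) hC₀))
  have hXM : X ≤ 2 * C₀ * M := by
    have h1 := Nat.lt_floor_add_one (X / C₀)
    have h2 : (1 : ℝ) ≤ M := by exact_mod_cast hM1
    have h3 : (⌊X / C₀⌋₊ : ℝ) ≤ M := by exact_mod_cast le_max_right _ _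
    have h4 : X / C₀ ≤ 2 * M := by linarith
    rw [div_le_iff₀ hC₀'] at h4
    linarith
  have hRD : R ≤ b * (2 * C₀ * M) ^ κ := by
    have : X ^ κ ≤ (2 * C₀ * M) ^ κ := by gcongr
    rw [hXκ, div_le_iff₀ hb] at this
    linarith
  refine (H.abs_le hC₁ hg h0 hr hr2 hR hgR hM1 (hMle.trans (max_le hN hXN)) hRD hy).trans ?_
  have h5 : (M : ℝ) ^ (d / 2 : ℝ) ≤ (R / b) ^ (d / (2 * κ) : ℝ) := by
    calc (M : ℝ) ^ (d / 2 : ℝ) ≤ X ^ (d / 2 : ℝ) := by gcongr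
      _ = _ := by
        rw [hX, ← Real.rpow_mul (by positivity)]
        congr 1
        field_simp
  gcongr

end

/-- An increasing geometric sum is dominated by its last term; the terms that count are below `G`,
so the bound does not depend on `J`. -/
lemma sum_geometric_truncated_le {σ : ℕ → ℝ} {q : ℝ} (hq : 1 < q) (h0 : 0 ≤ σ 0)
    (hσ : ∀ j, σ (j + 1) = q * σ j) {G : ℝ} (hG : 0 ≤ G) (J : ℕ) :
    ∑ j ∈ Finset.range J, (if σ j < G then σ j else 0) ≤ q / (q - 1) * G := by
  have hq1 : 0 < q - 1 := by linarith
  have hσ0 : ∀ j, 0 ≤ σ j := by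
    intro j
    induction j with
    | zero => exact h0
    | succ n ih => rw [hσ]; positivity
  have h1 : ∀ J, ∑ j ∈ Finset.range J, (if σ j < G then σ j else 0) ≤ σ J / (q - 1) := by
    intro J
    induction J with
    | zero => simpa using div_nonneg h0 hq1.le
    | succ n ih =>
      rw [Finset.sum_range_succ, hσ]
      have : (if σ n < G then σ n else 0) ≤ σ n := by
        split_ifs
        · exact le_rfl
        · exact hσ0 n
      have e : q * σ n / (q - 1) = σ n / (q - 1) + σ n := by
        field_simp
        ring
      linarith
  induction J with
  | zero => simpa using mul_nonneg (div_nonneg (by linarith) hq1.le) hG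
  | succ n ih =>
    rw [Finset.sum_range_succ]
    split_ifs with h
    · have e : q / (q - 1) * G = G / (q - 1) + G := by
        field_simp
        ring
      have := h1 n
      have h3 : σ n / (q - 1) ≤ G / (q - 1) := by gcongr
      linarith
    · simpa using ih

/-! ### The bound at the critical exponent by dyadic stopping -/

section
variable {C₁ C₀ : ℝ} {κ : ℕ} {r : ℝ} {N d : ℕ} {b R : ℝ} {v g : (Fin d → ℝ) → ℝ}

/-- The Lebesgue exponent at which the two regimes of the rate meet. -/
def critExp (κ d : ℕ) : ℝ := (4 * κ + 2 * d) / d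

/-- This identity singles out the exponent: the height `2^(j d/2)` raised to the power `critExp κ d`
is the square of the threshold factor `2^(j (κ + d/2))`, so the sum over scales can be compared with
`∫ g^2`. -/
lemma critExp_mul (κ : ℕ) {d : ℕ} (hd : 1 ≤ d) : (d / 2 : ℝ) * critExp κ d = 2 * κ + d := by
  have : (d : ℝ) ≠ 0 := by positivity
  unfold critExp
  field_simp
  ring

lemma two_lt_critExp {κ d : ℕ} (hκ : 0 < κ) (hd : 1 ≤ d) : 2 < critExp κ d := by
  have h1 : (0 : ℝ) < d := by exact_mod_cast hd
  have h2 : (0 : ℝ) < κ := by exact_mod_cast hκ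
  rw [critExp, lt_div_iff₀ h1]
  linarith

/-- For each `y`, stop at the first dyadic scale at which `|v y|` is below `C₂ b 2^(j d/2)`. Scale
`0` is accounted for by the constant term. If the process stops at `j + 1`, then scale `j` failed
and `abs_le_of_notMem` places `y` in the bad set of that scale. -/
lemma LocalBound.pointwise_rpow_le (H : LocalBound C₁ C₀ κ r N b v g) (hC₁ : 0 ≤ C₁)
    (hC₀ : 1 ≤ C₀) {p : ℝ} (hp : 0 < p)
    (hg : Continuous g) (h0 : ∀ x, 0 ≤ g x) (hr : 1 < r) (hr2 : r < 2) (hR : 0 ≤ R)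
    (hgR : ∫ x in Set.Icc 0 1, g x ^ 2 ≤ R ^ 2) (hN : C₀ ≤ N) (hb : 0 < b)
    (hRN : R ≤ b * (N : ℝ) ^ κ) :
    ∃ J : ℕ, ∀ y ∈ Set.Icc (0 : Fin d → ℝ) 1, |v y| ^ p ≤
      (C₁ * (1 + (2 * C₀) ^ κ) * b) ^ p + ∑ j ∈ Finset.range J,
        (badSet g r (2 ^ j) (b * ((2 ^ j : ℕ) : ℝ) ^ (κ + d / 2 : ℝ))).indicator
          (fun _ => (C₁ * (1 + (2 * C₀) ^ κ) * b * ((2 ^ (j + 1) : ℕ) : ℝ) ^ (d / 2 : ℝ)) ^ p) y := by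
  set C₂ := C₁ * (1 + (2 * C₀) ^ κ) with hC₂
  have hC₀' : 0 < C₀ := by linarith
  have hC₂0 : 0 ≤ C₂ := by positivity
  have h21 : 2 * C₁ ≤ C₂ := by
    have : 1 ≤ (2 * C₀) ^ κ := one_le_pow₀ (by linarith)
    nlinarith
  -- `2 ^ J` is the finest dyadic partition allowed by the grid. It succeeds everywhere because `2 ^
  -- J` is within a factor `2 C₀` of `N` and `R ≤ b N^κ`, so the process always stops by scale `J`.
  set t : ℕ := ⌊(N : ℝ) / C₀⌋₊
  have ht1 : 1 ≤ t := by
    rw [Nat.le_floor_iff (by positivity), Nat.cast_one, le_div_iff₀ hC₀']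
    linarith
  set J := Nat.log 2 t
  have hJ1 : 2 ^ J ≤ t := Nat.pow_log_le_self 2 (by omega)
  have hJ2 : t < 2 ^ (J + 1) := Nat.lt_pow_succ_log_self (by norm_num) t
  have hMN : ∀ j ≤ J, C₀ * ((2 ^ j : ℕ) : ℝ) ≤ N := by
    intro j hj
    have h1 : ((2 ^ j : ℕ) : ℝ) ≤ t := by
      exact_mod_cast (Nat.pow_le_pow_right (by norm_num) hj).trans hJ1
    have h2 := Nat.floor_le (show 0 ≤ (N : ℝ) / C₀ by positivity)
    rw [le_div_iff₀ hC₀'] at h2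
    nlinarith
  have hlast : ∀ y ∈ Set.Icc (0 : Fin d → ℝ) 1,
      |v y| ≤ C₂ * b * ((2 ^ J : ℕ) : ℝ) ^ (d / 2 : ℝ) := by
    intro y hy
    refine H.abs_le hC₁ hg h0 hr hr2 hR hgR (by positivity) (hMN J le_rfl) ?_ hy
    have h1 : (N : ℝ) ≤ 2 * C₀ * ((2 ^ J : ℕ) : ℝ) := by
      have h2 := Nat.lt_floor_add_one ((N : ℝ) / C₀)
      have h3 : ((t + 1 : ℕ) : ℝ) ≤ ((2 ^ (J + 1) : ℕ) : ℝ) := by exact_mod_cast hJ2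
      rw [div_lt_iff₀ hC₀'] at h2
      push_cast at h3 ⊢
      rw [pow_succ] at h3
      have h4 : ((t : ℝ) + 1) * C₀ ≤ 2 ^ J * 2 * C₀ := by gcongr
      linarith
    refine hRN.trans ?_
    gcongr
  refine ⟨J, fun y hy => ?_⟩
  classical
  have hex : ∃ j, |v y| ≤ C₂ * b * ((2 ^ j : ℕ) : ℝ) ^ (d / 2 : ℝ) := ⟨J, hlast y hy⟩
  have hsum0 : ∀ j, 0 ≤ (badSet g r (2 ^ j) (b * ((2 ^ j : ℕ) : ℝ) ^ (κ + d / 2 : ℝ))).indicator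
          (fun _ => (C₂ * b * ((2 ^ (j + 1) : ℕ) : ℝ) ^ (d / 2 : ℝ)) ^ p) y := fun j =>
    Set.indicator_nonneg (fun _ _ => by positivity) y
  have hj := Nat.find_spec hex
  have hjJ : Nat.find hex ≤ J := Nat.find_min' hex (hlast y hy)
  rcases hcase : Nat.find hex with _ | j
  · rw [hcase] at hj
    have h1 : |v y| ≤ C₂ * b := by simpa using hj
    have h2 : |v y| ^ p ≤ (C₂ * b) ^ p := Real.rpow_le_rpow (abs_nonneg _) h1 hp.le
    have h3 := Finset.sum_nonneg (s := Finset.range J) fun j _ => hsum0 j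
    linarith
  · have hlt : j < Nat.find hex := by omega
    have hnot := Nat.find_min hex hlt
    have hmem : y ∈ badSet g r (2 ^ j) (b * ((2 ^ j : ℕ) : ℝ) ^ (κ + d / 2 : ℝ)) := by
      by_contra hne
      refine hnot ((H.abs_le_of_notMem hC₁ (by positivity) (hMN j (by omega)) hy hne).trans ?_)
      gcongr
    rw [hcase] at hj
    have h1 : |v y| ^ p ≤ (C₂ * b * ((2 ^ (j + 1) : ℕ) : ℝ) ^ (d / 2 : ℝ)) ^ p :=
      Real.rpow_le_rpow (abs_nonneg _) hj hp.le
    have h2 := Finset.single_le_sum (f := fun j =>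
      (badSet g r (2 ^ j) (b * ((2 ^ j : ℕ) : ℝ) ^ (κ + d / 2 : ℝ))).indicator
          (fun _ => (C₂ * b * ((2 ^ (j + 1) : ℕ) : ℝ) ^ (d / 2 : ℝ)) ^ p) y)
      (fun j _ => hsum0 j) (Finset.mem_range.2 (show j < J by omega))
    simp only [Set.indicator_of_mem hmem] at h2
    have h3 : 0 ≤ (C₂ * b) ^ p := by positivity
    linarith

/-- The bound at the critical exponent. -/
lemma LocalBound.integral_rpow_le (H : LocalBound C₁ C₀ κ r N b v g) (hC₁ : 0 ≤ C₁)
    (hC₀ : 1 ≤ C₀) (hκ : 0 < κ) (hd : 1 ≤ d) (hv : Continuous v)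
    (hg : Continuous g) (h0 : ∀ x, 0 ≤ g x) (hr : 1 < r) (hr2 : r < 2) (hR : 0 ≤ R)
    (hgR : ∫ x in Set.Icc 0 1, g x ^ 2 ≤ R ^ 2) (hN : C₀ ≤ N) (hb : 0 < b)
    (hRN : R ≤ b * (N : ℝ) ^ κ) :
    ∫ x in Set.Icc 0 1, |v x| ^ critExp κ d ≤
      (C₁ * (1 + (2 * C₀) ^ κ)) ^ critExp κ d *
        (1 + 2 * 2 ^ (2 * κ + d : ℝ) * 2 ^ (2 - r) *
          ((2 ^ (κ + d / 2 : ℝ)) ^ (2 - r) / ((2 ^ (κ + d / 2 : ℝ)) ^ (2 - r) - 1))) *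
        (b ^ critExp κ d + b ^ (critExp κ d - 2) * R ^ 2) := by
  set p := critExp κ d with hp
  have hp2 : 2 < p := two_lt_critExp hκ hd
  set C₂ := C₁ * (1 + (2 * C₀) ^ κ) with hC₂
  have hC₂0 : 0 ≤ C₂ := by positivity
  obtain ⟨J, hJ⟩ := H.pointwise_rpow_le hC₁ hC₀ (p := p) (by linarith) hg h0 hr hr2 hR hgR hN hb hRN
  rw [← hC₂] at hJ
  clear_value C₂
  set ρ : ℝ := 2 ^ (κ + d / 2 : ℝ) with hρ
  have hκ' : (1 : ℝ) ≤ κ := by exact_mod_cast hκ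
  have hρ1 : 1 < ρ := Real.one_lt_rpow (by norm_num) (by positivity)
  have hρ0 : 0 < ρ := by linarith
  have hα : 0 < 2 - r := by linarith
  set q := ρ ^ (2 - r) with hq
  have hq1 : 1 < q := Real.one_lt_rpow hρ1 hα
  let s : ℕ → ℝ := fun j => b * ((2 ^ j : ℕ) : ℝ) ^ (κ + d / 2 : ℝ)
  let l : ℕ → ℝ := fun j => (C₂ * b * ((2 ^ (j + 1) : ℕ) : ℝ) ^ (d / 2 : ℝ)) ^ p
  have hs0 : ∀ j, 0 < s j := fun j => by positivity
  have hl0 : ∀ j, 0 ≤ l j := fun j => by positivity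
  have hs1 : ∀ j, s (j + 1) = ρ * s j := by
    intro j
    simp only [s, hρ]
    push_cast
    rw [pow_succ, Real.mul_rpow (by positivity) (by norm_num)]
    ring
  -- The heights are proportional to the squared thresholds, by the choice of the exponent
  -- (`critExp_mul`).
  have hl1 : ∀ j, l j = C₂ ^ p * 2 ^ (2 * κ + d : ℝ) * b ^ (p - 2) * s j ^ (2 : ℝ) := by
    intro j
    simp only [l, s]
    push_cast
    have e1 : ((2 : ℝ) ^ j * 2) ^ (d / 2 : ℝ) = (2 ^ j) ^ (d / 2 : ℝ) * 2 ^ (d / 2 : ℝ) :=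
      Real.mul_rpow (by positivity) (by norm_num)
    rw [pow_succ, e1, Real.mul_rpow (by positivity) (by positivity),
      Real.mul_rpow hC₂0 hb.le, Real.mul_rpow (by positivity) (by positivity),
      ← Real.rpow_mul (by positivity), ← Real.rpow_mul (by norm_num), hp, critExp_mul κ hd, ← hp,
      Real.mul_rpow hb.le (by positivity), ← Real.rpow_mul (by positivity)]
    have e2 : b ^ p = b ^ (p - 2) * b ^ (2 : ℝ) := by
      rw [← Real.rpow_add hb]; congr 1; ring
    have e3 : ((κ : ℝ) + d / 2) * 2 = 2 * κ + d := by ring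
    rw [e2, e3]
    ring
  set C₃ := C₂ ^ p * 2 ^ (2 * κ + d : ℝ) * b ^ (p - 2) with hC₃
  have hC₃0 : 0 ≤ C₃ := by positivity
  let E : ℕ → Set (Fin d → ℝ) := fun j => badSet g r (2 ^ j) (s j)
  have hEm : ∀ j, MeasurableSet (E j) := fun j => measurableSet_badSet _ _ _ _
  have hEs : ∀ j, E j ⊆ Set.Icc 0 1 := fun j => badSet_subset g r (by positivity) _
  have hEi : ∀ j, IntegrableOn ((E j).indicator fun _ => l j) (Set.Icc 0 1) := fun j =>
    (continuous_const.continuousOn.integrableOn_compact isCompact_Icc).indicator (hEm j)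
  have hEint : ∀ j, ∫ x in Set.Icc 0 1, (E j).indicator (fun _ => l j) x =
      volume.real (E j) * l j := by
    intro j
    rw [integral_indicator (hEm j), setIntegral_const, smul_eq_mul,
      measureReal_restrict_apply (hEm j), Set.inter_eq_left.2 (hEs j)]
  let G : ℕ → (Fin d → ℝ) → ℝ := fun j => {x | s j < 2 * g x}.indicator fun x => g x ^ r
  have hGi : ∀ j, IntegrableOn (G j) (Set.Icc 0 1) := fun j =>
    integrableOn_truncation hg (by linarith) _ _ isCompact_Icc
  -- For fixed `x` only scales with `s j < 2 g x` contribute. Since `r < 2`, the powers `s j ^ (2 -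
  -- r)` grow geometrically, and their truncated sum is of order `g x ^ (2 - r)`, which restores `g
  -- x ^ 2`.
  have hGsum : ∀ x, ∑ j ∈ Finset.range J, s j ^ (2 - r) * G j x ≤
      2 ^ (2 - r) * (q / (q - 1)) * g x ^ 2 := by
    intro x
    have h1 := sum_geometric_truncated_le (σ := fun j => s j ^ (2 - r)) hq1
      (by have := hs0 0; positivity) (fun j => by
        simp only [hs1]
        rw [Real.mul_rpow hρ0.le (hs0 j).le]) (G := (2 * g x) ^ (2 - r))
      (Real.rpow_nonneg (by linarith [h0 x]) _) J
    have hiff : ∀ j, s j ^ (2 - r) < (2 * g x) ^ (2 - r) ↔ s j < 2 * g x := fun j =>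
      Real.rpow_lt_rpow_iff (hs0 j).le (by linarith [h0 x]) hα
    simp only [hiff] at h1
    have h2 : ∀ j, s j ^ (2 - r) * G j x =
        (if s j < 2 * g x then s j ^ (2 - r) else 0) * g x ^ r := by
      intro j
      by_cases h : s j < 2 * g x
      · have : G j x = g x ^ r := Set.indicator_of_mem (s := {x | s j < 2 * g x}) h _
        rw [this, if_pos h]
      · have : G j x = 0 := Set.indicator_of_notMem (s := {x | s j < 2 * g x}) h _
        rw [this, if_neg h]; ring
    simp only [h2]
    rw [← Finset.sum_mul]
    calc _ ≤ (q / (q - 1) * (2 * g x) ^ (2 - r)) * g x ^ r :=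
          mul_le_mul_of_nonneg_right h1 (Real.rpow_nonneg (h0 x) r)
      _ = 2 ^ (2 - r) * (q / (q - 1)) * (g x ^ (2 - r) * g x ^ r) := by
          rw [Real.mul_rpow (by norm_num) (h0 x)]; ring
      _ = _ := by
          rw [← Real.rpow_add' (h0 x) (by norm_num), sub_add_cancel, Real.rpow_two]
  set C₄ := 2 ^ (2 - r) * (q / (q - 1)) with hC₄
  have hC₄0 : 0 ≤ C₄ := by
    have : 0 < q - 1 := by linarith
    positivity
  have hK : volume.real (Set.Icc (0 : Fin d → ℝ) 1) = 1 := by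
    simp [Measure.real, Real.volume_Icc_pi]
  have hci : IntegrableOn (fun _ : Fin d → ℝ => (C₂ * b) ^ p) (Set.Icc 0 1) :=
    continuous_const.continuousOn.integrableOn_compact isCompact_Icc
  calc ∫ x in Set.Icc 0 1, |v x| ^ p
      ≤ ∫ x in Set.Icc 0 1, ((C₂ * b) ^ p + ∑ j ∈ Finset.range J,
          (E j).indicator (fun _ => l j) x) := by
        refine setIntegral_mono_on ?_ (hci.add (integrable_finsetSum _ fun j _ => hEi j))
          measurableSet_Icc hJ
        exact (hv.abs.rpow_const fun _ => Or.inr (by linarith)).continuousOn.integrableOn_compact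
          isCompact_Icc
    _ = (C₂ * b) ^ p + ∑ j ∈ Finset.range J, volume.real (E j) * l j := by
        rw [integral_add hci (integrable_finsetSum _ fun j _ => hEi j),
          integral_finsetSum _ fun j _ => hEi j, setIntegral_const, hK, one_smul]
        simp only [hEint]
    _ ≤ (C₂ * b) ^ p + ∑ j ∈ Finset.range J,
          (2 * s j ^ (-r) * ∫ x in Set.Icc 0 1, G j x) * l j := by
        gcongr with j
        exact volume_badSet_le hg h0 hr (by positivity) (hs0 j)
    _ = (C₂ * b) ^ p + 2 * C₃ * ∫ x in Set.Icc 0 1,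
          ∑ j ∈ Finset.range J, s j ^ (2 - r) * G j x := by
        rw [integral_finsetSum _ fun j _ => (hGi j).const_mul _, Finset.mul_sum]
        congr 1
        refine Finset.sum_congr rfl fun j _ => ?_
        rw [integral_const_mul, hl1 j, sub_eq_add_neg (2 : ℝ) r, Real.rpow_add (hs0 j)]
        ring
    _ ≤ (C₂ * b) ^ p + 2 * C₃ * ∫ x in Set.Icc 0 1, C₄ * g x ^ 2 := by
        refine add_le_add le_rfl (mul_le_mul_of_nonneg_left (setIntegral_mono ?_ ?_ hGsum)
          (by positivity))
        · exact integrable_finsetSum _ fun j _ => (hGi j).const_mul _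
        · exact (continuous_const.mul (hg.pow 2)).continuousOn.integrableOn_compact isCompact_Icc
    _ ≤ (C₂ * b) ^ p + 2 * C₃ * (C₄ * R ^ 2) := by
        rw [integral_const_mul]
        gcongr
    _ ≤ _ := by
        rw [Real.mul_rpow hC₂0 hb.le]
        have e1 : 0 ≤ C₂ ^ p := by positivity
        have e2 : 0 ≤ b ^ p := by positivity
        have e3 : 0 ≤ b ^ (p - 2) * R ^ 2 := by positivity
        have e4 : (0 : ℝ) ≤ 2 * 2 ^ (2 * κ + d : ℝ) * 2 ^ (2 - r) * (q / (q - 1)) := by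
          have : 0 < q - 1 := by linarith
          positivity
        have e5 : 2 * C₃ * (C₄ * R ^ 2) = C₂ ^ p * (2 * 2 ^ (2 * κ + d : ℝ) * 2 ^ (2 - r) *
            (q / (q - 1))) * (b ^ (p - 2) * R ^ 2) := by
          rw [hC₃, hC₄]; ring
        rw [e5]
        set Z := 2 * 2 ^ (2 * κ + d : ℝ) * 2 ^ (2 - r) * (q / (q - 1))
        have e6 : 0 ≤ C₂ ^ p * (Z * b ^ p) := by positivity
        have e7 : 0 ≤ C₂ ^ p * (b ^ (p - 2) * R ^ 2) := by positivity
        nlinarith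
end

end MIND
end

noncomputable section
namespace MIND

/-! ### The interpolation inequality -/

lemma theta_of_le {k d : ℕ} {q : ℝ≥0∞} (h : q ≤ ENNReal.ofReal (critExp k d)) :
    theta k d q = (k : ℝ) / (2 * k + d) := if_pos h

lemma theta_of_lt {k d : ℕ} {q : ℝ≥0∞} (h : ¬ q ≤ ENNReal.ofReal (critExp k d)) :
    theta k d q = (k - d / 2 + d * (q⁻¹).toReal) / (2 * k) := if_neg h

lemma inv_toReal_le_of_lt {k d : ℕ} (hk : 0 < k) (hd : 1 ≤ d) {q : ℝ≥0∞}
    (h : ¬ q ≤ ENNReal.ofReal (critExp k d)) : (q⁻¹).toReal ≤ 1 / 2 := by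
  have h2 : (2 : ℝ≥0∞) ≤ q := by
    refine le_trans ?_ (not_le.1 h).le
    rw [← ENNReal.ofReal_ofNat 2]
    exact ENNReal.ofReal_le_ofReal (two_lt_critExp hk hd).le
  have h3 : q⁻¹ ≤ 2⁻¹ := ENNReal.inv_le_inv.2 h2
  have := ENNReal.toReal_mono (by simp) h3
  simpa using this

lemma theta_pos {k d : ℕ} (hd : 1 ≤ d) (hk : (d : ℝ) / 2 < k) (q : ℝ≥0∞) : 0 < theta k d q := by
  have h1 : (0 : ℝ) < d := by exact_mod_cast hd
  have h2 : (0 : ℝ) < k := by linarith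
  by_cases h : q ≤ ENNReal.ofReal (critExp k d)
  · rw [theta_of_le h]; positivity
  · rw [theta_of_lt h]
    have : 0 ≤ (d : ℝ) * (q⁻¹).toReal := by positivity
    exact div_pos (by linarith) (by positivity)

lemma two_mul_theta_le_one {k d : ℕ} (hd : 1 ≤ d) (hk : (d : ℝ) / 2 < k) (q : ℝ≥0∞) :
    2 * theta k d q ≤ 1 := by
  have h1 : (0 : ℝ) < d := by exact_mod_cast hd
  have h2 : (0 : ℝ) < k := by linarith
  by_cases h : q ≤ ENNReal.ofReal (critExp k d)
  · rw [theta_of_le h, ← mul_div_assoc, div_le_one (by positivity)]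
    linarith
  · rw [theta_of_lt h, ← mul_div_assoc, div_le_one (by positivity)]
    have := inv_toReal_le_of_lt (by exact_mod_cast h2) hd h
    nlinarith

/-! ### Passage between Lebesgue exponents -/

lemma eLpNorm_le_of_integral_rpow_le {d : ℕ} {v : (Fin d → ℝ) → ℝ} (hv : Continuous v)
    {t Y : ℝ} (ht : 0 < t) (hY : 0 ≤ Y)
    (h : ∫ x in Set.Icc 0 1, |v x| ^ t ≤ Y ^ t) :
    eLpNorm v (ENNReal.ofReal t) (torusMeasure d) ≤ ENNReal.ofReal Y := by
  rw [(memLp_torusMeasure_of_continuous hv _).eLpNorm_eq_integral_rpow_norm (by simpa using ht)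
    ENNReal.ofReal_ne_top, ENNReal.toReal_ofReal ht.le]
  refine ENNReal.ofReal_le_ofReal ?_
  have h1 : (∫ x, ‖v x‖ ^ t ∂torusMeasure d) ^ t⁻¹ ≤ (Y ^ t) ^ t⁻¹ :=
    Real.rpow_le_rpow (integral_nonneg fun x => by positivity) h (by positivity)
  rwa [← Real.rpow_mul hY, mul_inv_cancel₀ ht.ne', Real.rpow_one] at h1

lemma eLpNorm_le_of_forall_abs_le {d : ℕ} {v : (Fin d → ℝ) → ℝ} {B : ℝ} (q : ℝ≥0∞)
    (h : ∀ x ∈ Set.Icc (0 : Fin d → ℝ) 1, |v x| ≤ B) :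
    eLpNorm v q (torusMeasure d) ≤ ENNReal.ofReal B := by
  have h1 : ∀ᵐ x ∂(torusMeasure d), ‖v x‖ ≤ B :=
    (ae_restrict_iff' measurableSet_Icc).2 (Filter.Eventually.of_forall h)
  have := eLpNorm_le_of_ae_bound (p := q) h1
  simpa using this

/-- Interpolation between the bound at the critical exponent and the uniform bound. -/
lemma eLpNorm_le_of_bounds {k d : ℕ} (hd : 1 ≤ d) (hk : (d : ℝ) / 2 < k)
    {v : (Fin d → ℝ) → ℝ} (hv : Continuous v) {b x C : ℝ} (hb : 0 < b) (hx : 0 < x) (hC : 1 ≤ C)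
    (hsup : ∀ y ∈ Set.Icc (0 : Fin d → ℝ) 1, |v y| ≤ C * b * x ^ (d / (2 * k) : ℝ))
    (hint : ∫ y in Set.Icc 0 1, |v y| ^ critExp k d ≤ C * (b ^ critExp k d * x ^ 2))
    (q : ℝ≥0∞) :
    eLpNorm v q (torusMeasure d) ≤ ENNReal.ofReal (C * (b * x ^ (1 - 2 * theta k d q))) := by
  have h1 : (0 : ℝ) < d := by exact_mod_cast hd
  have h2 : (0 : ℝ) < k := by linarith
  have hk0 : 0 < k := by exact_mod_cast h2
  have hp2 := two_lt_critExp hk0 hd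
  have hpdef : critExp k d = (4 * k + 2 * d) / d := rfl
  set p := critExp k d
  have hC0 : 0 < C := by linarith
  have hint' : ∫ y in Set.Icc 0 1, |v y| ^ p ≤ C ^ p * (b ^ p * x ^ (2 : ℝ)) := by
    rw [Real.rpow_two]
    refine hint.trans ?_
    gcongr
    calc C = C ^ (1 : ℝ) := (Real.rpow_one C).symm
      _ ≤ C ^ p := Real.rpow_le_rpow_of_exponent_le hC (by linarith)
  -- Below the critical exponent `θ` does not depend on `q`, and monotonicity of `L^q` norms on a
  -- probability space suffices.
  by_cases hq : q ≤ ENNReal.ofReal p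
  · refine (eLpNorm_le_eLpNorm_of_exponent_le hq hv.aestronglyMeasurable).trans ?_
    refine eLpNorm_le_of_integral_rpow_le hv (by linarith) (by positivity) ?_
    refine hint'.trans (le_of_eq ?_)
    rw [Real.mul_rpow hC0.le (by positivity), Real.mul_rpow hb.le (by positivity),
      ← Real.rpow_mul hx.le, theta_of_le hq]
    congr 3
    rw [hpdef]
    field_simp
    ring
  · by_cases hqt : q = ∞
    · have hth : 1 - 2 * theta k d q = d / (2 * k) := by
        rw [theta_of_lt hq, hqt]
        simp only [ENNReal.inv_top, ENNReal.toReal_zero]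
        field_simp
        ring
      rw [hth, ← mul_assoc]
      exact eLpNorm_le_of_forall_abs_le q hsup
    · set t := q.toReal with ht
      have hqe : q = ENNReal.ofReal t := (ENNReal.ofReal_toReal hqt).symm
      have htp : p < t := by
        have := not_le.1 hq
        rw [hqe] at this
        exact (ENNReal.ofReal_lt_ofReal_iff_of_nonneg (by linarith)).1 this
      have ht0 : 0 < t := by linarith
      have hth : 1 - 2 * theta k d q = d / (2 * k) - d / (k * t) := by
        rw [theta_of_lt hq, ENNReal.toReal_inv, ← ht]
        field_simp
        ring
      rw [hth]
      conv_lhs => rw [hqe]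
      refine eLpNorm_le_of_integral_rpow_le hv ht0 (by positivity) ?_
      set W := C * b * x ^ (d / (2 * k) : ℝ) with hW
      have hW0 : 0 < W := by positivity
      have hcont : ∀ s : ℝ, 0 ≤ s → IntegrableOn (fun y => |v y| ^ s) (Set.Icc 0 1) := fun s hs =>
        (hv.abs.rpow_const fun _ => Or.inr hs).continuousOn.integrableOn_compact isCompact_Icc
      -- Split `|v|^t = |v|^(t-p) |v|^p` and use the uniform bound `W` on the first factor.
      calc ∫ y in Set.Icc 0 1, |v y| ^ t
          ≤ ∫ y in Set.Icc 0 1, W ^ (t - p) * |v y| ^ p := by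
            refine setIntegral_mono_on (hcont t ht0.le)
              ((hcont p (by linarith)).const_mul _) measurableSet_Icc fun y hy => ?_
            have e1 : |v y| ^ t = |v y| ^ (t - p) * |v y| ^ p := by
              rw [← Real.rpow_add' (abs_nonneg _) (by linarith), sub_add_cancel]
            rw [e1]
            gcongr
            exact hsup y hy
        _ ≤ W ^ (t - p) * (C ^ p * (b ^ p * x ^ (2 : ℝ))) := by
            rw [integral_const_mul]
            gcongr
        _ = (C * (b * x ^ (d / (2 * k) - d / (k * t) : ℝ))) ^ t := by
            rw [hW, Real.mul_rpow (x := C * b) (by positivity) (by positivity),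
              Real.mul_rpow (x := C) hC0.le hb.le,
              Real.mul_rpow (x := C) hC0.le (by positivity),
              Real.mul_rpow (x := b) hb.le (by positivity), ← Real.rpow_mul hx.le,
              ← Real.rpow_mul hx.le]
            have e1 : C ^ t = C ^ (t - p) * C ^ p := by
              rw [← Real.rpow_add hC0, sub_add_cancel]
            have e2 : b ^ t = b ^ (t - p) * b ^ p := by
              rw [← Real.rpow_add hb, sub_add_cancel]
            have e3 : x ^ ((d / (2 * k) - d / (k * t)) * t : ℝ) =
                x ^ (d / (2 * k) * (t - p) : ℝ) * x ^ (2 : ℝ) := by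
              rw [← Real.rpow_add hx]
              congr 1
              rw [hpdef]
              field_simp
              ring
            rw [e1, e2, e3]
            ring

/-- The right-hand side of the interpolation inequality. -/
def interpBound (k d : ℕ) (q : ℝ≥0∞) (N : ℕ) (a R : ℝ) : ℝ :=
  max (max a (R / (N : ℝ) ^ k)) (max a (R / (N : ℝ) ^ k) ^ (2 * theta k d q) *
    R ^ (1 - 2 * theta k d q))

lemma interpBound_mono {k d : ℕ} (hd : 1 ≤ d) (hk : (d : ℝ) / 2 < k) (q : ℝ≥0∞) (N : ℕ)
    {a a' R R' : ℝ} (ha : 0 ≤ a) (haa : a ≤ a') (hR : 0 ≤ R) (hRR : R ≤ R') :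
    interpBound k d q N a R ≤ interpBound k d q N a' R' := by
  have h1 := theta_pos hd hk q
  have h2 := two_mul_theta_le_one hd hk q
  have hb : max a (R / (N : ℝ) ^ k) ≤ max a' (R' / (N : ℝ) ^ k) := by gcongr
  have hb0 : 0 ≤ max a (R / (N : ℝ) ^ k) := le_max_of_le_left ha
  unfold interpBound
  refine max_le_max hb (mul_le_mul (Real.rpow_le_rpow hb0 hb (by linarith))
    (Real.rpow_le_rpow hR hRR (by linarith)) (by positivity) ?_)
  exact Real.rpow_nonneg (hb0.trans hb) _

/-- The exponents `2θ` and `1 - 2θ` add up to one, so numerical factors common to both bounds can be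
pulled out. -/
lemma interpBound_mul {k d : ℕ} (q : ℝ≥0∞) (N : ℕ) {a R s : ℝ} (ha : 0 ≤ a) (hR : 0 ≤ R)
    (hs : 0 < s) : interpBound k d q N (s * a) (s * R) = s * interpBound k d q N a R := by
  unfold interpBound
  rw [mul_div_assoc, ← mul_max_of_nonneg _ _ hs.le]
  have hb0 : 0 ≤ max a (R / (N : ℝ) ^ k) := le_max_of_le_left ha
  rw [Real.mul_rpow hs.le hb0, Real.mul_rpow hs.le hR, mul_mul_mul_comm, ← Real.rpow_add hs,
    add_sub_cancel, Real.rpow_one, ← mul_max_of_nonneg _ _ hs.le]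

lemma sobolevInner_self_nonneg (k : ℕ) {d : ℕ} (f : (Fin d → ℝ) → ℝ) : 0 ≤ sobolevInner k f f :=
  Finset.sum_nonneg fun _ _ => integral_nonneg fun _ => mul_self_nonneg _

lemma sobolevNorm_sq (k : ℕ) {d : ℕ} (f : (Fin d → ℝ) → ℝ) :
    sobolevNorm k f ^ 2 = sobolevInner k f f :=
  Real.sq_sqrt (sobolevInner_self_nonneg k f)

/-- The interpolation inequality for partial sums of Fourier series. -/
lemma exists_eLpNorm_trigPoly_le {k d : ℕ} (hd : 1 ≤ d) (hk : (d : ℝ) / 2 < k) {c : ℝ}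
    (hc : 1 < c) :
    ∃ C C₀ : ℝ, 1 ≤ C ∧ 1 ≤ C₀ ∧ ∀ 𝓑 : Set (Set (Fin d → ℝ)), IsNormalSystem c 𝓑 →
      ∀ (N : ℕ), C₀ ≤ N → ∀ (F : Finset (Fin d → ℤ)) (α : (Fin d → ℤ) → ℂ) (a R : ℝ),
      0 < a → 0 < R → multiresNorm 𝓑 (sample N (trigPoly F α)) ≤ a * Real.sqrt ((N : ℝ) ^ d) →
      ∫ x in Set.Icc 0 1, trigGrad k F α x ^ 2 ≤ R ^ 2 → ∀ q : ℝ≥0∞,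
      eLpNorm (trigPoly F α) q (torusMeasure d) ≤
        ENNReal.ofReal (C * interpBound k d q N a R) := by
  have hd0 : (0 : ℝ) < d := by exact_mod_cast hd
  have hd1 : (1 : ℝ) ≤ d := by exact_mod_cast hd
  have hk0' : (0 : ℝ) < k := by linarith
  have hk0 : 0 < k := by exact_mod_cast hk0'
  -- Taylor polynomials have degree `κ = k - 1`, so that the remainder involves the derivatives of
  -- order `k`.
  obtain ⟨κ, rfl⟩ : ∃ κ, k = κ + 1 := ⟨k - 1, by omega⟩
  -- This gives `d / r = d/2 + 1/4`. Since `d < 2k` are integers, `k ≥ (d + 1)/2`, hence `d / r <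
  -- k`, while `1 < r < 2`.
  set r : ℝ := 4 * d / (2 * d + 1) with hrdef
  have hr : 1 < r := by rw [hrdef, lt_div_iff₀ (by positivity)]; linarith
  have hr2 : r < 2 := by rw [hrdef, div_lt_iff₀ (by positivity)]; linarith
  have hkr : d / r < κ + 1 := by
    have e : d / r = d / 2 + 1 / 4 := by rw [hrdef]; field_simp; ring
    have h3 : (d : ℝ) < 2 * ((κ + 1 : ℕ) : ℝ) := by linarith
    have h4 : d < 2 * (κ + 1) := by exact_mod_cast h3
    have h5 : d + 1 ≤ 2 * (κ + 1) := h4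
    have h6 : (d : ℝ) + 1 ≤ 2 * (κ + 1) := by exact_mod_cast h5
    rw [e]
    linarith
  obtain ⟨C₁, C₀, hC₁, hC₀, hloc⟩ := exists_local_estimate κ hd hr hkr hc
  set C₂ := C₁ * (1 + (2 * C₀) ^ (κ + 1)) with hC₂
  set C₅ := C₂ ^ critExp (κ + 1) d *
        (1 + 2 * 2 ^ (2 * (κ + 1 : ℕ) + d : ℝ) * 2 ^ (2 - r) *
          ((2 ^ ((κ + 1 : ℕ) + d / 2 : ℝ)) ^ (2 - r) / ((2 ^ ((κ + 1 : ℕ) + d / 2 : ℝ)) ^ (2 - r) - 1)))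
    with hC₅
  set C := max (2 * C₁) (max C₂ (2 * C₅)) with hC
  have hC1 : 1 ≤ C := le_max_of_le_left (by linarith)
  refine ⟨C, C₀, hC1, hC₀, ?_⟩
  intro 𝓑 h𝓑 N hN F α a R ha hR hmr hgrad q
  have hN0 : (0 : ℝ) < N := by linarith
  set v := trigPoly F α
  set g := trigGrad (κ + 1) F α
  have hT := hasTaylor_trigPoly κ F α
  -- Cells finer than the grid are useless. Enlarging `a` to `b` ensures `R ≤ b N^k`, so the
  -- balancing scale is no finer than the grid spacing.
  set b := max a (R / (N : ℝ) ^ (κ + 1)) with hbdef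
  have hb : 0 < b := lt_max_of_lt_left ha
  have hRN : R ≤ b * (N : ℝ) ^ (κ + 1) := by
    rw [← div_le_iff₀ (by positivity)]
    exact le_max_right _ _
  have H : LocalBound C₁ C₀ (κ + 1) r N b v g := by
    intro M hM hMN m y hy
    have hM' : (0 : ℝ) < M := by exact_mod_cast hM
    have h1 := hloc 𝓑 h𝓑 N v g _ hT _ hmr (cellCorner m) (1 / (M : ℝ)) (by positivity)
      (closedCube_cellCorner_subset hM m) (by
        rw [mul_one_div, le_div_iff₀ hM']; exact hMN) y hy
    refine h1.trans ?_
    have h2 : a * Real.sqrt ((N : ℝ) ^ d) / Real.sqrt ((N * (1 / (M : ℝ))) ^ d) =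
        a * (M : ℝ) ^ (d / 2 : ℝ) := by
      rw [mul_div_assoc, ← Real.sqrt_div (by positivity), ← div_pow, mul_one_div, div_div_cancel₀
        hN0.ne', Real.sqrt_eq_rpow, ← Real.rpow_natCast, ← Real.rpow_mul hM'.le]
      congr 2
      ring
    rw [h2]
    have h3 : a ≤ b := le_max_left _ _
    gcongr
  have hv := continuous_trigPoly F α
  have hg := continuous_trigGrad (κ + 1) F α
  have h0 := trigGrad_nonneg (κ + 1) F α
  have hC₁0 : 0 ≤ C₁ := by linarith
  rcases le_or_gt R b with hRb | hRb
  · refine (eLpNorm_le_of_forall_abs_le q fun y hy =>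
      H.abs_le_of_le hC₁0 hg h0 hr hr2 hR.le hgrad hN hRb hy).trans (ENNReal.ofReal_le_ofReal ?_)
    calc 2 * C₁ * b ≤ C * b := by
          gcongr
          exact le_max_left _ _
      _ ≤ C * interpBound (κ + 1) d q N a R := by
          gcongr
          exact le_max_left _ _
  · have hx : 0 < R / b := by positivity
    have hsup : ∀ y ∈ Set.Icc (0 : Fin d → ℝ) 1,
        |v y| ≤ C * b * (R / b) ^ (d / (2 * (κ + 1 : ℕ)) : ℝ) := by
      intro y hy
      refine (H.abs_le_of_lt hC₁0 hC₀ hk0 hg h0 hr hr2 hR.le hgrad hN hb hRb hRN hy).trans ?_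
      gcongr
      exact (le_max_left _ _).trans (le_max_right _ _)
    have hint : ∫ y in Set.Icc 0 1, |v y| ^ critExp (κ + 1) d ≤
        C * (b ^ critExp (κ + 1) d * (R / b) ^ 2) := by
      refine (H.integral_rpow_le hC₁0 hC₀ hk0 hd hv hg h0 hr hr2 hR.le hgrad hN hb hRN).trans ?_
      rw [← hC₂, ← hC₅]
      have e1 : b ^ critExp (κ + 1) d * (R / b) ^ 2 = b ^ (critExp (κ + 1) d - 2) * R ^ 2 := by
        rw [Real.rpow_sub hb, Real.rpow_two]
        field_simp
      rw [e1]
      have e2 : b ^ critExp (κ + 1) d ≤ b ^ (critExp (κ + 1) d - 2) * R ^ 2 := by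
        rw [← e1]
        refine le_mul_of_one_le_right (by positivity) ?_
        refine one_le_pow₀ ?_
        rw [le_div_iff₀ hb]
        linarith
      have e3 : 2 * C₅ ≤ C := (le_max_right _ _).trans (le_max_right _ _)
      have e4 : 0 ≤ b ^ (critExp (κ + 1) d - 2) * R ^ 2 := by positivity
      have e5 : 0 ≤ C₅ := by
        have h7 : (1 : ℝ) < 2 ^ ((κ + 1 : ℕ) + d / 2 : ℝ) :=
          Real.one_lt_rpow (by norm_num) (by positivity)
        have h8 : (1 : ℝ) < (2 ^ ((κ + 1 : ℕ) + d / 2 : ℝ)) ^ (2 - r) :=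
          Real.one_lt_rpow h7 (by linarith)
        have h9 : (0 : ℝ) < (2 ^ ((κ + 1 : ℕ) + d / 2 : ℝ)) ^ (2 - r) - 1 := by linarith
        have h10 : 0 ≤ C₂ := by positivity
        positivity
      nlinarith
    refine (eLpNorm_le_of_bounds hd hk hv hb hx hC1 hsup hint q).trans
      (ENNReal.ofReal_le_ofReal ?_)
    gcongr
    refine le_trans (le_of_eq ?_) (le_max_right _ _)
    rw [← hbdef, Real.div_rpow hR.le hb.le, sub_eq_add_neg 1, Real.rpow_add hb, Real.rpow_one,
      Real.rpow_neg hb.le]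
    field_simp

/-- The interpolation inequality between the multiresolution norm and the Sobolev norm. -/
lemma exists_eLpNorm_le_interpBound {k d : ℕ} (hd : 1 ≤ d) (hk : (d : ℝ) / 2 < k) {c : ℝ}
    (hc : 1 < c) :
    ∃ C C₀ : ℝ, 1 ≤ C ∧ 1 ≤ C₀ ∧ ∀ 𝓑 : Set (Set (Fin d → ℝ)), IsNormalSystem c 𝓑 →
      ∀ (N : ℕ), C₀ ≤ N → ∀ u ∈ SobolevZero k d, ∀ a R : ℝ, 0 ≤ a →
      multiresNorm 𝓑 (sample N u) ≤ a * Real.sqrt ((N : ℝ) ^ d) → sobolevNorm k u ≤ R →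
      ∀ q : ℝ≥0∞, 1 ≤ q → eLpNorm u q (torusMeasure d) ≤
        ENNReal.ofReal (C * interpBound k d q N a R) := by
  obtain ⟨C, C₀, hC, hC₀, hmain⟩ := exists_eLpNorm_trigPoly_le hd hk hc
  have hd1 : (1 : ℝ) ≤ d := by exact_mod_cast hd
  -- The loss in `integral_sq_trigGrad_le`.
  set D : ℝ := Real.sqrt ((d : ℝ) ^ k)
  have hD : 1 ≤ D := by
    rw [Real.one_le_sqrt]
    exact one_le_pow₀ hd1
  refine ⟨C * D, C₀, by nlinarith, hC₀, ?_⟩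
  intro 𝓑 h𝓑 N hN u hu a R ha hmr hR q hq
  have hR0 : 0 ≤ R := (Real.sqrt_nonneg _).trans hR
  have hk2 : d < 2 * k := by
    have : (d : ℝ) < 2 * k := by linarith
    exact_mod_cast this
  have hth := theta_pos hd hk q
  have hth2 := two_mul_theta_le_one hd hk q
  -- Besides the approximation error, the shift by `ε` makes both bounds strictly positive, as the
  -- estimate for trigonometric polynomials requires. Continuity of `interpBound` in `ε` removes it
  -- afterwards.
  have hstep : ∀ ε : ℝ, 0 < ε → eLpNorm u q (torusMeasure d) ≤
      ENNReal.ofReal (C * interpBound k d q N (a + ε) (D * (R + ε)) + ε) := by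
    intro ε hε
    obtain ⟨F, hF⟩ := exists_trigPoly_approx hk2 hu hε
    set v := trigPoly F (fourierCoef u)
    have hv : Continuous v := continuous_trigPoly _ _
    have h1 : multiresNorm 𝓑 (sample N v) ≤ (a + ε) * Real.sqrt ((N : ℝ) ^ d) := by
      have e : sample N v = sample N u + (sample N v - sample N u) := by abel
      rw [e, add_mul]
      refine (multiresNorm_add_le _ _ _).trans (add_le_add hmr ?_)
      refine multiresNorm_le_sup 𝓑 hε.le fun τ => ?_
      have := hF (gridPoint τ)
      rw [abs_sub_comm] at this
      exact this
    have h2 : ∫ x in Set.Icc 0 1, trigGrad k F (fourierCoef u) x ^ 2 ≤ (D * (R + ε)) ^ 2 := by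
      refine (integral_sq_trigGrad_le hu F).trans ?_
      rw [← sobolevNorm_sq, mul_pow, Real.sq_sqrt (by positivity)]
      have : 0 ≤ sobolevNorm k u := Real.sqrt_nonneg _
      gcongr
      linarith
    have h3 := hmain 𝓑 h𝓑 N hN F (fourierCoef u) (a + ε) (D * (R + ε)) (by linarith)
      (by positivity) h1 h2 q
    have h4 : eLpNorm (u - v) q (torusMeasure d) ≤ ENNReal.ofReal ε :=
      eLpNorm_le_of_forall_abs_le q fun x _ => hF x
    calc eLpNorm u q (torusMeasure d) = eLpNorm (v + (u - v)) q (torusMeasure d) := by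
          rw [add_sub_cancel]
      _ ≤ eLpNorm v q (torusMeasure d) + eLpNorm (u - v) q (torusMeasure d) :=
          eLpNorm_add_le hv.aestronglyMeasurable (hu.1.sub hv).aestronglyMeasurable hq
      _ ≤ ENNReal.ofReal (C * interpBound k d q N (a + ε) (D * (R + ε))) + ENNReal.ofReal ε :=
          add_le_add h3 h4
      _ = _ := by
          rw [ENNReal.ofReal_add _ hε.le]
          refine mul_nonneg (by linarith) (le_max_of_le_left (le_max_of_le_left (by linarith)))
  have hcont : Continuous fun ε : ℝ =>
      C * interpBound k d q N (a + ε) (D * (R + ε)) + ε := by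
    unfold interpBound
    have hb : Continuous fun ε : ℝ => max (a + ε) (D * (R + ε) / (N : ℝ) ^ k) := by fun_prop
    have hR : Continuous fun ε : ℝ => D * (R + ε) := by fun_prop
    exact (continuous_const.mul (hb.max ((hb.rpow_const fun _ => Or.inr (by linarith)).mul
      (hR.rpow_const fun _ => Or.inr (by linarith))))).add continuous_id
  have hlim : Filter.Tendsto (fun ε : ℝ => ENNReal.ofReal
      (C * interpBound k d q N (a + ε) (D * (R + ε)) + ε)) (nhdsWithin 0 (Set.Ioi 0))
      (nhds (ENNReal.ofReal (C * interpBound k d q N a (D * R)))) := by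
    have := (ENNReal.continuous_ofReal.comp hcont).tendsto 0
    simp only [Function.comp, add_zero] at this
    exact this.mono_left nhdsWithin_le_nhds
  refine (ge_of_tendsto hlim (eventually_nhdsWithin_of_forall fun ε hε => hstep ε hε)).trans
    (ENNReal.ofReal_le_ofReal ?_)
  rw [mul_assoc]
  gcongr
  rw [← interpBound_mul q N ha hR0 (by linarith)]
  exact interpBound_mono hd hk q N ha (le_mul_of_one_le_left ha hD) (by positivity) le_rfl

end MIND
end

noncomputable section
namespace MIND

/-! ### The estimator and the distance function -/

lemma zero_mem_SobolevZero (k d : ℕ) : (0 : (Fin d → ℝ) → ℝ) ∈ SobolevZero k d :=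
  ⟨continuous_const, fun _ _ => rfl, by simp, fun m _ I => ⟨0, MemLp.zero, by simp⟩⟩

lemma sobolevInner_zero_right (k : ℕ) {d : ℕ} (f : (Fin d → ℝ) → ℝ) :
    sobolevInner k f (0 : (Fin d → ℝ) → ℝ) = 0 := by
  refine Finset.sum_eq_zero fun I _ => ?_
  have h0 := zero_mem_SobolevZero k d
  have h : weakDeriv I (0 : (Fin d → ℝ) → ℝ) =ᵐ[torusMeasure d] 0 :=
    (SobolevZero.isWeakDeriv h0 I).ae_unique (SobolevZero.memLp h0) ⟨MemLp.zero, by simp⟩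
  rw [integral_eq_zero_of_ae]
  filter_upwards [h] with x hx
  simp [hx]

/-- With `u = f' - f`, the hypothesis gives `‖u‖² ≤ -2⟨u, f⟩ = 2⟨u, w - f⟩ - 2⟨u, w⟩`, and Young's
inequality absorbs the first term. The proof works pointwise on weak derivatives: the two sides of
`key` differ by the integral of `½ (u - 2 (w - f))²`. -/
lemma sobolevNorm_sub_sq_le {k d : ℕ} {f f' w : (Fin d → ℝ) → ℝ} (hf : f ∈ SobolevZero k d)
    (hf' : f' ∈ SobolevZero k d) (hw : w ∈ SobolevZero k d)
    (h : sobolevInner k f' f' ≤ sobolevInner k f f) :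
    sobolevNorm k (f' - f) ^ 2 ≤ 4 * sobolevNorm k (w - f) ^ 2 - 4 * sobolevInner k (f' - f) w := by
  have hi : ∀ u v : (Fin d → ℝ) → ℝ, u ∈ SobolevZero k d → v ∈ SobolevZero k d →
      ∀ I : Fin k → Fin d, Integrable (fun x => weakDeriv I u x * weakDeriv I v x)
        (torusMeasure d) := fun u v hu hv I =>
    (SobolevZero.isWeakDeriv hu I).1.integrable_mul (SobolevZero.isWeakDeriv hv I).1
  have hu := SobolevZero.sub hf' hf
  have hwf := SobolevZero.sub hw hf
  have key : 1 / 2 * sobolevInner k (f' - f) (f' - f) ≤ sobolevInner k f' f' - sobolevInner k f f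
      + 2 * sobolevInner k (w - f) (w - f) - 2 * sobolevInner k (f' - f) w := by
    simp only [sobolevInner, Finset.mul_sum]
    rw [← Finset.sum_sub_distrib, ← Finset.sum_add_distrib, ← Finset.sum_sub_distrib]
    refine Finset.sum_le_sum fun I _ => ?_
    have i1 := hi _ _ hu hu I
    have i2 := hi _ _ hf' hf' I
    have i3 := hi _ _ hf hf I
    have i4 := hi _ _ hwf hwf I
    have i5 := hi _ _ hu hw I
    simp only [← integral_const_mul]
    have i23 : Integrable (fun x => weakDeriv I f' x * weakDeriv I f' x -
        weakDeriv I f x * weakDeriv I f x) (torusMeasure d) := i2.sub i3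
    have i234 : Integrable (fun x => weakDeriv I f' x * weakDeriv I f' x -
        weakDeriv I f x * weakDeriv I f x +
        2 * (weakDeriv I (w - f) x * weakDeriv I (w - f) x)) (torusMeasure d) :=
      i23.add (i4.const_mul 2)
    rw [← integral_sub i2 i3, ← integral_add i23 (i4.const_mul 2),
      ← integral_sub i234 (i5.const_mul 2)]
    refine integral_mono_ae (i1.const_mul _) (i234.sub (i5.const_mul 2)) ?_
    filter_upwards [weakDeriv_sub hf' hf I, weakDeriv_sub hw hf I] with x h1 h2
    simp only [h1, h2, Pi.sub_apply]
    nlinarith [sq_nonneg (weakDeriv I f' x - weakDeriv I f x -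
      2 * (weakDeriv I w x - weakDeriv I f x))]
  rw [sobolevNorm_sq, sobolevNorm_sq]
  linarith

lemma neg_sum_le_of_dualMultiresNorm_le {d N : ℕ} {𝓑 : Set (Set (Fin d → ℝ))}
    {ω u : (Fin d → Fin N) → ℝ} {t : ℝ≥0} (hω : dualMultiresNorm 𝓑 ω ≤ t) {s : ℝ}
    (hs : multiresNorm 𝓑 u ≤ s) : -(∑ τ, u τ * ω τ) ≤ s * t := by
  have hs0 : 0 ≤ s := (multiresNorm_nonneg _ _).trans hs
  refine le_of_forall_pos_le_add fun δ hδ => ?_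
  -- Normalizing by `s + ε` allows `s = 0`; the resulting excess `ε t` is at most `δ`. The scalar is
  -- negative because the lower bound for the pairing is needed.
  set ε : ℝ := δ / (t + 1)
  have hε : 0 < ε := by positivity
  set v : (Fin d → Fin N) → ℝ := (-(s + ε)⁻¹) • u
  have hsε : 0 < s + ε := by linarith
  have hv : multiresNorm 𝓑 v ≤ 1 := by
    refine (multiresNorm_smul_le _ _ _).trans ?_
    rw [abs_neg, abs_of_pos (inv_pos.2 hsε), inv_mul_le_iff₀ hsε]
    linarith
  have h1 : ENNReal.ofReal (∑ τ, ω τ * v τ) ≤ t :=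
    (le_iSup₂ (f := fun (v : (Fin d → Fin N) → ℝ) (_ : multiresNorm 𝓑 v ≤ 1) =>
      ENNReal.ofReal (∑ τ, ω τ * v τ)) v hv).trans hω
  have h2 : ∑ τ, ω τ * v τ ≤ t := by
    rw [ENNReal.ofReal_le_iff_le_toReal ENNReal.coe_ne_top] at h1
    simpa using h1
  have h3 : ∑ τ, ω τ * v τ = (s + ε)⁻¹ * -(∑ τ, u τ * ω τ) := by
    rw [← Finset.sum_neg_distrib, Finset.mul_sum]
    refine Finset.sum_congr rfl fun τ _ => ?_
    simp only [v, Pi.smul_apply, smul_eq_mul]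
    ring
  rw [h3, inv_mul_le_iff₀ hsε] at h2
  have h4 : ε * t ≤ δ := by
    have : ε * (t + 1) = δ := div_mul_cancel₀ _ (by positivity)
    nlinarith
  linarith

lemma multiresNorm_sample_sub_le {d N : ℕ} {𝓑 : Set (Set (Fin d → ℝ))}
    {f f' : (Fin d → ℝ) → ℝ} {y : (Fin d → Fin N) → ℝ} {γ : ℝ}
    (h : multiresNorm 𝓑 (sample N f - y) ≤ γ) (h' : multiresNorm 𝓑 (sample N f' - y) ≤ γ) :
    multiresNorm 𝓑 (sample N (f' - f)) ≤ 2 * γ := by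
  have e : sample N (f' - f) = (sample N f' - y) + (-1 : ℝ) • (sample N f - y) := by
    ext τ
    simp [sample]
  rw [e]
  have h1 := multiresNorm_add_le 𝓑 (sample N f' - y) ((-1 : ℝ) • (sample N f - y))
  have h2 := multiresNorm_smul_le 𝓑 (-1) (sample N f - y)
  rw [abs_neg, abs_one, one_mul] at h2
  linarith

/-- The Sobolev error of a MIND estimator. -/
lemma sobolevNorm_sub_le_cMin {k d N : ℕ} {𝓑 : Set (Set (Fin d → ℝ))} {f f' : (Fin d → ℝ) → ℝ}
    {y : (Fin d → Fin N) → ℝ} {γ : ℝ} (hf : f ∈ SobolevZero k d)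
    (hfy : multiresNorm 𝓑 (sample N f - y) ≤ γ) (hf' : IsMINDEstimator k 𝓑 y γ f') :
    sobolevNorm k (f' - f) ≤ 3 * cMin k N 𝓑 f γ := by
  have hγ : 0 ≤ γ := (multiresNorm_nonneg _ _).trans hfy
  have hmin : sobolevInner k f' f' ≤ sobolevInner k f f := by
    have := hf'.2 f hf hfy
    rw [sobolevNorm_sq, sobolevNorm_sq] at this
    linarith
  have hmr := multiresNorm_sample_sub_le hfy hf'.1.2
  rw [← div_le_iff₀' (by norm_num)]
  refine le_ciInf fun t => ?_
  rw [← sub_le_iff_le_add]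
  -- `ω = 0`, `w = 0` shows that the infimum is over a nonempty set.
  refine le_csInf ⟨_, 0, 0, ?_, ⟨zero_mem_SobolevZero k d, fun u _ => ?_⟩, rfl⟩ ?_
  · simp [dualMultiresNorm]
  · simp [sobolevInner_zero_right]
  · rintro r ⟨ω, w, hω, hw, rfl⟩
    have h1 := sobolevNorm_sub_sq_le hf hf'.1.1 hw.1 hmin
    have h2 := neg_sum_le_of_dualMultiresNorm_le hω hmr
    rw [hw.2 _ (SobolevZero.sub hf'.1.1 hf)] at h2
    have hr : 0 ≤ sobolevNorm k (w - f) := Real.sqrt_nonneg _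
    set r := sobolevNorm k (w - f)
    have hq := Real.sq_sqrt (show 0 ≤ γ * t by positivity)
    have hq0 := Real.sqrt_nonneg (γ * t)
    set s := Real.sqrt (γ * t)
    -- The residual bound `2γ` gives `4 r^2 + 8 γ t`, and `γ t = s^2`.
    have h3 : sobolevNorm k (f' - f) ^ 2 ≤ (3 * (r + s)) ^ 2 := by nlinarith
    have h4 := le_of_sq_le_sq h3 (by positivity)
    linarith

lemma cMin_nonneg (k : ℕ) {d : ℕ} (N : ℕ) (𝓑 : Set (Set (Fin d → ℝ))) (f : (Fin d → ℝ) → ℝ)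
    (γ : ℝ) : 0 ≤ cMin k N 𝓑 f γ := by
  refine Real.iInf_nonneg fun t => add_nonneg (Real.sInf_nonneg ?_) (Real.sqrt_nonneg _)
  rintro r ⟨ω, w, -, -, rfl⟩
  exact Real.sqrt_nonneg _

/-! ### The rate -/

/-- With `α = γ / √n`, each term of the rate is one regime: `ρ ≤ α` gives `γ / √n`; `α ≤ ρ / N^k`
gives `ρ N^(-2kθ) = ρ n^(-θ')`; the intermediate range gives the product term. -/
lemma interpBound_le_max {k d N : ℕ} (hd : 1 ≤ d) (hk : (d : ℝ) / 2 < k) (hN : 1 ≤ N) (q : ℝ≥0∞)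
    {γ ρ : ℝ} (hγ : 0 ≤ γ) (hρ : 0 ≤ ρ) :
    interpBound k d q N (γ / Real.sqrt ((N : ℝ) ^ d)) ρ ≤
      max (γ ^ (2 * theta k d q) * ρ ^ (1 - 2 * theta k d q) / ((N : ℝ) ^ d) ^ theta k d q)
        (max (γ / ((N : ℝ) ^ d) ^ (1 / 2 : ℝ)) (ρ / ((N : ℝ) ^ d) ^ theta' k d q)) := by
  have hth := theta_pos hd hk q
  have hth2 := two_mul_theta_le_one hd hk q
  have hN1 : (1 : ℝ) ≤ N := by exact_mod_cast hN
  have hN0 : (0 : ℝ) < N := by linarith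
  have hd0 : (0 : ℝ) < d := by exact_mod_cast hd
  have hn : (0 : ℝ) < (N : ℝ) ^ d := by positivity
  set θ := theta k d q
  set α := γ / Real.sqrt ((N : ℝ) ^ d) with hα
  have hα0 : 0 ≤ α := by positivity
  have hαe : γ / ((N : ℝ) ^ d) ^ (1 / 2 : ℝ) = α := by rw [hα, Real.sqrt_eq_rpow]
  have hβρ : ρ / (N : ℝ) ^ k ≤ ρ := div_le_self hρ (one_le_pow₀ hN1)
  have hβ0 : 0 ≤ ρ / (N : ℝ) ^ k := by positivity
  rw [hαe]
  have hone : ∀ x : ℝ, 0 ≤ x → x ^ (2 * θ) * x ^ (1 - 2 * θ) = x := by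
    intro x hx
    rw [← Real.rpow_add' hx (by norm_num), add_sub_cancel, Real.rpow_one]
  rcases le_or_gt ρ α with h | h
  · refine le_trans ?_ ((le_max_left _ _).trans (le_max_right _ _))
    have hb : max α (ρ / (N : ℝ) ^ k) = α := max_eq_left (hβρ.trans h)
    unfold interpBound
    rw [hb]
    refine max_le le_rfl ?_
    calc α ^ (2 * θ) * ρ ^ (1 - 2 * θ) ≤ α ^ (2 * θ) * α ^ (1 - 2 * θ) := by
          gcongr
      _ = α := hone α hα0
  · set b := max α (ρ / (N : ℝ) ^ k) with hb
    have hbρ : b ≤ ρ := max_le h.le hβρ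
    have hb0 : 0 ≤ b := le_max_of_le_left hα0
    have h1 : interpBound k d q N α ρ = b ^ (2 * θ) * ρ ^ (1 - 2 * θ) := by
      refine max_eq_right ?_
      calc b = b ^ (2 * θ) * b ^ (1 - 2 * θ) := (hone b hb0).symm
        _ ≤ b ^ (2 * θ) * ρ ^ (1 - 2 * θ) := by
            gcongr
    rw [h1]
    rcases le_total α (ρ / (N : ℝ) ^ k) with h2 | h2
    · refine le_trans (le_of_eq ?_) ((le_max_right _ _).trans (le_max_right _ _))
      rw [hb, max_eq_right h2, Real.div_rpow hρ (by positivity), div_mul_eq_mul_div, hone ρ hρ]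
      congr 1
      rw [← Real.rpow_natCast, ← Real.rpow_natCast, ← Real.rpow_mul hN0.le, ← Real.rpow_mul hN0.le]
      congr 1
      rw [theta']
      field_simp
      rfl
    · refine le_trans (le_of_eq ?_) (le_max_left _ _)
      rw [hb, max_eq_left h2, hα, Real.div_rpow hγ (by positivity), Real.sqrt_eq_rpow,
        ← Real.rpow_mul hn.le, div_mul_eq_mul_div]
      congr 2
      ring

end MIND
end

/-! ### The error bound for MIND estimators -/

theorem mainTheorem1 (k d : ℕ) (hd : 1 ≤ d) (hk : (d : ℝ) / 2 < k) (c : ℝ) (hc : 1 < c) :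
    ∃ C : ℝ, 0 < C ∧ ∃ n₀ : ℕ,
      ∀ (q : ℝ≥0∞), 1 ≤ q →
      ∀ 𝓑 : Set (Set (Fin d → ℝ)), MIND.IsNormalSystem c 𝓑 →
      ∀ n N : ℕ, n = N ^ d → n₀ ≤ n →
      ∀ (f : (Fin d → ℝ) → ℝ) (y : (Fin d → Fin N) → ℝ) (γ : ℝ),
        f ∈ MIND.SobolevZero k d →
        MIND.multiresNorm 𝓑 (MIND.sample N f - y) ≤ γ →
      ∀ f' : (Fin d → ℝ) → ℝ, MIND.IsMINDEstimator k 𝓑 y γ f' →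
        eLpNorm (f' - f) q (MIND.torusMeasure d) ≤
          ENNReal.ofReal (C *
            max (γ ^ (2 * MIND.theta k d q) *
                  MIND.cMin k N 𝓑 f γ ^ (1 - 2 * MIND.theta k d q) / (n : ℝ) ^ MIND.theta k d q)
              (max (γ / (n : ℝ) ^ (1 / 2 : ℝ))
                (MIND.cMin k N 𝓑 f γ / (n : ℝ) ^ MIND.theta' k d q))) := by
  obtain ⟨C, C₀, hC, hC₀, hmain⟩ := MIND.exists_eLpNorm_le_interpBound hd hk hc
  refine ⟨C * 3, by linarith, ⌈C₀⌉₊ ^ d, ?_⟩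
  rintro q hq 𝓑 h𝓑 n N rfl hn f y γ hf hfy f' hf'
  have hN : ⌈C₀⌉₊ ≤ N := (Nat.pow_le_pow_iff_left (by omega)).1 hn
  have hN' : C₀ ≤ N := Nat.ceil_le.1 hN
  have hN1 : 1 ≤ N := by
    have : (1 : ℝ) ≤ N := hC₀.trans hN'
    exact_mod_cast this
  have hγ : 0 ≤ γ := (MIND.multiresNorm_nonneg _ _).trans hfy
  have hc0 := MIND.cMin_nonneg k N 𝓑 f γ
  have hs : 0 < Real.sqrt ((N : ℝ) ^ d) := Real.sqrt_pos.2 (by positivity)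
  have hα : 0 ≤ γ / Real.sqrt ((N : ℝ) ^ d) := by positivity
  -- The data bound `2γ` is relaxed to `3γ` to match the factor `3` of the Sobolev bound, so that
  -- homogeneity extracts a single factor.
  refine (hmain 𝓑 h𝓑 N hN' (f' - f) (MIND.SobolevZero.sub hf'.1.1 hf)
    (3 * (γ / Real.sqrt ((N : ℝ) ^ d))) (3 * MIND.cMin k N 𝓑 f γ) (by positivity) ?_
    (MIND.sobolevNorm_sub_le_cMin hf hfy hf') q hq).trans (ENNReal.ofReal_le_ofReal ?_)
  · rw [mul_assoc, div_mul_cancel₀ _ hs.ne']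
    exact (MIND.multiresNorm_sample_sub_le hfy hf'.1.2).trans (by linarith)
  · rw [MIND.interpBound_mul q N hα hc0 (by norm_num), ← mul_assoc]
    push_cast
    exact mul_le_mul_of_nonneg_left (MIND.interpBound_le_max hd hk hN1 q hγ hc0) (by linarith)
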